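/- \textbf{Trees.} Consider plane trees with a marked leaf (the root leaf); non-leaf vertices are called nodes. Leaves are either \emph{opening} or \emph{closing}, there are as many opening as closing leaves, and the root leaf is opening. Such a tree is an \emph{Eulerian tree} if each node has even degree and each node of degree $2k$ has exactly $k-1$ adjacent opening leaves, the root leaf not being counted. (The tree made of a single edge joining two leaves is allowed; it is called nodeless.) Let $i\ge 1$. Walk clockwise around the tree from the root leaf (excluded) and record a step $+1$ for each opening leaf and $-1$ for each closing leaf, starting from height $i$. The tree is \emph{$i$-balanced} if this path stays $\ge 0$ (it then goes from $i$ to $i-1$); the \emph{$i$-height} of a closing leaf is the height from which its down-step descends. An \emph{$i$-enriched Eulerian tree} is an $i$-balanced Eulerian tree in which each closing leaf of $i$-height $h$ carries an index in $\{0,\dots,h-1\}$. \textbf{Maps.} Maps are connected, drawn on orientable surfaces of arbitrary genus, rooted at a corner, with at least one edge, and taken up to isomorphism; the root half-edge is the half-edge following the root corner in clockwise order around its vertex, the root vertex. A \emph{marked Eulerian map with multiplicities} is a rooted map with all vertex degrees even, in which some edges are marked, and each marked edge is given a fixed orientation and a multiplicity in $\{1,2,\dots\}$. It is \emph{admissible}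 if its edges can be oriented so that every vertex has outdegree equal to half its degree, marked edges have their fixed orientation, from each vertex there is a directed path to the root vertex using no marked edge, and the root half-edge is outgoing. Let $\mathcal R_i$ be the set of admissible marked Eulerian maps with multiplicities whose multiplicities sum to less than $i$. Let $\mathcal R_i^+$ be $\mathcal R_i$ together with $i$ conventional maps without vertex: a closed curve, seen as an edge without endpoint, either unmarked or marked with a multiplicity in $\{1,\dots,i-1\}$; their total half-degree is $0$. \textbf{Series.} Let $(r_i(t))_{i\ge 0}$ be the power series in $t$ with coefficients in $\mathbb Z[g_1,g_2,\dots]$ determined uniquely by $$r_i(t)=i+\sum_{k\ge1}t^kg_k\sum_{\wp\in\mathcal P_k^{(i)}}\ \prod_{\text{down-steps }h\to h-1\text{ of }\wp}r_h(t),$$ where $\mathcal P_k^{(i)}$ is the set of walks on $\mathbb N$ with steps $\pm1$ and length $2k-1$, from height $i$ to height $i-1$ (in particular $r_0=0$). \textbf{Proposition.} Let $i\ge1$. There is a bijection from the set of $i$-enriched Eulerian trees to $\mathcal R_i^+$, sending the trees with at least one node onto $\mathcal R_i$ (and the nodeless ones onto the conventional maps), such that for every $k$ the number of nodes of degree $2k$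 of a tree equals the number of vertices of degree $2k$ of its image. In particular the total half-degree $E$ of the nodes of the tree equals the total half-degree of the vertices of its image; for a map in $\mathcal R_i$ the latter is the number of edges. There are finitely many objects of each total half-degree $E$, and, with weight $t^E\prod_k g_k^{n_k}$ for an object having $n_k$ nodes (vertices) of degree $2k$ for each $k$, both the $i$-enriched Eulerian trees and $\mathcal R_i^+$ have generating function $r_i(t)$, and $\mathcal R_i$ has generating function $r_i(t)-i$. -/

import Mathlib

namespace EulerianMaps

/-! ## Blossoming trees -/

/-- What hangs below an edge of a rooted plane tree whose leaves are opening or closing: a leaf, or a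
node with `n` further incident edges, listed in clockwise order starting after the edge that leads to
the root. A rooted plane tree (marked leaf = root leaf) is encoded by what hangs from its root edge;
the root leaf itself, always an opening leaf, is left implicit. A node with `n` children has degree
`n + 1`. -/
inductive PlantedTree : Type
  | opening : PlantedTree
  | closing : PlantedTree
  | node (n : ℕ) (child : Fin n → PlantedTree) : PlantedTree

namespace PlantedTree

def isOpening : PlantedTree → Bool
  | opening => true
  | closing => false
  | node _ _ => false

/-- The tree has at least one node. -/
def HasNode : PlantedTree → Prop
  | opening => False
  | closing => False
  | node _ _ => True

/-- The steps of the leaf-path: the leaves other than the root leaf, in the order of a clockwise walk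
around the tree from the root leaf, with `+1` for an opening and `-1` for a closing leaf. -/
def leafSteps : PlantedTree → List ℤ
  | opening => [1]
  | closing => [-1]
  | node _ child => (List.ofFn fun j => (child j).leafSteps).flatten

/-- As many opening leaves (counting the root leaf) as closing leaves. -/
def IsBlossoming (T : PlantedTree) : Prop :=
  T.leafSteps.count 1 + 1 = T.leafSteps.count (-1)

/-- Each node has even degree `2 k` and `k - 1` adjacent opening leaves, not counting the root leaf. -/
def IsEulerian : PlantedTree → Prop
  | opening => True
  | closing => True
  | node n child =>
      (∃ k : ℕ, n + 1 = 2 * k ∧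
        (Finset.univ.filter fun j : Fin n => (child j).isOpening = true).card + 1 = k) ∧
      ∀ j, (child j).IsEulerian

/-- Height of the leaf-path, shifted so as to start at height `i`, after `j` steps. -/
def pathHeight (i : ℕ) (T : PlantedTree) (j : ℕ) : ℤ :=
  i + (T.leafSteps.take j).sum

/-- The leaf-path, shifted to start at `i`, is a walk on `ℕ` from `i` to `i - 1`. -/
def IsBalanced (i : ℕ) (T : PlantedTree) : Prop :=
  (∀ j ≤ T.leafSteps.length, 0 ≤ T.pathHeight i j) ∧
    T.pathHeight i T.leafSteps.length = (i : ℤ) - 1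

/-- The closing leaves, as positions of down-steps of the leaf-path. -/
def ClosingLeaf (T : PlantedTree) : Type :=
  {j : Fin T.leafSteps.length // T.leafSteps.get j = -1}

/-- The `i`-height of a closing leaf: the height from which its down-step descends. -/
def iHeight (i : ℕ) (T : PlantedTree) (c : T.ClosingLeaf) : ℤ :=
  T.pathHeight i c.1

/-- The number of nodes of degree `2 k`. -/
def nodeCount (k : ℕ) : PlantedTree → ℕ
  | opening => 0
  | closing => 0
  | node n child => (if n + 1 = 2 * k then 1 else 0) + ∑ j, (child j).nodeCount k

/-- The sum over all nodes of half of the degree. -/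
def halfDegree : PlantedTree → ℕ
  | opening => 0
  | closing => 0
  | node n child => (n + 1) / 2 + ∑ j, (child j).halfDegree

end PlantedTree

/-- An `i`-enriched Eulerian tree: an `i`-balanced Eulerian (blossoming) tree where each closing leaf
of `i`-height `h` carries an index in `{0, …, h - 1}`. -/
structure EnrichedTree (i : ℕ) : Type where
  tree : PlantedTree
  blossoming : tree.IsBlossoming
  eulerian : tree.IsEulerian
  balanced : tree.IsBalanced i
  index : ∀ c : tree.ClosingLeaf, Fin (tree.iHeight i c).toNat

/-! ## Rooted maps and marked maps -/

/-- A connected rooted map (on an orientable surface of any genus, with at least one edge) with set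
`D` of half-edges: `next` sends a half-edge to the next one in clockwise order around its vertex,
`opp` to the other half of its edge, and `root` is the root half-edge. -/
structure RootedMap (D : Type) : Type where
  next : Equiv.Perm D
  opp : Equiv.Perm D
  opp_opp : ∀ d, opp (opp d) = d
  opp_ne : ∀ d, opp d ≠ d
  connected : ∀ d e, ∃ g ∈ Subgroup.closure ({next, opp} : Set (Equiv.Perm D)), g d = e
  root : D

/-- A marked map with multiplicities: some edges are marked and oriented, each with a positive
multiplicity. If `d` is the half-edge at the origin of a marked edge then `mult d` is the
multiplicity of that edge; on all other half-edges `mult` is `0`. -/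
structure MarkedMap (D : Type) : Type extends RootedMap D where
  mult : D → ℕ
  mult_opp : ∀ d, mult d ≠ 0 → mult (opp d) = 0

namespace MarkedMap

variable {D : Type}

/-- Isomorphism of marked maps with multiplicities, preserving the root. -/
structure IsIso {D' : Type} (M : MarkedMap D) (M' : MarkedMap D') (f : D ≃ D') : Prop where
  next : ∀ d, f (M.next d) = M'.next (f d)
  opp : ∀ d, f (M.opp d) = M'.opp (f d)
  root : f M.root = M'.root
  mult : ∀ d, M'.mult (f d) = M.mult d

section Isomorphism

variable {D' : Type} {M : MarkedMap D} {M' : MarkedMap D'} {f : D ≃ D'}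

theorem IsIso.refl (M : MarkedMap D) : M.IsIso M (Equiv.refl D) :=
  ⟨fun _ => rfl, fun _ => rfl, rfl, fun _ => rfl⟩

theorem IsIso.symm (h : M.IsIso M' f) : M'.IsIso M f.symm where
  next d := by rw [Equiv.symm_apply_eq, h.next, Equiv.apply_symm_apply]
  opp d := by rw [Equiv.symm_apply_eq, h.opp, Equiv.apply_symm_apply]
  root := by rw [Equiv.symm_apply_eq, h.root]
  mult d := by rw [← h.mult, Equiv.apply_symm_apply]

theorem IsIso.trans {D'' : Type} {M'' : MarkedMap D''} {g : D' ≃ D''} (h : M.IsIso M' f)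
    (h' : M'.IsIso M'' g) : M.IsIso M'' (f.trans g) where
  next d := by simp [h.next, h'.next]
  opp d := by simp [h.opp, h'.opp]
  root := by simp [h.root, h'.root]
  mult d := by simp [h.mult, h'.mult]

theorem IsIso.next_eq (h : M.IsIso M' f) : M'.next = (f.symm.trans M.next).trans f := by
  ext d
  simp [h.next]

theorem IsIso.sameCycle (h : M.IsIso M' f) (d e : D) :
    M'.next.SameCycle (f d) (f e) ↔ M.next.SameCycle d e := by
  have key : ∀ n : ℤ, (M'.next ^ n) (f d) = f ((M.next ^ n) d) := by
    have h1 : M'.next = f.permCongrHom M.next := by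
      rw [h.next_eq]; rfl
    intro n
    rw [h1, ← map_zpow]
    simp [Equiv.permCongrHom, Equiv.permCongr_apply]
  simp only [Equiv.Perm.SameCycle, key, f.injective.eq_iff]

end Isomorphism

variable [Fintype D]

open Classical in
/-- The vertex at a half-edge, as the set of its incident half-edges. -/
noncomputable def vertexOf (M : MarkedMap D) (d : D) : Finset D :=
  Finset.univ.filter fun e => M.next.SameCycle d e

open Classical in
/-- The vertices; the degree of the vertex `v` is `v.card`. -/
noncomputable def vertices (M : MarkedMap D) : Finset (Finset D) :=
  Finset.univ.image M.vertexOf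

open Classical in
noncomputable def edges (M : MarkedMap D) : Finset (Finset D) :=
  Finset.univ.image fun d => {d, M.opp d}

/-- Every vertex has even degree. -/
def IsEulerian (M : MarkedMap D) : Prop := ∀ v ∈ M.vertices, Even v.card

/-- An orientation of the edges, given by the set of outgoing half-edges. -/
def IsOrientation (M : MarkedMap D) (out : Set D) : Prop := ∀ d, d ∈ out ↔ M.opp d ∉ out

/-- Agreement with the given orientation of the marked edges. -/
def IsCompatible (M : MarkedMap D) (out : Set D) : Prop := ∀ d, M.mult d ≠ 0 → d ∈ out

open Classical in
/-- The outdegree of each vertex is half of its degree. -/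
def IsEulerianOrientation (M : MarkedMap D) (out : Set D) : Prop :=
  M.IsOrientation out ∧ ∀ v ∈ M.vertices, 2 * (v.filter (· ∈ out)).card = v.card

/-- There is an unmarked edge directed from the vertex `v` to the vertex `w`. -/
def Step (M : MarkedMap D) (out : Set D) (v w : Finset D) : Prop :=
  ∃ d ∈ out, M.mult d = 0 ∧ M.mult (M.opp d) = 0 ∧ M.vertexOf d = v ∧ M.vertexOf (M.opp d) = w

/-- From each vertex there is a directed path of unmarked edges to the root vertex. -/
def IsRootAccessible (M : MarkedMap D) (out : Set D) : Prop :=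
  ∀ v ∈ M.vertices, Relation.ReflTransGen (M.Step out) v (M.vertexOf M.root)

/-- There is a compatible, root-accessible Eulerian orientation where the root half-edge is outgoing. -/
def IsAdmissible (M : MarkedMap D) : Prop :=
  ∃ out : Set D, M.IsEulerianOrientation out ∧ M.IsCompatible out ∧ M.IsRootAccessible out ∧
    M.root ∈ out

/-- The sum of the multiplicities of the marked edges. -/
def totalMult (M : MarkedMap D) : ℕ := ∑ d, M.mult d

/-- The number of vertices of degree `2 k`. -/
noncomputable def vertexCount (M : MarkedMap D) (k : ℕ) : ℕ :=
  (M.vertices.filter fun v => v.card = 2 * k).card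

/-- The sum over all vertices of half of the degree. -/
noncomputable def halfDegree (M : MarkedMap D) : ℕ := ∑ v ∈ M.vertices, v.card / 2

noncomputable def edgeCount (M : MarkedMap D) : ℕ := M.edges.card

section Invariance

variable {D' : Type} [Fintype D'] {M : MarkedMap D} {M' : MarkedMap D'} {f : D ≃ D'}

theorem IsIso.vertexOf (h : M.IsIso M' f) (d : D) :
    M'.vertexOf (f d) = (M.vertexOf d).map f.toEmbedding := by
  ext e
  obtain ⟨e, rfl⟩ := f.surjective e
  simp [MarkedMap.vertexOf, h.sameCycle]

theorem IsIso.vertices (h : M.IsIso M' f) :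
    M'.vertices = M.vertices.map (Finset.mapEmbedding f.toEmbedding).toEmbedding := by
  ext v
  simp only [MarkedMap.vertices, Finset.mem_image, Finset.mem_univ, true_and, Finset.mem_map]
  constructor
  · rintro ⟨d, rfl⟩
    obtain ⟨d, rfl⟩ := f.surjective d
    exact ⟨_, ⟨d, rfl⟩, (h.vertexOf d).symm⟩
  · rintro ⟨_, ⟨d, rfl⟩, rfl⟩
    exact ⟨f d, h.vertexOf d⟩

theorem IsIso.edges (h : M.IsIso M' f) :
    M'.edges = M.edges.map (Finset.mapEmbedding f.toEmbedding).toEmbedding := by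
  classical
  have key : ∀ d, ({f d, M'.opp (f d)} : Finset D') =
      ({d, M.opp d} : Finset D).map f.toEmbedding := by
    intro d
    simp [← h.opp]
  ext v
  simp only [MarkedMap.edges, Finset.mem_image, Finset.mem_univ, true_and, Finset.mem_map]
  constructor
  · rintro ⟨d, rfl⟩
    obtain ⟨d, rfl⟩ := f.surjective d
    refine ⟨_, ⟨d, rfl⟩, ?_⟩
    convert (key d).symm using 2
    simp
  · rintro ⟨_, ⟨d, rfl⟩, rfl⟩
    refine ⟨f d, ?_⟩
    convert key d using 2
    simp

theorem IsIso.vertexCount (h : M.IsIso M' f) (k : ℕ) : M.vertexCount k = M'.vertexCount k := by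
  simp [MarkedMap.vertexCount, h.vertices, Finset.filter_map]

theorem IsIso.halfDegree (h : M.IsIso M' f) : M.halfDegree = M'.halfDegree := by
  simp [MarkedMap.halfDegree, h.vertices]

theorem IsIso.edgeCount (h : M.IsIso M' f) : M.edgeCount = M'.edgeCount := by
  simp [MarkedMap.edgeCount, h.edges]

theorem IsIso.totalMult (h : M.IsIso M' f) : M.totalMult = M'.totalMult := by
  simp only [MarkedMap.totalMult]
  exact Fintype.sum_equiv f _ _ fun d => (h.mult d).symm

end Invariance

end MarkedMap

/-- An admissible marked Eulerian map with multiplicities, its half-edges labelled by `Fin n`. -/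
structure LabelledMap : Type where
  n : ℕ
  map : MarkedMap (Fin n)
  eulerian : map.IsEulerian
  admissible : map.IsAdmissible

instance LabelledMap.setoid : Setoid LabelledMap where
  r M M' := ∃ f, M.map.IsIso M'.map f
  iseqv :=
    { refl := fun M => ⟨_, MarkedMap.IsIso.refl M.map⟩
      symm := fun ⟨_, h⟩ => ⟨_, h.symm⟩
      trans := fun ⟨_, h⟩ ⟨_, h'⟩ => ⟨_, h.trans h'⟩ }

/-- Admissible marked Eulerian maps with multiplicities (up to isomorphism). -/
def AdmissibleMap : Type := Quotient LabelledMap.setoid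

namespace AdmissibleMap

noncomputable def vertexCount (k : ℕ) : AdmissibleMap → ℕ :=
  Quotient.lift (fun M => M.map.vertexCount k) fun _ _ ⟨_, h⟩ => h.vertexCount k

noncomputable def halfDegree : AdmissibleMap → ℕ :=
  Quotient.lift (fun M => M.map.halfDegree) fun _ _ ⟨_, h⟩ => h.halfDegree

noncomputable def edgeCount : AdmissibleMap → ℕ :=
  Quotient.lift (fun M => M.map.edgeCount) fun _ _ ⟨_, h⟩ => h.edgeCount

def totalMult : AdmissibleMap → ℕ :=
  Quotient.lift (fun M => M.map.totalMult) fun _ _ ⟨_, h⟩ => h.totalMult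

end AdmissibleMap

/-- The admissible marked Eulerian maps with multiplicities, together with the conventional maps
without vertex: a closed curve, regarded as one edge, which is either unmarked (`none`) or marked with
a multiplicity. -/
inductive ExtendedMap : Type
  | vertexless (μ : Option ℕ+) : ExtendedMap
  | ofMap (M : AdmissibleMap) : ExtendedMap

namespace ExtendedMap

noncomputable def vertexCount (k : ℕ) : ExtendedMap → ℕ
  | vertexless _ => 0
  | ofMap M => M.vertexCount k

noncomputable def halfDegree : ExtendedMap → ℕ
  | vertexless _ => 0
  | ofMap M => M.halfDegree

def totalMult : ExtendedMap → ℕ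
  | vertexless none => 0
  | vertexless (some μ) => μ
  | ofMap M => M.totalMult

end ExtendedMap

/-- Admissible marked Eulerian maps with total multiplicity less than `i`. -/
def MapFamily (i : ℕ) : Type := {M : AdmissibleMap // M.totalMult < i}

/-- The same family together with the conventional maps without vertex. -/
def ExtendedFamily (i : ℕ) : Type := {M : ExtendedMap // M.totalMult < i}

/-! ## The series `r_i` -/

/-- Formal power series in `t` whose coefficients are integer polynomials in the `g_k`. -/
abbrev Series : Type := PowerSeries (MvPolynomial ℕ ℤ)

/-- Height after `j` steps of the walk with steps `p` (`true` = up, `false` = down) starting at `i`. -/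
def walkHeight {m : ℕ} (i : ℕ) (p : Fin m → Bool) (j : ℕ) : ℤ :=
  i + ∑ l : Fin m, if (l : ℕ) < j then (if p l then 1 else -1) else 0

open Classical in
/-- Walks on `ℕ` of length `2 k - 1` from height `i` to height `i - 1`. -/
noncomputable def dyckPaths (k i : ℕ) : Finset (Fin (2 * k - 1) → Bool) :=
  Finset.univ.filter fun p =>
    (∀ j ∈ Finset.range (2 * k), 0 ≤ walkHeight i p j) ∧
      walkHeight i p (2 * k - 1) = (i : ℤ) - 1

/-- The sum over such walks of the product of `r h` over the down-steps `h → h - 1`. -/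
noncomputable def pathSum (r : ℕ → Series) (k i : ℕ) : Series :=
  ∑ p ∈ dyckPaths k i, ∏ j ∈ Finset.univ.filter (fun j => p j = false), r (walkHeight i p j).toNat

/-- The series `i + ∑_{k ≥ 1} t ^ k g_k (pathSum r k i)`, coefficient by coefficient in `t`. -/
noncomputable def systemRHS (r : ℕ → Series) (i : ℕ) : Series :=
  (i : Series) + PowerSeries.mk fun n =>
    ∑ k ∈ Finset.Icc 1 n, MvPolynomial.X k * PowerSeries.coeff (n - k) (pathSum r k i)

noncomputable def approx : ℕ → ℕ → Series
  | 0 => fun _ => 0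
  | N + 1 => systemRHS (approx N)

/-- The series `r_i`: the unique solution of the recursive system `r_i = systemRHS r i`
(see `rSeries_system` and `rSeries_unique`), built by successive approximation. -/
noncomputable def rSeries (i : ℕ) : Series :=
  PowerSeries.mk fun n => PowerSeries.coeff n (approx (n + 1) i)

theorem pathSum_congr {r s : ℕ → Series} {N : ℕ}
    (h : ∀ i, ∀ m < N, PowerSeries.coeff m (r i) = PowerSeries.coeff m (s i)) (k i : ℕ) :
    ∀ m < N, PowerSeries.coeff m (pathSum r k i) = PowerSeries.coeff m (pathSum s k i) := by
  let I : Ideal Series := Ideal.span {PowerSeries.X ^ N}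
  have hI : ∀ a b : Series, Ideal.Quotient.mk I a = Ideal.Quotient.mk I b ↔
      ∀ m < N, PowerSeries.coeff m a = PowerSeries.coeff m b := by
    intro a b
    rw [Ideal.Quotient.eq, Ideal.mem_span_singleton, PowerSeries.X_pow_dvd_iff]
    simp [sub_eq_zero]
  rw [← hI]
  simp only [pathSum, map_sum, map_prod]
  refine Finset.sum_congr rfl fun p _ => Finset.prod_congr rfl fun j _ => ?_
  exact (hI _ _).2 (h _)

theorem systemRHS_congr {r s : ℕ → Series} {N : ℕ}
    (h : ∀ i, ∀ m < N, PowerSeries.coeff m (r i) = PowerSeries.coeff m (s i)) (i : ℕ) :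
    ∀ m < N + 1, PowerSeries.coeff m (systemRHS r i) = PowerSeries.coeff m (systemRHS s i) := by
  intro m hm
  simp only [systemRHS, map_add, PowerSeries.coeff_mk]
  congr 1
  refine Finset.sum_congr rfl fun k hk => ?_
  rw [Finset.mem_Icc] at hk
  rw [pathSum_congr h k i (m - k) (by omega)]

theorem approx_stable (N : ℕ) : ∀ i, ∀ m < N,
    PowerSeries.coeff m (approx N i) = PowerSeries.coeff m (approx (N + 1) i) := by
  induction N with
  | zero => intro i m hm; omega
  | succ N ih => exact fun i => systemRHS_congr ih i

theorem coeff_rSeries (N : ℕ) : ∀ i, ∀ m < N,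
    PowerSeries.coeff m (rSeries i) = PowerSeries.coeff m (approx N i) := by
  induction N with
  | zero => intro i m hm; omega
  | succ N ih =>
    intro i m hm
    rcases Nat.lt_succ_iff_lt_or_eq.1 hm with h | rfl
    · rw [ih i m h, approx_stable N i m h]
    · simp [rSeries]

/-- The series `r_i` solve the recursive system. -/
theorem rSeries_system (i : ℕ) : rSeries i = systemRHS rSeries i := by
  ext1 n
  rw [systemRHS_congr (coeff_rSeries n) i n (Nat.lt_succ_self n), coeff_rSeries (n + 1) i n
    (Nat.lt_succ_self n), approx]

/-- The recursive system has no other solution. -/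
theorem rSeries_unique (r : ℕ → Series) (hr : ∀ i, r i = systemRHS r i) : r = rSeries := by
  have key : ∀ N, ∀ i, ∀ m < N, PowerSeries.coeff m (r i) = PowerSeries.coeff m (rSeries i) := by
    intro N
    induction N with
    | zero => intro i m hm; omega
    | succ N ih =>
      intro i
      rw [hr i, rSeries_system i]
      exact systemRHS_congr ih i
  funext i
  ext1 n
  exact key (n + 1) i n (Nat.lt_succ_self n)

/-- `F` is the generating function of the objects of `α`, where the object `a` has weight
`t ^ size a * ∏_k g_k ^ count k a`: there are finitely many objects of each size, and the coefficient
of each monomial is the number of objects with that weight. -/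
def IsCountingSeries {α : Type} (size : α → ℕ) (count : ℕ → α → ℕ) (F : Series) : Prop :=
  (∀ E, Finite {a : α // size a = E}) ∧
    ∀ (E : ℕ) (m : ℕ →₀ ℕ), MvPolynomial.coeff m (PowerSeries.coeff E F) =
      (Nat.card {a : α // size a = E ∧ ∀ k, count k a = m k} : ℤ)

end EulerianMaps

open EulerianMaps

/-! Both sides are fibred over trees, and for each tree the two fibres have the same finite size.
The bijection is glued from arbitrary bijections between fibres, and the degree statistics agree
because on both sides they are functions of the tree.

From maps to trees. Given a good orientation of a map, search it depth-first and clockwise from the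
root. An outgoing half-edge becomes an opening leaf. An incoming one becomes a closing leaf if its
edge is marked or its other half has been visited, and otherwise leads to a new node, so that tree
edges point towards the root. A suitable orientation is found greedily: each half-edge met is turned
outwards whenever some good orientation agreeing with the past allows it. If inward is forced on an
unmarked edge, its other half is not waiting on the stack: it would close a directed cycle, whose
reversal contradicts a forced choice (`Branch.not_opp`, `exists_run`). The resulting tree does not
depend on the orientation: at a first disagreement, one orientation explores a subtree whose
half-edges form a union of vertices, and the flows of the two orientations through its boundary
would differ (`GoodOrientation.cut`, `Run.forest_unique`).

From trees to maps. Conversely, match the closing leaves of an Eulerian tree with its opening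
leaves, root leaf included, with multiplicities on the marked edges, such that in each unmarked pair
the opening leaf comes first in the contour. The result is admissible and opens to the same tree
(`TreeStructure.good`, `TreeStructure.run`, `AdmissibleMap.bijective_ofTree`). Thus the maps over a
tree are these matchings.

Counting. Put `m = i - 1`. There are `m.choose k` multiplicity functions with a given support of
size `k` and sum at most `m`, so the marked opening leaves can be traded for `k` of `m` tokens. What
remains are injections from closing leaves to earlier opening leaves and tokens. Filled in contour
order, a closing leaf has as many free choices as its `i`-height (`card_matching_eq`,
`card_injective`, `card_matching`). The product of these heights also counts the index assignments,
and it vanishes for unbalanced trees.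

Series. A subtree of the root node changes the height by `+1` if it is an opening leaf and by `-1`
otherwise. Hence the children of the root node trace a walk, the weight factors along it, and the
recursion for `rSeries` follows; walks that leave the natural numbers contribute zero. -/

namespace EulerianMaps

/-! ### Good orientations: reversals and cuts. -/

namespace MarkedMap

variable {D : Type}

theorem opp_injective (M : MarkedMap D) : Function.Injective M.opp := M.opp.injective

/-- A set of half-edges that is a union of vertices. -/
def Saturated (M : MarkedMap D) (S : Finset D) : Prop := ∀ d, M.next d ∈ S ↔ d ∈ S

theorem Saturated.iterate {M : MarkedMap D} {S : Finset D} (h : M.Saturated S) (n : ℕ) (d : D) :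
    M.next^[n] d ∈ S ↔ d ∈ S := by
  induction n generalizing d with
  | zero => rfl
  | succ n ih => rw [Function.iterate_succ_apply, ih, h]

variable [DecidableEq D]

theorem Saturated.union {M : MarkedMap D} {S T : Finset D} (hS : M.Saturated S)
    (hT : M.Saturated T) : M.Saturated (S ∪ T) := by
  intro d
  simp [hS d, hT d]

theorem Saturated.sdiff {M : MarkedMap D} {S T : Finset D} (hS : M.Saturated S)
    (hT : M.Saturated T) : M.Saturated (S \ T) := by
  intro d
  simp [hS d, hT d]

/-- Compatible root-accessible Eulerian orientations with outgoing root, described by cuts. -/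
structure GoodOrientation (M : MarkedMap D) (O : Finset D) : Prop where
  orientation : ∀ d, d ∈ O ↔ M.opp d ∉ O
  balanced : ∀ S, M.Saturated S → 2 * (S ∩ O).card = S.card
  compatible : ∀ d, M.mult d ≠ 0 → d ∈ O
  accessible : ∀ S, M.Saturated S → S.Nonempty → M.root ∉ S →
    ∃ d ∈ S, d ∈ O ∧ M.mult d = 0 ∧ M.opp d ∉ S
  root_mem : M.root ∈ O

theorem GoodOrientation.opp_mem {M : MarkedMap D} {O : Finset D} (h : M.GoodOrientation O) (d : D) :
    M.opp d ∈ O ↔ d ∉ O := by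
  rw [h.orientation (M.opp d), M.opp_opp]

theorem GoodOrientation.mult_eq_zero {M : MarkedMap D} {O : Finset D} (h : M.GoodOrientation O)
    {d : D} (hd : d ∉ O) : M.mult d = 0 := by
  by_contra hm
  exact hd (h.compatible d hm)

/-- Reversal of a balanced set of unmarked edges. -/
theorem GoodOrientation.flip {M : MarkedMap D} {O F : Finset D} (h : M.GoodOrientation O)
    (hFO : F ⊆ O) (hm : ∀ d ∈ F, M.mult d = 0)
    (hb : ∀ S, M.Saturated S → (S ∩ F).card = (S ∩ F.image M.opp).card) (hr : M.root ∉ F) :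
    M.GoodOrientation ((O \ F) ∪ F.image M.opp) := by
  have mem_image : ∀ d, d ∈ F.image M.opp ↔ M.opp d ∈ F := by
    intro d
    rw [Finset.mem_image]
    constructor
    · rintro ⟨e, he, rfl⟩
      rwa [M.opp_opp]
    · intro hd
      exact ⟨_, hd, M.opp_opp d⟩
  have mem : ∀ d, d ∈ (O \ F) ∪ F.image M.opp ↔ (d ∈ O ∧ d ∉ F) ∨ M.opp d ∈ F := by
    intro d
    rw [Finset.mem_union, Finset.mem_sdiff, mem_image]
  constructor
  · intro d
    rw [mem, mem, M.opp_opp]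
    have h1 := h.orientation d
    have h2 := @hFO d
    have h3 := @hFO (M.opp d)
    tauto
  · intro S hS
    have key : (S ∩ ((O \ F) ∪ F.image M.opp)).card + (S ∩ F).card
        = (S ∩ O).card + (S ∩ F.image M.opp).card := by
      rw [Finset.inter_union_distrib_left, Finset.card_union_of_disjoint]
      · have : (S ∩ O).card = (S ∩ (O \ F)).card + (S ∩ F).card := by
          rw [← Finset.card_union_of_disjoint]
          · congr 1
            ext d
            have := @hFO d
            simp only [Finset.mem_inter, Finset.mem_union, Finset.mem_sdiff]
            tauto
          · rw [Finset.disjoint_left]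
            intro d
            simp only [Finset.mem_inter, Finset.mem_sdiff]
            tauto
        omega
      · rw [Finset.disjoint_left]
        intro d hd hd'
        rw [Finset.mem_inter, Finset.mem_sdiff] at hd
        rw [Finset.mem_inter, mem_image] at hd'
        exact (h.orientation d).1 hd.2.1 (hFO hd'.2)
    have := hb S hS
    have := h.balanced S hS
    omega
  · intro d hd
    rw [mem]
    left
    refine ⟨h.compatible d hd, fun hF => hd (hm d hF)⟩
  · intro S hS hne hroot
    obtain ⟨d, hdS, hdO, hdm, hdS'⟩ := h.accessible S hS hne hroot
    by_cases hdF : d ∈ F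
    -- An edge of `F` leaves `S`, so by balance another edge of `F` enters it; once reversed, that
    -- one leaves `S`.
    · have : ∃ x ∈ S ∩ F.image M.opp, M.opp x ∉ S := by
        by_contra! hcon
        have hlt : (S ∩ F.image M.opp).card < (S ∩ F).card := by
          rw [← Finset.card_image_of_injective _ M.opp_injective]
          refine Finset.card_lt_card ⟨?_, fun hsub => ?_⟩
          · intro y hy
            obtain ⟨x, hx, rfl⟩ := Finset.mem_image.1 hy
            rw [Finset.mem_inter]
            refine ⟨hcon x hx, ?_⟩
            rw [Finset.mem_inter, mem_image] at hx
            exact hx.2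
          · obtain ⟨x, hx, hxd⟩ := Finset.mem_image.1 (hsub (Finset.mem_inter.2 ⟨hdS, hdF⟩))
            apply hdS'
            rw [← hxd, M.opp_opp]
            exact (Finset.mem_inter.1 hx).1
        exact absurd (hb S hS) hlt.ne'
      obtain ⟨x, hx, hxS⟩ := this
      rw [Finset.mem_inter, mem_image] at hx
      refine ⟨x, hx.1, (mem x).2 (Or.inr hx.2), ?_, hxS⟩
      apply h.mult_eq_zero
      rw [h.orientation, not_not]
      exact hFO hx.2
    · exact ⟨d, hdS, (mem d).2 (Or.inl ⟨hdO, hdF⟩), hdm, hdS'⟩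
  · exact (mem _).2 (Or.inl ⟨h.root_mem, hr⟩)

/-- `M.opp` exchanges `I ∩ O` with `I \ O`. -/
theorem GoodOrientation.two_mul_card_inter {M : MarkedMap D} {O I : Finset D}
    (h : M.GoodOrientation O) (hI : ∀ d ∈ I, M.opp d ∈ I) : 2 * (I ∩ O).card = I.card := by
  have h1 : (I ∩ O).card = (I \ O).card := by
    refine Finset.card_nbij' M.opp M.opp ?_ ?_ (fun d _ => M.opp_opp d) (fun d _ => M.opp_opp d)
    · intro d hd
      simp only [Finset.coe_inter, Set.mem_inter_iff, Finset.mem_coe, Finset.coe_sdiff,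
        Set.mem_sdiff] at hd ⊢
      exact ⟨hI d hd.1, (h.orientation d).1 hd.2⟩
    · intro d hd
      simp only [Finset.coe_inter, Set.mem_inter_iff, Finset.mem_coe, Finset.coe_sdiff,
        Set.mem_sdiff] at hd ⊢
      exact ⟨hI d hd.1, (h.opp_mem d).2 hd.2⟩
  have := Finset.card_inter_add_card_sdiff I O
  omega

/-- Two good orientations have the same flow through a cut. -/
theorem GoodOrientation.cut {M : MarkedMap D} {O₁ O₂ S : Finset D} (h₁ : M.GoodOrientation O₁)
    (h₂ : M.GoodOrientation O₂) (hS : M.Saturated S)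
    (hle : ∀ s ∈ S, s ∈ O₁ → M.opp s ∉ S → s ∈ O₂) {s : D} (hs : s ∈ S) (hs' : M.opp s ∉ S)
    (hs₂ : s ∈ O₂) : s ∈ O₁ := by
  by_contra hs₁
  -- Edges with both ends in `S` contribute half of their half-edges to either orientation, so only
  -- the boundary of `S` can make a difference.
  set I := S.filter fun d => M.opp d ∈ S with hI
  have hI' : ∀ d ∈ I, M.opp d ∈ I := by
    intro d hd
    rw [hI, Finset.mem_filter] at hd ⊢
    exact ⟨hd.2, by rw [M.opp_opp]; exact hd.1⟩
  have split : ∀ O : Finset D, (S ∩ O).card = (I ∩ O).card + ((S \ I) ∩ O).card := by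
    intro O
    rw [← Finset.card_union_of_disjoint]
    · congr 1
      ext d
      simp only [hI, Finset.mem_inter, Finset.mem_union, Finset.mem_sdiff, Finset.mem_filter]
      tauto
    · rw [Finset.disjoint_left]
      intro d
      simp only [Finset.mem_inter, Finset.mem_sdiff]
      tauto
  -- On the boundary `O₁` is contained in `O₂`, strictly because of `s`, although balance forces
  -- equal cardinalities.
  have hlt : ((S \ I) ∩ O₁).card < ((S \ I) ∩ O₂).card := by
    refine Finset.card_lt_card ⟨?_, fun hsub => ?_⟩
    · intro d hd
      simp only [hI, Finset.mem_inter, Finset.mem_sdiff, Finset.mem_filter, not_and] at hd ⊢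
      exact ⟨hd.1, hle d hd.1.1 hd.2 (hd.1.2 hd.1.1)⟩
    · have : s ∈ (S \ I) ∩ O₂ := by
        simp only [hI, Finset.mem_inter, Finset.mem_sdiff, Finset.mem_filter, not_and]
        exact ⟨⟨hs, fun _ => hs'⟩, hs₂⟩
      exact hs₁ (Finset.mem_inter.1 (hsub this)).2
  have e1 := h₁.balanced S hS
  have e2 := h₂.balanced S hS
  have e3 := h₁.two_mul_card_inter hI'
  have e4 := h₂.two_mul_card_inter hI'
  have e5 := split O₁
  have e6 := split O₂
  omega

end MarkedMap

/-! ### Half-edges of a tree and its contour. -/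

namespace PlantedTree

/-- The half-edges at the nodes of the tree, a root leaf being added above a root node: at a root
node, `inl 0` is the half-edge towards the root, and `inl j.succ` the one towards the child `j`. -/
def Below : PlantedTree → Type
  | opening => Empty
  | closing => Empty
  | node n child => Fin (n + 1) ⊕ Σ j : Fin n, (child j).Below

section Node

variable {n : ℕ} {child : Fin n → PlantedTree}

/-- A half-edge at the root node. -/
def half (j : Fin (n + 1)) : (node n child).Below := Sum.inl j

/-- A half-edge below the child `j` of the root node. -/
def sub (j : Fin n) (x : (child j).Below) : (node n child).Below := Sum.inr ⟨j, x⟩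

theorem half_or_sub (x : (node n child).Below) : (∃ j, x = half j) ∨ ∃ j y, x = sub j y :=
  match x with
  | .inl j => Or.inl ⟨j, rfl⟩
  | .inr ⟨j, y⟩ => Or.inr ⟨j, y, rfl⟩

theorem half_injective : Function.Injective (half (child := child)) := Sum.inl_injective

theorem sub_injective (j : Fin n) : Function.Injective (sub (child := child) j) := by
  intro x y h
  simpa using (Sum.inr_injective h : (⟨j, x⟩ : Σ j, (child j).Below) = ⟨j, y⟩)

@[simp]
theorem half_ne_sub (j : Fin (n + 1)) (k : Fin n) (x : (child k).Below) : half j ≠ sub k x :=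
  Sum.inl_ne_inr

@[simp]
theorem sub_ne_half (j : Fin (n + 1)) (k : Fin n) (x : (child k).Below) : sub k x ≠ half j :=
  Sum.inr_ne_inl

theorem sub_index_eq {j k : Fin n} {x : (child j).Below} {y : (child k).Below}
    (h : sub j x = sub k y) : j = k :=
  congrArg Sigma.fst (Sum.inr_injective h : (⟨j, x⟩ : Σ j, (child j).Below) = ⟨k, y⟩)

end Node

/-- The step of a leaf, `0` for a node. -/
def step : PlantedTree → ℤ
  | opening => 1
  | closing => -1
  | node _ _ => 0

/-- The step of the leaf at the other end of the half-edge, if it is one other than the root leaf. -/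
def sgn : ∀ T : PlantedTree, T.Below → ℤ
  | opening, x => x.elim
  | closing, x => x.elim
  | node _ child, x =>
    x.elim (fun j => Fin.cases 0 (fun j => (child j).step) j) fun y => (child y.1).sgn y.2

/-- The half-edges in the order of a clockwise walk around the tree from the root. -/
def contour : ∀ T : PlantedTree, List T.Below
  | opening => []
  | closing => []
  | node _ child =>
    half 0 :: (List.ofFn fun j => half j.succ :: ((child j).contour.map (sub j))).flatten

section Node

variable {n : ℕ} {child : Fin n → PlantedTree}

@[simp]
theorem sgn_half_zero : (node n child).sgn (half 0) = 0 := rfl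

@[simp]
theorem sgn_half_succ (j : Fin n) : (node n child).sgn (half j.succ) = (child j).step := rfl

@[simp]
theorem sgn_sub (j : Fin n) (x : (child j).Below) :
    (node n child).sgn (sub j x) = (child j).sgn x := rfl

end Node

end PlantedTree

/-! ### Depth-first exploration of an oriented map, and uniqueness of its forest. -/

namespace MarkedMap

variable {D : Type}

/-- The half-edges of a map that correspond to those of a tree, starting at the half-edge `d`. -/
def follow (M : MarkedMap D) : ∀ T : PlantedTree, D → T.Below → D
  | .opening, _, x => x.elim
  | .closing, _, x => x.elim
  | .node _ child, d, x =>
    Sum.elim (fun j : Fin (_ + 1) => M.next^[(j : ℕ)] d) (fun y : Σ j, (child j).Below =>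
      M.follow (child y.1) (M.opp (M.next^[(y.1 : ℕ) + 1] d)) y.2) x

@[simp]
theorem follow_half (M : MarkedMap D) {n : ℕ} {child : Fin n → PlantedTree} (d : D)
    (j : Fin (n + 1)) : M.follow (.node n child) d (PlantedTree.half j) = M.next^[(j : ℕ)] d := rfl

@[simp]
theorem follow_sub (M : MarkedMap D) {n : ℕ} {child : Fin n → PlantedTree} (d : D)
    (j : Fin n) (x : (child j).Below) : M.follow (.node n child) d (PlantedTree.sub j x) =
      M.follow (child j) (M.opp (M.next^[(j : ℕ) + 1] d)) x := rfl

/-- The `n` half-edges that follow `d` around its vertex. -/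
def others (M : MarkedMap D) (n : ℕ) (d : D) : List D :=
  List.ofFn fun j : Fin n => M.next^[(j : ℕ) + 1] d

/-- The half-edges met on a walk around the trees that hang from given half-edges, with steps. -/
def walk (M : MarkedMap D) (st : List D) (f : List PlantedTree) : List (D × ℤ) :=
  (List.zipWith (fun h t => (h, t.step) ::
    (t.contour.map fun x => (M.follow t (M.opp h) x, t.sgn x))) st f).flatten

@[simp]
theorem walk_opening (M : MarkedMap D) (h : D) (hs : List D) (ts : List PlantedTree) :
    M.walk (h :: hs) (.opening :: ts) = (h, 1) :: M.walk hs ts := rfl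

@[simp]
theorem walk_closing (M : MarkedMap D) (h : D) (hs : List D) (ts : List PlantedTree) :
    M.walk (h :: hs) (.closing :: ts) = (h, -1) :: M.walk hs ts := rfl

theorem walk_append (M : MarkedMap D) {st st' : List D} {f f' : List PlantedTree}
    (h : st.length = f.length) : M.walk (st ++ st') (f ++ f') = M.walk st f ++ M.walk st' f' := by
  simp [walk, List.zipWith_append h]

theorem zipWith_ofFn {α β γ : Type*} (g : α → β → γ) : ∀ {n : ℕ} (a : Fin n → α) (b : Fin n → β),
    List.zipWith g (List.ofFn a) (List.ofFn b) = List.ofFn fun j => g (a j) (b j)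
  | 0, _, _ => by simp
  | n + 1, a, b => by simp [List.ofFn_succ, zipWith_ofFn]

/-- Links the walk over a stack, in which the search is described, to the contour of a tree, in
which the order of its leaves is described. -/
theorem walk_others (M : MarkedMap D) (n : ℕ) (child : Fin n → PlantedTree) (d : D) :
    (d, (0 : ℤ)) :: M.walk (M.others n d) (List.ofFn child) =
      (PlantedTree.node n child).contour.map fun x =>
        (M.follow (.node n child) d x, (PlantedTree.node n child).sgn x) := by
  simp [walk, others, zipWith_ofFn, PlantedTree.contour, List.map_flatten, Function.comp_def]

/-- The unfolding that matches `Run.node`: the children of the node become the top of the stack. -/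
theorem walk_node (M : MarkedMap D) (h : D) (hs : List D) (n : ℕ) (child : Fin n → PlantedTree)
    (ts : List PlantedTree) : M.walk (h :: hs) (.node n child :: ts) =
      (h, 0) :: (M.opp h, 0) :: M.walk (M.others n (M.opp h) ++ hs) (List.ofFn child ++ ts) := by
  rw [walk_append _ (by simp [others]), ← List.cons_append, walk_others]
  rfl

variable [DecidableEq D]

/-- A depth-first exploration of an oriented map: `V` is the set of visited half-edges, the stack
holds the half-edges to be visited, from which the trees of the forest will hang. -/
inductive Run (M : MarkedMap D) (O : Finset D) : Finset D → List D → List PlantedTree → Prop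
  | nil (V) : Run M O V [] []
  | opening {V h hs ts} (hO : h ∈ O) (hr : Run M O (insert h V) hs ts) :
      Run M O V (h :: hs) (.opening :: ts)
  | closing {V h hs ts} (hO : h ∉ O) (hV : M.mult (M.opp h) = 0 → M.opp h ∈ V)
      (hr : Run M O (insert h V) hs ts) : Run M O V (h :: hs) (.closing :: ts)
  | node {V h hs ts n child} (hO : h ∉ O) (hm : M.mult (M.opp h) = 0) (hV : M.opp h ∉ V)
      (hs' : M.opp h ∉ hs) (hn : Function.minimalPeriod M.next (M.opp h) = n + 1)
      (hr : Run M O (insert (M.opp h) (insert h V)) (M.others n (M.opp h) ++ hs)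
        (List.ofFn child ++ ts)) :
      Run M O V (h :: hs) (.node n child :: ts)

theorem Run.length_eq {M : MarkedMap D} {O V : Finset D} {st : List D} {f : List PlantedTree}
    (h : M.Run O V st f) : st.length = f.length := by
  induction h with
  | nil => rfl
  | opening _ _ ih => simpa using ih
  | closing _ _ _ ih => simpa using ih
  | node _ _ _ _ _ _ ih => simpa [others] using ih

/-- Because of saturation, a vertex that has been touched has all its half-edges visited or waiting.
A half-edge in neither place therefore belongs to a new vertex. -/
structure StackInv (M : MarkedMap D) (V : Finset D) (st : List D) : Prop where
  saturated : M.Saturated (V ∪ st.toFinset)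
  nodup : st.Nodup
  notMem : ∀ d ∈ st, d ∉ V

variable {M : MarkedMap D} {V : Finset D}

theorem StackInv.pop {h : D} {hs : List D} (hI : M.StackInv V (h :: hs)) :
    M.StackInv (insert h V) hs where
  saturated := by
    convert hI.saturated using 1
    ext d
    simp only [Finset.mem_union, Finset.mem_insert, List.mem_toFinset, List.mem_cons]
    tauto
  nodup := hI.nodup.of_cons
  notMem d hd := by
    rw [Finset.mem_insert, not_or]
    refine ⟨?_, hI.notMem d (List.mem_cons_of_mem _ hd)⟩
    rintro rfl
    exact (List.nodup_cons.1 hI.nodup).1 hd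

theorem saturated_orbit {n : ℕ} {d : D} (hn : Function.minimalPeriod M.next d = n + 1) :
    M.Saturated (insert d (M.others n d).toFinset) := by
  have mem : ∀ e, e ∈ insert d (M.others n d).toFinset ↔ ∃ j < n + 1, M.next^[j] d = e := by
    intro e
    simp only [others, Finset.mem_insert, List.mem_toFinset, List.mem_ofFn]
    constructor
    · rintro (rfl | ⟨j, rfl⟩)
      · exact ⟨0, by omega, rfl⟩
      · exact ⟨j + 1, by omega, rfl⟩
    · rintro ⟨_ | j, hj, rfl⟩
      · exact Or.inl rfl
      · exact Or.inr ⟨⟨j, by omega⟩, rfl⟩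
  have hper : M.next^[n + 1] d = d := by
    rw [← hn]; exact Function.iterate_minimalPeriod
  intro e
  rw [mem, mem]
  constructor
  · rintro ⟨_ | j, hj, h⟩
    · refine ⟨n, by omega, M.next.injective ?_⟩
      rw [← Function.iterate_succ_apply' (f := M.next), hper]
      exact h
    · refine ⟨j, by omega, M.next.injective ?_⟩
      rw [← Function.iterate_succ_apply' (f := M.next)]
      exact h
  · rintro ⟨j, hj, rfl⟩
    rcases Nat.lt_or_ge j n with h | h
    · exact ⟨j + 1, by omega, Function.iterate_succ_apply' _ _ _⟩
    · obtain rfl : j = n := by omega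
      refine ⟨0, by omega, ?_⟩
      rw [← Function.iterate_succ_apply' (f := M.next), hper]
      rfl

omit [DecidableEq D] in
theorem nodup_orbit {n : ℕ} {d : D} (hn : Function.minimalPeriod M.next d = n + 1) :
    (d :: M.others n d).Nodup := by
  have : d :: M.others n d = List.ofFn fun j : Fin (n + 1) => M.next^[j] d := by
    rw [List.ofFn_succ]
    rfl
  rw [this, List.nodup_ofFn]
  intro a b hab
  refine Fin.ext (Function.iterate_injOn_Iio_minimalPeriod (f := M.next) (x := d) ?_ ?_ hab)
  · rw [Set.mem_Iio, hn]; exact a.2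
  · rw [Set.mem_Iio, hn]; exact b.2

/-- `M.opp h` lies outside the saturated set of visited and waiting half-edges, so its whole vertex
does, and can be pushed without repetition. -/
theorem StackInv.push {h : D} {hs : List D} (hI : M.StackInv V (h :: hs)) (hV : M.opp h ∉ V)
    (hs' : M.opp h ∉ hs) {n : ℕ} (hn : Function.minimalPeriod M.next (M.opp h) = n + 1) :
    M.StackInv (insert (M.opp h) (insert h V)) (M.others n (M.opp h) ++ hs) := by
  have hW : M.opp h ∉ V ∪ (h :: hs).toFinset := by
    simp [hV, hs', M.opp_ne]
  have hW' : ∀ e ∈ M.others n (M.opp h), e ∉ V ∪ (h :: hs).toFinset := by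
    intro e he
    obtain ⟨j, rfl⟩ := (List.mem_ofFn' _ _).1 he
    rwa [hI.saturated.iterate]
  have hnd := nodup_orbit hn
  rw [List.nodup_cons] at hnd
  have hnd' := List.nodup_cons.1 hI.nodup
  constructor
  · convert hI.saturated.union (saturated_orbit hn) using 1
    ext d
    simp only [Finset.mem_union, Finset.mem_insert, List.mem_toFinset, List.mem_cons,
      List.mem_append]
    tauto
  · rw [List.nodup_append]
    refine ⟨hnd.2, hnd'.2, ?_⟩
    rintro a ha b hb rfl
    apply hW' a ha
    simp [hb]
  · intro d hd
    simp only [Finset.mem_insert, not_or]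
    rcases List.mem_append.1 hd with hd' | hd'
    · have := hW' d hd'
      simp only [Finset.mem_union, List.mem_toFinset, List.mem_cons, not_or] at this
      refine ⟨?_, this.2.1, this.1⟩
      rintro rfl
      exact hnd.1 hd'
    · refine ⟨?_, ?_, hI.notMem d (List.mem_cons_of_mem _ hd')⟩
      · rintro rfl
        exact hs' hd'
      · rintro rfl
        exact hnd'.1 hd'

/-- The exploration of the first trees of a forest. -/
structure Explored (M : MarkedMap D) (O V : Finset D) (L : List D) (hs : List D) : Prop where
  inv : M.StackInv (V ∪ L.toFinset) hs
  nodup : L.Nodup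
  notMem : ∀ d ∈ L, d ∉ V
  closed : ∀ d ∈ L, d ∉ O → M.mult (M.opp d) = 0 → M.opp d ∈ V ∪ L.toFinset

theorem Explored.cons {O : Finset D} {L hs : List D} {h : D} (hV : h ∉ V)
    (hE : M.Explored O (insert h V) L hs)
    (hc : h ∉ O → M.mult (M.opp h) = 0 → M.opp h ∈ insert h V ∪ L.toFinset) :
    M.Explored O V (h :: L) hs := by
  have e : insert h V ∪ L.toFinset = V ∪ (h :: L).toFinset := by
    ext d
    simp only [Finset.mem_union, Finset.mem_insert, List.mem_toFinset, List.mem_cons]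
    tauto
  rw [e] at hc
  constructor
  · rw [← e]; exact hE.inv
  · rw [List.nodup_cons]
    exact ⟨fun hh => hE.notMem h hh (Finset.mem_insert_self _ _), hE.nodup⟩
  · intro d hd
    rcases List.mem_cons.1 hd with rfl | hd
    · exact hV
    · exact fun hd' => hE.notMem d hd (Finset.mem_insert_of_mem hd')
  · intro d hd
    rcases List.mem_cons.1 hd with rfl | hd
    · exact hc
    · rw [← e]; exact hE.closed d hd

/-- The top of the stack is used up before anything below it is touched. Stopping there isolates the
half-edges explored by a subtree, which `Run.forest_unique` needs for its cut, and those explored by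
the whole search. -/
theorem Run.split {O : Finset D} {st' : List D} {f' : List PlantedTree}
    (hr : M.Run O V st' f') : ∀ {st hs : List D} {f ts : List PlantedTree}, st' = st ++ hs →
      f' = f ++ ts → st.length = f.length → M.StackInv V (st ++ hs) →
      M.Explored O V ((M.walk st f).map Prod.fst) hs ∧
        M.Run O (V ∪ ((M.walk st f).map Prod.fst).toFinset) hs ts := by
  have base : ∀ {V : Finset D} {hs ts}, M.Run O V hs ts → M.StackInv V hs →
      M.Explored O V [] hs ∧ M.Run O (V ∪ [].toFinset) hs ts := by
    intro V hs ts h hI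
    simp only [List.toFinset_nil, Finset.union_empty]
    exact ⟨⟨by simpa using hI, List.nodup_nil, by simp, by simp⟩, h⟩
  induction hr with
  | nil V =>
    intro st hs f ts h1 h2 h3 hI
    obtain ⟨rfl, rfl⟩ := List.append_eq_nil_iff.1 h1.symm
    obtain ⟨rfl, rfl⟩ := List.append_eq_nil_iff.1 h2.symm
    exact base (.nil V) hI
  | @opening V h hs0 ts0 hO hr ih =>
    intro st hs f ts h1 h2 h3 hI
    match st, f, h3 with
    | [], [], _ =>
      obtain rfl : _ = hs := h1
      obtain rfl : _ = ts := h2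
      exact base (.opening hO hr) hI
    | a :: st, b :: f, h3 =>
      simp only [List.cons_append, List.cons.injEq] at h1 h2
      obtain ⟨rfl, h1⟩ := h1
      obtain ⟨rfl, h2⟩ := h2
      obtain ⟨hE, hR⟩ := ih h1 h2 (by simpa using h3) hI.pop
      refine ⟨hE.cons (hI.notMem _ (by simp)) (fun h' => absurd hO h'), ?_⟩
      convert hR using 1
      ext d
      simp
  | @closing V h hs0 ts0 hO hV hr ih =>
    intro st hs f ts h1 h2 h3 hI
    match st, f, h3 with
    | [], [], _ =>
      obtain rfl : _ = hs := h1
      obtain rfl : _ = ts := h2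
      exact base (.closing hO hV hr) hI
    | a :: st, b :: f, h3 =>
      simp only [List.cons_append, List.cons.injEq] at h1 h2
      obtain ⟨rfl, h1⟩ := h1
      obtain ⟨rfl, h2⟩ := h2
      obtain ⟨hE, hR⟩ := ih h1 h2 (by simpa using h3) hI.pop
      refine ⟨hE.cons (hI.notMem _ (by simp)) (fun _ hm => by simp [hV hm]), ?_⟩
      convert hR using 1
      ext d
      simp
  | @node V h hs0 ts0 n child hO hm hV hs' hn hr ih =>
    intro st hs f ts h1 h2 h3 hI
    match st, f, h3 with
    | [], [], _ =>
      obtain rfl : _ = hs := h1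
      obtain rfl : _ = ts := h2
      exact base (.node hO hm hV hs' hn hr) hI
    | a :: st, b :: f, h3 =>
      simp only [List.cons_append, List.cons.injEq] at h1 h2
      obtain ⟨rfl, rfl⟩ := h1
      obtain ⟨rfl, rfl⟩ := h2
      have hI' := hI.push hV hs' hn
      rw [List.append_eq, ← List.append_assoc] at hI'
      obtain ⟨hE, hR⟩ := ih (st := M.others n (M.opp h) ++ st) (hs := hs)
        (f := List.ofFn child ++ f) (ts := ts) (by simp) (by simp) (by simpa [others] using h3) hI'
      rw [walk_node, List.map_cons, List.map_cons]
      refine ⟨(hE.cons ?_ ?_).cons (hI.notMem _ (by simp)) ?_, ?_⟩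
      · simp [hV, M.opp_ne]
      · rw [M.opp_opp]; simp
      · simp
      · convert hR using 1
        ext d
        simp
        tauto

/-- The forest explored does not depend on the orientation. -/
theorem Run.forest_unique {O₁ : Finset D} {st : List D} {f₁ : List PlantedTree}
    (h₁ : M.Run O₁ V st f₁) : ∀ {O₂ : Finset D} {f₂ : List PlantedTree}, M.Run O₂ V st f₂ →
      M.GoodOrientation O₁ → M.GoodOrientation O₂ → (∀ d ∈ V, d ∈ O₁ ↔ d ∈ O₂) →
      M.StackInv V st → f₁ = f₂ := by
  -- A disagreement where `O₁` sends `h` out while `O₂` finds a new node behind it. The flows of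
  -- both through the boundary of that subtree are compared.
  have key : ∀ {V : Finset D} {O₁ O₂ : Finset D} {h hs n child ts}, h ∈ O₁ →
      M.GoodOrientation O₁ → M.GoodOrientation O₂ → (∀ d ∈ V, d ∈ O₁ ↔ d ∈ O₂) →
      M.StackInv V (h :: hs) → ¬ M.Run O₂ V (h :: hs) (.node n child :: ts) := by
    intro V O₁ O₂ h hs n child ts hO₁ hg₁ hg₂ hag hI hr
    rcases hr with _ | _ | _ | ⟨hO, hm, hV, hs', hn, hr⟩
    obtain ⟨hE, -⟩ := hr.split (st := M.others n (M.opp h)) (hs := hs) rfl rfl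
      (by simp [others]) (hI.push hV hs' hn)
    set L := (M.walk (M.others n (M.opp h)) (List.ofFn child)).map Prod.fst
    have hE' : M.Explored O₂ (insert h V) (M.opp h :: L) hs := by
      refine hE.cons ?_ ?_
      · simp [hV, M.opp_ne]
      · rw [M.opp_opp]; simp
    have hS : M.Saturated (M.opp h :: L).toFinset := by
      -- The half-edges visited or waiting after the subtree, minus those visited or waiting before
      -- it.
      convert hE'.inv.saturated.sdiff hI.saturated using 1
      ext d
      have h1 := hE'.notMem d
      have h2 : d ∈ hs → d ∉ _ := hE'.inv.notMem d
      simp only [Finset.mem_union, Finset.mem_sdiff, List.mem_toFinset, List.mem_cons,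
        Finset.mem_insert] at h1 h2 ⊢
      tauto
    have hh : h ∉ M.opp h :: L := fun h' => hE'.notMem h h' (Finset.mem_insert_self _ _)
    have := hg₁.cut hg₂ hS (s := M.opp h) ?_ (by simp) (by rwa [M.opp_opp, List.mem_toFinset])
      ((hg₂.opp_mem h).2 hO)
    · exact (hg₁.opp_mem h).1 this hO₁
    -- A boundary half-edge outgoing in `O₁` but incoming in `O₂` is unmarked, so its other half was
    -- visited by the `O₂` search, outside the subtree. That half is `h`, or lies in `V` where the
    -- orientations agree; both are impossible.
    · intro s hs hs₁ hs''
      by_contra hs₂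
      have hopp : M.opp s ∉ O₁ := (hg₁.orientation s).1 hs₁
      have := hE'.closed s (List.mem_toFinset.1 hs) hs₂ (hg₁.mult_eq_zero hopp)
      rw [Finset.mem_union, or_iff_left hs'', Finset.mem_insert] at this
      rcases this with h3 | h3
      · apply hs₂
        rw [← M.opp_opp s, h3]
        exact (hg₂.opp_mem h).2 hO
      · exact hopp ((hag _ h3).2 ((hg₂.opp_mem s).2 hs₂))
  -- If `O₂` closes at `h`, the edge carries no mark since `O₁` directs it the other way. Its other
  -- half then lies in `V`, where the orientations agree.
  have close : ∀ {V : Finset D} {O₁ O₂ : Finset D} {h hs ts}, h ∈ O₁ →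
      M.GoodOrientation O₁ → M.GoodOrientation O₂ → (∀ d ∈ V, d ∈ O₁ ↔ d ∈ O₂) →
      ¬ M.Run O₂ V (h :: hs) (.closing :: ts) := by
    intro V O₁ O₂ h hs ts hO₁ hg₁ hg₂ hag hr
    rcases hr with _ | _ | ⟨hO, hV, hr⟩
    have hopp := (hg₁.orientation h).1 hO₁
    exact hopp ((hag _ (hV (hg₁.mult_eq_zero hopp))).2 ((hg₂.opp_mem h).2 hO))
  induction h₁ with
  | nil V =>
    intro O₂ f₂ h₂ hg₁ hg₂ hag hI
    cases h₂
    rfl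
  | @opening V h hs ts hO hr ih =>
    intro O₂ f₂ h₂ hg₁ hg₂ hag hI
    have h₂' := h₂
    rcases h₂' with _ | ⟨hO', hr'⟩ | ⟨hO', hV', hr'⟩ | ⟨hO', hm', hV', hs', hn', hr'⟩
    · rw [ih hr' hg₁ hg₂ ?_ hI.pop]
      intro d hd
      rcases Finset.mem_insert.1 hd with rfl | hd
      · simp [hO, hO']
      · exact hag d hd
    · exact absurd h₂ (close hO hg₁ hg₂ hag)
    · exact absurd h₂ (key hO hg₁ hg₂ hag hI)
  | @closing V h hs ts hO hV hr ih =>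
    intro O₂ f₂ h₂ hg₁ hg₂ hag hI
    have h₂' := h₂
    rcases h₂' with _ | ⟨hO', hr'⟩ | ⟨hO', hV', hr'⟩ | ⟨hO', hm', hV', hs', hn', hr'⟩
    · exact absurd (Run.closing hO hV hr) (close hO' hg₂ hg₁ fun d hd => (hag d hd).symm)
    · rw [ih hr' hg₁ hg₂ ?_ hI.pop]
      intro d hd
      rcases Finset.mem_insert.1 hd with rfl | hd
      · simp [hO, hO']
      · exact hag d hd
    · exact absurd (hV hm') hV'
  | @node V h hs ts n child hO hm hV hs' hn hr ih =>
    intro O₂ f₂ h₂ hg₁ hg₂ hag hI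
    have h₂' := h₂
    rcases h₂' with _ | ⟨hO', hr'⟩ | ⟨hO', hV', hr'⟩ | ⟨hO', hm', hV', hs'', hn', hr'⟩
    · exact absurd (Run.node hO hm hV hs' hn hr)
        (key hO' hg₂ hg₁ (fun d hd => (hag d hd).symm) hI)
    · exact absurd (hV' hm) hV
    · rename_i ts' n' child'
      obtain rfl : n = n' := by omega
      have := ih hr' hg₁ hg₂ ?_ (hI.push hV hs' hn)
      · obtain ⟨h1, h2⟩ := List.append_inj this (by simp)
        rw [List.ofFn_injective h1, h2]
      · intro d hd
        simp only [Finset.mem_insert] at hd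
        rcases hd with rfl | rfl | hd
        · rw [hg₁.opp_mem, hg₂.opp_mem]; simp [hO, hO']
        · simp [hO, hO']
        · exact hag d hd

end MarkedMap

/-! ### Existence of an exploration: the greedy orientation. -/

namespace MarkedMap

variable {D : Type} [DecidableEq D] {M : MarkedMap D} {V O : Finset D}

theorem Run.mem_iff_isOpening {st : List D} {f : List PlantedTree} (h : M.Run O V st f) :
    List.Forall₂ (fun d t => d ∈ O ↔ t.isOpening = true) st f := by
  induction h with
  | nil => exact .nil
  | opening hO _ ih => exact .cons (by simp [hO, PlantedTree.isOpening]) ih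
  | closing hO _ _ ih => exact .cons (by simp [hO, PlantedTree.isOpening]) ih
  | node hO _ _ _ _ _ ih =>
    refine .cons (by simp [hO, PlantedTree.isOpening]) ?_
    have := List.forall₂_drop_append _ _ _ ih
    simpa [others] using this

/-- The half-edge `d` is itself outgoing, so among the other `n` there is one outgoing half-edge
fewer than half of the degree. This is the Eulerian condition at a node entered through `d`. -/
theorem GoodOrientation.degree (h : M.GoodOrientation O) {n : ℕ} {d : D} (hd : d ∈ O)
    (hn : Function.minimalPeriod M.next d = n + 1) :
    n + 1 = 2 * ((Finset.univ.filter fun j : Fin n => M.next^[(j : ℕ) + 1] d ∈ O).card + 1) := by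
  have hnd := nodup_orbit hn
  have hb := h.balanced _ (saturated_orbit hn)
  rw [← List.toFinset_cons, List.toFinset_card_of_nodup hnd] at hb
  simp only [List.length_cons, others, List.length_ofFn] at hb
  rw [← hb]
  congr 1
  rw [List.nodup_cons] at hnd
  have hinj : Function.Injective fun j : Fin n => M.next^[(j : ℕ) + 1] d :=
    List.nodup_ofFn.1 hnd.2
  rw [← Finset.card_image_of_injective _ hinj, List.toFinset_cons, Finset.insert_inter_of_mem hd,
    Finset.card_insert_of_notMem]
  · congr 2
    ext e
    simp only [Finset.mem_inter, List.mem_toFinset, List.mem_ofFn, Finset.mem_image,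
      Finset.mem_filter, Finset.mem_univ, true_and]
    constructor
    · rintro ⟨⟨j, rfl⟩, he⟩
      exact ⟨j, he, rfl⟩
    · rintro ⟨j, he, rfl⟩
      exact ⟨⟨j, rfl⟩, he⟩
  · intro hd'
    exact hnd.1 (List.mem_toFinset.1 (Finset.mem_inter.1 hd').1)

/-- A reason why no unmarked edge should lead from the vertex of `b` to that of `a`: the two are
equal, or there is a directed path `F` of visited unmarked edges from `a` to `b`, whose last edge
was impossible to reverse when it was visited, `U` having been visited before. -/
def Branch (M : MarkedMap D) (O V : Finset D) (a b : D) : Prop :=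
  (∀ S, M.Saturated S → (a ∈ S ↔ b ∈ S)) ∨ ∃ (U F : Finset D) (k : D), U ⊆ V ∧ M.root ∈ U ∧
    F ⊆ V ∧ F ⊆ O ∧ (∀ d ∈ F, M.mult d = 0 ∧ d ∉ U ∧ M.opp d ∉ U) ∧ M.opp k ∈ F ∧
    (∀ O₁, M.GoodOrientation O₁ → (∀ d ∈ U, d ∈ O ↔ d ∈ O₁) → k ∉ O₁) ∧
    ∀ S, M.Saturated S → (S ∩ F).card + (if b ∈ S then 1 else 0) =
      (S ∩ F.image M.opp).card + (if a ∈ S then 1 else 0)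

theorem Branch.mono {V' O' : Finset D} {a b : D} (h : M.Branch O V a b) (hV : V ⊆ V')
    (hO : ∀ d ∈ V, d ∈ O ↔ d ∈ O') : M.Branch O' V' a b := by
  rcases h with h | ⟨U, F, k, hU, hr, hFV, hFO, hF, hk, hk', hb⟩
  · exact Or.inl h
  · refine Or.inr ⟨U, F, k, hU.trans hV, hr, hFV.trans hV, ?_, hF, hk, ?_, hb⟩
    · intro d hd
      exact (hO d (hFV hd)).1 (hFO hd)
    · intro O₁ h₁ hag
      exact hk' O₁ h₁ fun d hd => (hO d (hU hd)).trans (hag d hd)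

theorem card_inter_insert (S F : Finset D) {d : D} (hd : d ∉ F) :
    (S ∩ insert d F).card = (S ∩ F).card + if d ∈ S then 1 else 0 := by
  split_ifs with h
  · rw [Finset.inter_insert_of_mem h, Finset.card_insert_of_notMem (by simp [hd])]
  · rw [Finset.inter_insert_of_notMem h, add_zero]

theorem card_inter_image_insert (M : MarkedMap D) (S F : Finset D) {d : D} (hd : d ∉ F) :
    (S ∩ (insert d F).image M.opp).card =
      (S ∩ F.image M.opp).card + if M.opp d ∈ S then 1 else 0 := by
  rw [Finset.image_insert, card_inter_insert]
  rwa [M.opp_injective.mem_finset_image]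

/-- An application of `GoodOrientation.flip` where both halves of each reversed edge avoid `U`; the
root is protected by lying in `U`. -/
theorem GoodOrientation.exists_reversed (h : M.GoodOrientation O) {U F : Finset D} (hFO : F ⊆ O)
    (hF : ∀ d ∈ F, M.mult d = 0 ∧ d ∉ U ∧ M.opp d ∉ U) (hr : M.root ∈ U)
    (hb : ∀ S, M.Saturated S → (S ∩ F).card = (S ∩ F.image M.opp).card) :
    ∃ O₁, M.GoodOrientation O₁ ∧ (∀ d ∈ U, d ∈ O ↔ d ∈ O₁) ∧ ∀ d ∈ F, M.opp d ∈ O₁ := by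
  refine ⟨_, h.flip hFO (fun d hd => (hF d hd).1) hb fun hd => (hF _ hd).2.1 hr, ?_, ?_⟩
  · intro d hd
    have h1 : d ∉ F := fun h' => (hF d h').2.1 hd
    have h2 : d ∉ F.image M.opp := by
      rw [Finset.mem_image]
      rintro ⟨e, he, rfl⟩
      exact (hF e he).2.2 hd
    simp only [Finset.mem_union, Finset.mem_sdiff, h1, h2, not_false_iff, and_true, or_false]
  · intro d hd
    exact Finset.mem_union_right _ (Finset.mem_image_of_mem _ hd)

/-- The edge from `M.opp h` to `h` would close the path of the branch to a directed cycle. Reversing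
the cycle turns `k` outwards without changing anything in `U`, which `Branch` excludes. If no
saturated set separates the ends, the edge is a loop, and reversing it alone contradicts `hno`. -/
theorem Branch.not_opp {h : D} (hB : M.Branch O V h (M.opp h)) (hg : M.GoodOrientation O)
    (hO : h ∉ O) (hm : M.mult (M.opp h) = 0) (hV : h ∉ V) (hV' : M.opp h ∉ V) (hr : M.root ∈ V)
    (hno : ∀ O₁, M.GoodOrientation O₁ → (∀ d ∈ V, d ∈ O ↔ d ∈ O₁) → h ∉ O₁) : False := by
  have hoO : M.opp h ∈ O := (hg.opp_mem h).2 hO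
  rcases hB with hB | ⟨U, F, k, hU, hrU, hFV, hFO, hF, hk, hk', hb⟩
  · obtain ⟨O₁, h₁, hag, hmem⟩ := hg.exists_reversed (U := V) (F := {M.opp h})
      (by simpa using hoO) (by simp [hm, hV, hV', M.opp_opp]) hr (by
        intro S hS
        have := hB S hS
        rw [Finset.image_singleton, M.opp_opp]
        by_cases hh : h ∈ S
        · simp [hh, this.1 hh]
        · simp [hh, mt this.2 hh])
    apply hno O₁ h₁ hag
    simpa [M.opp_opp] using hmem (M.opp h) (by simp)
  · have hoF : M.opp h ∉ F := fun h' => hV' (hFV h')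
    obtain ⟨O₁, h₁, hag, hmem⟩ := hg.exists_reversed (U := U) (F := insert (M.opp h) F)
      (Finset.insert_subset hoO hFO) (by
        intro d hd
        rcases Finset.mem_insert.1 hd with rfl | hd
        · exact ⟨hm, fun h' => hV' (hU h'), by rw [M.opp_opp]; exact fun h' => hV (hU h')⟩
        · exact hF d hd) hrU (by
        intro S hS
        rw [card_inter_insert _ _ hoF, card_inter_image_insert _ _ _ hoF, M.opp_opp]
        exact hb S hS)
    apply hk' O₁ h₁ hag
    simpa [M.opp_opp] using hmem (M.opp k) (by simp [hk])

/-- The half-edge `a` is at the new vertex, from which the edge just crossed leads to the vertex of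
`h`; the path for `a` is this edge followed by the path for `h`. If `h` and `b` are at the same
vertex, the path is this edge alone, with `V` as the earlier visited set and `h` as the half-edge
that could not be turned. -/
theorem Branch.extend {h a b : D} (hB : M.Branch O V h b) (hg : M.GoodOrientation O)
    (hO : h ∉ O) (hm : M.mult (M.opp h) = 0) (hV : h ∉ V) (hV' : M.opp h ∉ V) (hr : M.root ∈ V)
    (hno : ∀ O₁, M.GoodOrientation O₁ → (∀ d ∈ V, d ∈ O ↔ d ∈ O₁) → h ∉ O₁)
    (ha : ∀ S, M.Saturated S → (a ∈ S ↔ M.opp h ∈ S)) :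
    M.Branch O (insert (M.opp h) (insert h V)) a b := by
  have hoO : M.opp h ∈ O := (hg.opp_mem h).2 hO
  have hsub : V ⊆ insert (M.opp h) (insert h V) :=
    (Finset.subset_insert _ _).trans (Finset.subset_insert _ _)
  right
  rcases hB with hB | ⟨U, F, k, hU, hrU, hFV, hFO, hF, hk, hk', hb⟩
  · refine ⟨V, {M.opp h}, h, hsub, hr, by simp, by simpa using hoO,
      by simp [hm, hV, hV', M.opp_opp], by simp, hno, ?_⟩
    intro S hS
    have h1 := hB S hS
    have h2 := ha S hS
    rw [Finset.image_singleton, M.opp_opp]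
    have e : ∀ d, (S ∩ {d}).card = if d ∈ S then 1 else 0 := by
      intro d
      split_ifs with h <;> simp [h]
    simp only [e, h1, h2]
    omega
  · have hoF : M.opp h ∉ F := fun h' => hV' (hFV h')
    refine ⟨U, insert (M.opp h) F, k, hU.trans hsub, hrU, ?_, Finset.insert_subset hoO hFO, ?_,
      Finset.mem_insert_of_mem hk, hk', ?_⟩
    · exact Finset.insert_subset (Finset.mem_insert_self _ _) (hFV.trans hsub)
    · intro d hd
      rcases Finset.mem_insert.1 hd with rfl | hd
      · exact ⟨hm, fun h' => hV' (hU h'), by rw [M.opp_opp]; exact fun h' => hV (hU h')⟩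
      · exact hF d hd
    · intro S hS
      rw [card_inter_insert _ _ hoF, card_inter_image_insert _ _ _ hoF, M.opp_opp]
      have h1 := hb S hS
      have h2 := ha S hS
      simp only [h2]
      omega

/-- Greedy search: the orientation is changed, away from `V`, whenever this can make the top of the
stack outgoing. `Branch`, required of each half-edge of the stack and each one below it, ensures
that an unmarked edge that is forced inwards comes from a visited half-edge or from a new vertex.
`N` bounds the number of unvisited half-edges. -/
theorem exists_run [Fintype D] (N : ℕ) : ∀ (V : Finset D) (st : List D) (O : Finset D),
    Vᶜ.card ≤ N → M.GoodOrientation O → M.StackInv V st → M.root ∈ V →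
    st.Pairwise (M.Branch O V) → ∃ O' f, M.GoodOrientation O' ∧ (∀ d ∈ V, d ∈ O ↔ d ∈ O') ∧
      M.Run O' V st f ∧ ∀ t ∈ f, t.IsEulerian := by
  induction N with
  | zero =>
    intro V st O hN hg hI hr hB
    match st with
    | [] => exact ⟨O, [], hg, fun _ _ => Iff.rfl, .nil V, by simp⟩
    | h :: hs =>
      have : h ∈ Vᶜ := Finset.mem_compl.2 (hI.notMem h (by simp))
      have := Finset.card_pos.2 ⟨h, this⟩
      omega
  | succ N ih =>
    intro V st O hN hg hI hr hB
    match st with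
    | [] => exact ⟨O, [], hg, fun _ _ => Iff.rfl, .nil V, by simp⟩
    | h :: hs =>
      have hhV : h ∉ V := hI.notMem h (by simp)
      have hcard : (insert h V)ᶜ.card ≤ N := by
        rw [Finset.card_compl, Finset.card_insert_of_notMem hhV]
        rw [Finset.card_compl] at hN
        omega
      have hr' : M.root ∈ insert h V := Finset.mem_insert_of_mem hr
      have hB' := List.pairwise_cons.1 hB
      by_cases hex : ∃ O₁, M.GoodOrientation O₁ ∧ (∀ d ∈ V, d ∈ O ↔ d ∈ O₁) ∧ h ∈ O₁
      · obtain ⟨O₁, hg₁, hag₁, hh⟩ := hex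
        obtain ⟨O', f, hg', hag', hR, hE⟩ := ih (insert h V) hs O₁ hcard hg₁ hI.pop hr'
          (hB'.2.imp fun hb => hb.mono (Finset.subset_insert _ _) hag₁)
        refine ⟨O', .opening :: f, hg', fun d hd => ?_, .opening ?_ hR, ?_⟩
        · exact (hag₁ d hd).trans (hag' d (Finset.mem_insert_of_mem hd))
        · exact (hag' h (Finset.mem_insert_self _ _)).1 hh
        · simpa [PlantedTree.IsEulerian] using hE
      · push Not at hex
        have hhO : h ∉ O := hex O hg fun _ _ => Iff.rfl
        by_cases hc : M.mult (M.opp h) = 0 → M.opp h ∈ V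
        · obtain ⟨O', f, hg', hag', hR, hE⟩ := ih (insert h V) hs O hcard hg hI.pop hr'
            (hB'.2.imp fun hb => hb.mono (Finset.subset_insert _ _) fun _ _ => Iff.rfl)
          refine ⟨O', .closing :: f, hg', fun d hd => hag' d (Finset.mem_insert_of_mem hd),
            .closing ?_ hc hR, ?_⟩
          · rwa [← hag' h (Finset.mem_insert_self _ _)]
          · simpa [PlantedTree.IsEulerian] using hE
        · push Not at hc
          obtain ⟨hm, hV'⟩ := hc
          have hs' : M.opp h ∉ hs := fun hmem =>
            (hB'.1 _ hmem).not_opp hg hhO hm hhV hV' hr hex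
          obtain ⟨n, hn⟩ : ∃ n, Function.minimalPeriod M.next (M.opp h) = n + 1 := by
            have : 0 < Function.minimalPeriod M.next (M.opp h) :=
              Function.minimalPeriod_pos_of_mem_periodicPts
                (M.next.injective.mem_periodicPts _)
            exact ⟨_, (Nat.succ_pred_eq_of_pos this).symm⟩
          obtain ⟨O', f, hg', hag', hR, hE⟩ := ih (insert (M.opp h) (insert h V))
            (M.others n (M.opp h) ++ hs) O
            ((Finset.card_le_card (Finset.compl_subset_compl.2 (Finset.subset_insert _ _))).trans
              hcard) hg (hI.push hV' hs' hn) (Finset.mem_insert_of_mem hr') (by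
              have hsame : ∀ a ∈ M.others n (M.opp h), ∀ S, M.Saturated S →
                  (a ∈ S ↔ M.opp h ∈ S) := by
                intro a ha S hS
                obtain ⟨j, rfl⟩ := (List.mem_ofFn' _ _).1 ha
                exact hS.iterate _ _
              -- Pairs at the new vertex, pairs of the old stack, and mixed pairs; only the mixed
              -- ones need the new edge.
              rw [List.pairwise_append]
              refine ⟨?_, ?_, ?_⟩
              · apply List.pairwise_of_forall_mem_list
                intro a ha b hb
                exact Or.inl fun S hS => (hsame a ha S hS).trans (hsame b hb S hS).symm
              · exact hB'.2.imp fun hb => hb.mono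
                  ((Finset.subset_insert _ _).trans (Finset.subset_insert _ _)) fun _ _ => Iff.rfl
              · intro a ha b hb
                exact (hB'.1 b hb).extend hg hhO hm hhV hV' hr hex (hsame a ha))
          have hhO' : h ∉ O' := by
            rwa [← hag' h (by simp)]
          have hlen := hR.length_eq
          have hop := hR.mem_iff_isOpening
          obtain ⟨f₁, ts, rfl, hf₁⟩ : ∃ f₁ ts, f = f₁ ++ ts ∧ f₁.length = n := by
            refine ⟨f.take n, f.drop n, (List.take_append_drop _ _).symm, ?_⟩
            rw [List.length_take, ← hlen]
            simp [others]
          obtain ⟨child, rfl⟩ : ∃ child : Fin n → PlantedTree, f₁ = List.ofFn child := by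
            subst hf₁
            exact ⟨f₁.get, (List.ofFn_get _).symm⟩
          refine ⟨O', .node n child :: ts, hg', fun d hd => hag' d (by simp [hd]),
            .node hhO' hm hV' hs' hn hR, ?_⟩
          -- Since the opening leaves are exactly the outgoing half-edges, the degree count is the
          -- Eulerian condition on the new node.
          have hdeg := hg'.degree ((hg'.opp_mem h).2 hhO') hn
          intro t ht
          rcases List.mem_cons.1 ht with rfl | ht
          · refine ⟨⟨_, hdeg, ?_⟩, fun j => hE _ (by simp [List.mem_ofFn])⟩
            congr 2
            ext j
            simp only [Finset.mem_filter, Finset.mem_univ, true_and]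
            have h1 := List.forall₂_iff_get.1 hop
            have h2 := h1.2 j (by simp [others]; omega) (by simp; omega)
            simp only [List.get_eq_getElem] at h2
            rw [List.getElem_append_left (by simp [others]),
              List.getElem_append_left (by simp)] at h2
            simpa [others] using h2.symm
          · exact hE t (List.mem_append_right _ ht)

end MarkedMap

/-! ### Rotation, edges and orientation of the node tree. -/

namespace PlantedTree

instance finite_below (T : PlantedTree) : Finite T.Below := by
  induction T with
  | opening => exact inferInstanceAs (Finite Empty)
  | closing => exact inferInstanceAs (Finite Empty)
  | node n child ih => exact inferInstanceAs (Finite (Fin (n + 1) ⊕ Σ j, (child j).Below))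

noncomputable instance fintypeBelow (T : PlantedTree) : Fintype T.Below := Fintype.ofFinite _

noncomputable instance decidableEqBelow (T : PlantedTree) : DecidableEq T.Below :=
  Classical.decEq _

/-- The half-edge of the root node that leads to the root. -/
def base : ∀ T : PlantedTree, Option T.Below
  | opening => none
  | closing => none
  | node _ _ => some (half 0)

/-- The next half-edge in clockwise order around a node. -/
def rot : ∀ T : PlantedTree, Equiv.Perm T.Below
  | opening => Equiv.refl Empty
  | closing => Equiv.refl Empty
  | node n child => Equiv.sumCongr (finRotate (n + 1)) (Equiv.sigmaCongrRight fun j => (child j).rot)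

/-- The other half of an edge between two nodes; the remaining half-edges are fixed. -/
noncomputable def treeOpp : ∀ T : PlantedTree, T.Below → T.Below
  | opening, x => x.elim
  | closing, x => x.elim
  | node _ child, x =>
    Sum.elim
      (fun j => Fin.cases (half 0) (fun j => (child j).base.elim (half j.succ) (sub j)) j)
      (fun y : Σ j, (child j).Below =>
        if (child y.1).base = some y.2 then half y.1.succ else sub y.1 ((child y.1).treeOpp y.2)) x

/-- The half-edge is outgoing when all edges are directed towards the root, and opening leaves are
outgoing. -/
def Out : ∀ T : PlantedTree, T.Below → Prop
  | opening, x => x.elim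
  | closing, x => x.elim
  | node _ child, x =>
    Sum.elim (fun j => Fin.cases True (fun j => (child j).isOpening = true) j)
      (fun y : Σ j, (child j).Below => (child y.1).Out y.2) x

theorem base_eq_none_iff (T : PlantedTree) : T.base = none ↔ T.step ≠ 0 := by
  cases T <;> simp [base, step]

theorem isOpening_iff (T : PlantedTree) : T.isOpening = true ↔ T.step = 1 := by
  cases T <;> simp [isOpening, step]

theorem step_cases (T : PlantedTree) : T.step = 1 ∨ T.step = -1 ∨ T.step = 0 := by
  cases T <;> simp [step]

section Node

variable {n : ℕ} {child : Fin n → PlantedTree}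

@[simp]
theorem base_node : (node n child).base = some (half 0) := rfl

@[simp]
theorem rot_half (j : Fin (n + 1)) : (node n child).rot (half j) = half (finRotate _ j) := rfl

theorem rot_half_castSucc (j : Fin n) : (node n child).rot (half j.castSucc) = half j.succ := by
  rw [rot_half, finRotate_apply, Fin.coeSucc_eq_succ]

theorem rot_half_last : (node n child).rot (half (Fin.last n)) = half 0 := by
  rw [rot_half, finRotate_last]

@[simp]
theorem rot_sub (j : Fin n) (x : (child j).Below) :
    (node n child).rot (sub j x) = sub j ((child j).rot x) := rfl

@[simp]
theorem treeOpp_half_zero : (node n child).treeOpp (half 0) = half 0 := rfl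

theorem treeOpp_half_succ_of_none {j : Fin n} (h : (child j).base = none) :
    (node n child).treeOpp (half j.succ) = half j.succ :=
  (congrArg (fun o => Option.elim o (half j.succ) (sub j)) h :)

theorem treeOpp_half_succ {j : Fin n} {b : (child j).Below} (h : (child j).base = some b) :
    (node n child).treeOpp (half j.succ) = sub j b :=
  (congrArg (fun o => Option.elim o (half j.succ) (sub j)) h :)

theorem treeOpp_sub_base {j : Fin n} {b : (child j).Below} (h : (child j).base = some b) :
    (node n child).treeOpp (sub j b) = half j.succ :=
  if_pos h

theorem treeOpp_sub {j : Fin n} {x : (child j).Below} (h : (child j).base ≠ some x) :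
    (node n child).treeOpp (sub j x) = sub j ((child j).treeOpp x) :=
  if_neg h

@[simp]
theorem out_half_zero : (node n child).Out (half 0) := trivial

@[simp]
theorem out_half_succ (j : Fin n) :
    (node n child).Out (half j.succ) ↔ (child j).isOpening = true := Iff.rfl

@[simp]
theorem out_sub (j : Fin n) (x : (child j).Below) :
    (node n child).Out (sub j x) ↔ (child j).Out x := Iff.rfl

theorem sum_below {A : Type*} [AddCommMonoid A] (f : (node n child).Below → A) :
    ∑ x, f x = ∑ j, f (half j) + ∑ j, ∑ x, f (sub j x) := by
  have h : ∀ g : Fin (n + 1) ⊕ (Σ j, (child j).Below) → A,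
      ∑ x, g x = ∑ j, g (.inl j) + ∑ j, ∑ x, g (.inr ⟨j, x⟩) := fun g => by
    rw [Fintype.sum_sum_type, Fintype.sum_sigma]
  exact (Fintype.sum_equiv (ι := (node n child).Below)
    (κ := Fin (n + 1) ⊕ Σ j, (child j).Below) (Equiv.refl _) f f fun _ => rfl).trans (h f)

end Node

theorem treeOpp_base {T : PlantedTree} {b : T.Below} (h : T.base = some b) : T.treeOpp b = b := by
  cases T with
  | opening => exact b.elim
  | closing => exact b.elim
  | node n child =>
    obtain rfl : half 0 = b := Option.some_injective _ h
    rfl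

theorem sgn_base {T : PlantedTree} {b : T.Below} (h : T.base = some b) : T.sgn b = 0 := by
  cases T with
  | opening => exact b.elim
  | closing => exact b.elim
  | node n child =>
    obtain rfl : half 0 = b := Option.some_injective _ h
    rfl

theorem out_base {T : PlantedTree} {b : T.Below} (h : T.base = some b) : T.Out b := by
  cases T with
  | opening => exact b.elim
  | closing => exact b.elim
  | node n child =>
    obtain rfl : half 0 = b := Option.some_injective _ h
    trivial

/-- Case analysis on a half-edge. -/
theorem below_cases {n : ℕ} {child : Fin n → PlantedTree} {motive : (node n child).Below → Prop}
    (zero : motive (half 0))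
    (leaf : ∀ j, (child j).base = none → motive (half j.succ))
    (upper : ∀ j b, (child j).base = some b → motive (half j.succ))
    (lower : ∀ j b, (child j).base = some b → motive (sub j b))
    (sub : ∀ j x, (child j).base ≠ some x → motive (sub j x)) (x : (node n child).Below) :
    motive x := by
  rcases half_or_sub x with ⟨j, rfl⟩ | ⟨j, y, rfl⟩
  · refine Fin.cases zero (fun j => ?_) j
    cases h : (child j).base with
    | none => exact leaf j h
    | some b => exact upper j b h
  · by_cases h : (child j).base = some y
    · exact lower j y h
    · exact sub j y h

theorem not_isOpening_of_base {T : PlantedTree} {b : T.Below} (h : T.base = some b) :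
    T.isOpening = false := by
  cases T with
  | opening => exact b.elim
  | closing => exact b.elim
  | node n child => rfl

theorem treeOpp_ne_base {T : PlantedTree} {x : T.Below} (h : T.base ≠ some x) :
    T.base ≠ some (T.treeOpp x) := by
  induction T with
  | opening => exact x.elim
  | closing => exact x.elim
  | node n child _ =>
    rw [base_node, Ne, Option.some_inj] at h ⊢
    induction x using below_cases with
    | zero => exact absurd rfl h
    | leaf j hj =>
      intro h
      rw [treeOpp_half_succ_of_none hj] at h
      exact (Fin.succ_ne_zero j).symm (half_injective h)
    | upper j b hb =>
      rw [treeOpp_half_succ hb]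
      exact half_ne_sub _ _ _
    | lower j b hb =>
      intro h
      rw [treeOpp_sub_base hb] at h
      exact (Fin.succ_ne_zero j).symm (half_injective h)
    | sub j y hy =>
      rw [treeOpp_sub hy]
      exact half_ne_sub _ _ _

theorem treeOpp_treeOpp {T : PlantedTree} (x : T.Below) : T.treeOpp (T.treeOpp x) = x := by
  induction T with
  | opening => exact x.elim
  | closing => exact x.elim
  | node n child ih =>
    induction x using below_cases with
    | zero => rfl
    | leaf j hj =>
      rw [treeOpp_half_succ_of_none hj, treeOpp_half_succ_of_none hj]
    | upper j b hb =>
      rw [treeOpp_half_succ hb, treeOpp_sub_base hb]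
    | lower j b hb =>
      rw [treeOpp_sub_base hb, treeOpp_half_succ hb]
    | sub j y hy =>
      rw [treeOpp_sub hy, treeOpp_sub (treeOpp_ne_base hy), ih]

/-- The fixed points are the half-edges leading to leaves. The base is one of them, as the root leaf
is placed above it; its step is `0` because that leaf is not recorded in the path. -/
theorem treeOpp_eq_self_iff {T : PlantedTree} (x : T.Below) :
    T.treeOpp x = x ↔ T.base = some x ∨ T.sgn x ≠ 0 := by
  induction T with
  | opening => exact x.elim
  | closing => exact x.elim
  | node n child ih =>
    induction x using below_cases with
    | zero => simp
    | leaf j hj =>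
      simp [treeOpp_half_succ_of_none hj, (base_eq_none_iff _).1 hj]
    | upper j b hb =>
      have h1 : ¬ (child j).step ≠ 0 := by
        rw [← base_eq_none_iff, hb]; simp
      simp only [treeOpp_half_succ hb, sgn_half_succ, h1, or_false, base_node, Option.some_inj]
      refine iff_of_false (sub_ne_half _ _ _) fun h => ?_
      exact (Fin.succ_ne_zero j).symm (half_injective h)
    | lower j b hb =>
      simp [treeOpp_sub_base hb, sgn_base hb]
    | sub j y hy =>
      simp only [treeOpp_sub hy, (sub_injective j).eq_iff, ih, hy, sgn_sub, base_node,
        Option.some_inj, half_ne_sub, false_or]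

theorem out_of_sgn_eq_one {T : PlantedTree} {x : T.Below} (h : T.sgn x = 1) : T.Out x := by
  induction T with
  | opening => exact x.elim
  | closing => exact x.elim
  | node n child ih =>
    rcases half_or_sub x with ⟨j, rfl⟩ | ⟨j, y, rfl⟩
    · revert h
      refine Fin.cases (by simp) (fun j => ?_) j
      rw [sgn_half_succ, out_half_succ, isOpening_iff]
      exact id
    · exact ih j h

theorem not_out_of_sgn_eq_neg_one {T : PlantedTree} {x : T.Below} (h : T.sgn x = -1) :
    ¬ T.Out x := by
  induction T with
  | opening => exact x.elim
  | closing => exact x.elim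
  | node n child ih =>
    rcases half_or_sub x with ⟨j, rfl⟩ | ⟨j, y, rfl⟩
    · revert h
      refine Fin.cases (by simp) (fun j => ?_) j
      rw [sgn_half_succ, out_half_succ, isOpening_iff]
      intro h
      rw [h]
      decide
    · exact ih j h

theorem sgn_cases {T : PlantedTree} (x : T.Below) : T.sgn x = 1 ∨ T.sgn x = -1 ∨ T.sgn x = 0 := by
  induction T with
  | opening => exact x.elim
  | closing => exact x.elim
  | node n child ih =>
    rcases half_or_sub x with ⟨j, rfl⟩ | ⟨j, y, rfl⟩
    · refine Fin.cases (by simp) (fun j => ?_) j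
      exact step_cases _
    · exact ih j y

theorem out_treeOpp {T : PlantedTree} {x : T.Below} (h : T.treeOpp x ≠ x) :
    T.Out (T.treeOpp x) ↔ ¬ T.Out x := by
  induction T with
  | opening => exact x.elim
  | closing => exact x.elim
  | node n child ih =>
    induction x using below_cases with
    | zero => simp at h
    | leaf j hj => exact absurd (treeOpp_half_succ_of_none hj) h
    | upper j b hb =>
      simp [treeOpp_half_succ hb, out_base hb, not_isOpening_of_base hb]
    | lower j b hb =>
      simp [treeOpp_sub_base hb, out_base hb, not_isOpening_of_base hb]
    | sub j y hy =>
      rw [treeOpp_sub hy] at h ⊢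
      exact ih j fun h' => h (congrArg _ h')

theorem mem_contour {T : PlantedTree} (x : T.Below) : x ∈ T.contour := by
  induction T with
  | opening => exact x.elim
  | closing => exact x.elim
  | node n child ih =>
    simp only [contour, List.mem_cons, List.mem_flatten, List.mem_ofFn, exists_exists_eq_and]
    rcases half_or_sub x with ⟨j, rfl⟩ | ⟨j, y, rfl⟩
    · refine Fin.cases (by simp) (fun j => ?_) j
      exact Or.inr ⟨j, by simp⟩
    · exact Or.inr ⟨j, by simp [ih]⟩

theorem nodup_contour (T : PlantedTree) : T.contour.Nodup := by
  induction T with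
  | opening => exact List.nodup_nil
  | closing => exact List.nodup_nil
  | node n child ih =>
    simp only [contour, List.nodup_cons, List.nodup_flatten, List.mem_flatten, List.mem_ofFn,
      exists_exists_eq_and]
    refine ⟨?_, ?_, ?_⟩
    · rintro ⟨j, hj⟩
      rcases List.mem_cons.1 hj with h | h
      · exact (Fin.succ_ne_zero j).symm (half_injective h)
      · obtain ⟨y, -, h⟩ := List.mem_map.1 h
        exact sub_ne_half _ _ _ h
    · rintro _ ⟨j, rfl⟩
      refine List.nodup_cons.2 ⟨?_, (ih j).map (sub_injective j)⟩
      intro h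
      obtain ⟨y, -, h⟩ := List.mem_map.1 h
      exact sub_ne_half _ _ _ h
    · rw [List.pairwise_ofFn]
      intro j k hjk x hx hx'
      rcases List.mem_cons.1 hx with rfl | h
      · rcases List.mem_cons.1 hx' with h' | h'
        · exact hjk.ne (Fin.succ_injective _ (half_injective h'))
        · obtain ⟨y, -, h'⟩ := List.mem_map.1 h'
          exact sub_ne_half _ _ _ h'
      · obtain ⟨y, -, rfl⟩ := List.mem_map.1 h
        rcases List.mem_cons.1 hx' with h' | h'
        · exact sub_ne_half _ _ _ h'
        · obtain ⟨z, -, h'⟩ := List.mem_map.1 h'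
          exact hjk.ne (sub_index_eq h').symm

end PlantedTree


/-! ### Trees embedded in maps. -/

namespace MarkedMap

open PlantedTree

variable {D : Type}

/-- A plane tree drawn in a map, except for its leaves. -/
structure TreeEmbedding (M : MarkedMap D) (O : Finset D) (T : PlantedTree) (g : T.Below → D) :
    Prop where
  injective : Function.Injective g
  next : ∀ x, g (T.rot x) = M.next (g x)
  opp : ∀ x, T.treeOpp x ≠ x → M.opp (g x) = g (T.treeOpp x)
  out : ∀ x, T.Out x ↔ g x ∈ O
  mult : ∀ x, T.treeOpp x ≠ x → M.mult (g x) = 0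

/-- The tree of nodes can be followed in the map from the half-edge `d`. -/
def Fits (M : MarkedMap D) (O : Finset D) : PlantedTree → D → Prop
  | .opening, _ => True
  | .closing, _ => True
  | .node n child, d => Function.minimalPeriod M.next d = n + 1 ∧
      ∀ j : Fin n, (M.next^[(j : ℕ) + 1] d ∈ O ↔ (child j).isOpening = true) ∧
        ((child j).step = 0 → M.mult (M.opp (M.next^[(j : ℕ) + 1] d)) = 0) ∧
        M.Fits O (child j) (M.opp (M.next^[(j : ℕ) + 1] d))

/-- The tree can be followed in the map from the edge of the half-edge `h`. -/
def Hangs (M : MarkedMap D) (O : Finset D) (h : D) (t : PlantedTree) : Prop :=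
  (h ∈ O ↔ t.isOpening = true) ∧ (t.step = 0 → M.mult (M.opp h) = 0) ∧ M.Fits O t (M.opp h)

theorem fits_node {M : MarkedMap D} {O : Finset D} {n : ℕ} {child : Fin n → PlantedTree} {d : D} :
    M.Fits O (.node n child) d ↔ Function.minimalPeriod M.next d = n + 1 ∧
      ∀ j : Fin n, M.Hangs O (M.next^[(j : ℕ) + 1] d) (child j) := Iff.rfl

section Embedding

variable {M : MarkedMap D} {O : Finset D}

theorem isEmpty_below {T : PlantedTree} (h : T.base = none) : IsEmpty T.Below := by
  cases T with
  | opening => exact inferInstanceAs (IsEmpty Empty)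
  | closing => exact inferInstanceAs (IsEmpty Empty)
  | node => cases h

theorem follow_base {T : PlantedTree} {b : T.Below} (h : T.base = some b) (d : D) :
    M.follow T d b = d := by
  cases T with
  | opening => exact b.elim
  | closing => exact b.elim
  | node n child =>
    obtain rfl : half 0 = b := Option.some_injective _ h
    rfl

variable {n : ℕ} {child : Fin n → PlantedTree}

/-- The base of a child is matched in the whole tree but fixed by `treeOpp` of the child.
Restriction thus only drops the conditions on the edge above the child. -/
theorem TreeEmbedding.toChild {g : (node n child).Below → D}
    (h : M.TreeEmbedding O (node n child) g) (j : Fin n) :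
    M.TreeEmbedding O (child j) fun x => g (sub j x) := by
  have key : ∀ x, (child j).treeOpp x ≠ x → (child j).base ≠ some x := fun x hx hb =>
    hx (treeOpp_base hb)
  have key' : ∀ x, (child j).treeOpp x ≠ x →
      (node n child).treeOpp (sub j x) ≠ sub j x := fun x hx h' => by
    rw [treeOpp_sub (key x hx)] at h'
    exact hx (sub_injective j h')
  constructor
  · exact h.injective.comp (sub_injective j)
  · intro x
    rw [← h.next, rot_sub]
  · intro x hx
    rw [h.opp _ (key' x hx), treeOpp_sub (key x hx)]
  · intro x
    rw [← h.out, out_sub]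
  · intro x hx
    exact h.mult _ (key' x hx)

theorem TreeEmbedding.half {g : (node n child).Below → D}
    (h : M.TreeEmbedding O (node n child) g) (j : Fin (n + 1)) :
    g (half j) = M.next^[(j : ℕ)] (g (half 0)) := by
  refine Fin.induction rfl (fun j ih => ?_) j
  rw [← rot_half_castSucc, h.next, ih, Fin.val_succ, Function.iterate_succ_apply']
  rfl

theorem TreeEmbedding.half_succ {g : (node n child).Below → D}
    (h : M.TreeEmbedding O (node n child) g) (j : Fin n) :
    g (PlantedTree.half j.succ) = M.next^[(j : ℕ) + 1] (g (PlantedTree.half 0)) := by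
  rw [h.half, Fin.val_succ]

theorem TreeEmbedding.opp_half_succ {g : (node n child).Below → D}
    (h : M.TreeEmbedding O (node n child) g) {j : Fin n} {b : (PlantedTree.Below (child j))}
    (hb : (child j).base = some b) : M.opp (g (PlantedTree.half j.succ)) = g (sub j b) := by
  have e := treeOpp_half_succ (child := child) hb
  rw [h.opp, e]
  rw [e]
  exact sub_ne_half _ _ _

/-- Rotation comes back after `n + 1` steps, and injectivity of the embedding excludes an earlier
return. -/
theorem TreeEmbedding.minimalPeriod {g : (node n child).Below → D}
    (h : M.TreeEmbedding O (node n child) g) :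
    Function.minimalPeriod M.next (g (PlantedTree.half 0)) = n + 1 := by
  have hper : Function.IsPeriodicPt M.next (n + 1) (g (PlantedTree.half 0)) := by
    have := h.next (PlantedTree.half (Fin.last n))
    rw [rot_half_last, h.half (Fin.last n), Fin.val_last,
      ← Function.iterate_succ_apply' (f := M.next)] at this
    exact this.symm
  refine le_antisymm (hper.minimalPeriod_le n.succ_pos) ?_
  by_contra! hlt
  have h0 := hper.minimalPeriod_pos n.succ_pos
  have h1 := h.half ⟨_, hlt⟩
  rw [Function.iterate_minimalPeriod] at h1
  have := congrArg Fin.val (half_injective (h.injective h1))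
  simp only [Fin.val_zero] at this
  omega

/-- Rigidity: every half-edge is reached from the base by turning around nodes and crossing tree
edges, so the image of the base determines the embedding. -/
theorem TreeEmbedding.eq_follow {T : PlantedTree} {g : T.Below → D}
    (h : M.TreeEmbedding O T g) {b : T.Below} (hb : T.base = some b) (x : T.Below) :
    g x = M.follow T (g b) x := by
  induction T with
  | opening => exact x.elim
  | closing => exact x.elim
  | node n child ih =>
    obtain rfl : PlantedTree.half 0 = b := Option.some_injective _ hb
    rcases half_or_sub x with ⟨j, rfl⟩ | ⟨j, y, rfl⟩
    · rw [h.half, follow_half]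
    · rw [follow_sub, ← h.half_succ]
      cases hc : (child j).base with
      | none => exact ((isEmpty_below hc).false y).elim
      | some b =>
        rw [h.opp_half_succ hc]
        exact ih j (h.toChild j) hc y

theorem TreeEmbedding.fits {T : PlantedTree} {g : T.Below → D}
    (h : M.TreeEmbedding O T g) {b : T.Below} (hb : T.base = some b) : M.Fits O T (g b) := by
  induction T with
  | opening => exact b.elim
  | closing => exact b.elim
  | node n child ih =>
    obtain rfl : PlantedTree.half 0 = b := Option.some_injective _ hb
    rw [fits_node]
    refine ⟨h.minimalPeriod, fun j => ?_⟩
    rw [← h.half_succ]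
    refine ⟨by rw [← h.out, out_half_succ], ?_, ?_⟩
    · intro hs
      cases hc : (child j).base with
      | none => exact absurd hs ((base_eq_none_iff _).1 hc)
      | some b =>
        rw [h.opp_half_succ hc]
        apply h.mult
        rw [treeOpp_sub_base hc]
        exact half_ne_sub _ _ _
    · cases hc : (child j).base with
      | none =>
        cases hcj : child j with
        | opening => trivial
        | closing => trivial
        | node => rw [hcj] at hc; cases hc
      | some b =>
        rw [h.opp_half_succ hc]
        exact ih j (h.toChild j) hc

theorem Fits.follow_next {T : PlantedTree} {d : D} (h : M.Fits O T d) (x : T.Below) :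
    M.follow T d (T.rot x) = M.next (M.follow T d x) := by
  induction T generalizing d with
  | opening => exact x.elim
  | closing => exact x.elim
  | node n child ih =>
    rw [fits_node] at h
    rcases half_or_sub x with ⟨j, rfl⟩ | ⟨j, y, rfl⟩
    · refine Fin.lastCases ?_ (fun j => ?_) j
      · have hper := Function.iterate_minimalPeriod (f := M.next) (x := d)
        rw [h.1] at hper
        rw [rot_half_last, follow_half, follow_half, Fin.val_last,
          ← Function.iterate_succ_apply' (f := M.next), hper]
        rfl
      · rw [rot_half_castSucc, follow_half, follow_half, Fin.val_succ,
          Function.iterate_succ_apply']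
        rfl
    · rw [rot_sub, follow_sub, follow_sub]
      exact ih j (h.2 j).2.2 y

theorem follow_opp {T : PlantedTree} {d : D} {x : T.Below} (hx : T.treeOpp x ≠ x) :
    M.opp (M.follow T d x) = M.follow T d (T.treeOpp x) := by
  induction T generalizing d with
  | opening => exact x.elim
  | closing => exact x.elim
  | node n child ih =>
    induction x using below_cases with
    | zero => exact absurd rfl hx
    | leaf j hj => exact absurd (treeOpp_half_succ_of_none hj) hx
    | upper j b hb =>
      rw [treeOpp_half_succ hb, follow_sub, follow_base hb, follow_half, Fin.val_succ]
    | lower j b hb =>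
      rw [treeOpp_sub_base hb, follow_sub, follow_base hb, follow_half, Fin.val_succ, M.opp_opp]
    | sub j y hy =>
      rw [treeOpp_sub hy] at hx ⊢
      exact ih j fun h' => hx (congrArg _ h')

variable [DecidableEq D]

theorem Fits.follow_out (hO : M.GoodOrientation O) {T : PlantedTree} {d : D} (h : M.Fits O T d)
    (hd : d ∈ O) (x : T.Below) : T.Out x ↔ M.follow T d x ∈ O := by
  induction T generalizing d with
  | opening => exact x.elim
  | closing => exact x.elim
  | node n child ih =>
    rw [fits_node] at h
    rcases half_or_sub x with ⟨j, rfl⟩ | ⟨j, y, rfl⟩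
    · refine Fin.cases ?_ (fun j => ?_) j
      · simpa using hd
      · rw [out_half_succ, follow_half, Fin.val_succ]
        exact (h.2 j).1.symm
    · rw [out_sub, follow_sub]
      refine ih j (h.2 j).2.2 ((hO.opp_mem _).2 fun h' => ?_) y
      have := (h.2 j).1.1 h'
      generalize child j = T at y this
      cases T with
      | opening => exact y.elim
      | closing => exact y.elim
      | node => cases this

theorem Fits.follow_mult (hO : M.GoodOrientation O) {T : PlantedTree} {d : D} (h : M.Fits O T d)
    {x : T.Below} (hx : T.treeOpp x ≠ x) : M.mult (M.follow T d x) = 0 := by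
  induction T generalizing d with
  | opening => exact x.elim
  | closing => exact x.elim
  | node n child ih =>
    rw [fits_node] at h
    induction x using below_cases with
    | zero => exact absurd rfl hx
    | leaf j hj => exact absurd (treeOpp_half_succ_of_none hj) hx
    | upper j b hb =>
      rw [follow_half, Fin.val_succ]
      apply hO.mult_eq_zero
      rw [(h.2 j).1, not_isOpening_of_base hb]
      exact Bool.false_ne_true
    | lower j b hb =>
      rw [follow_sub, follow_base hb]
      refine (h.2 j).2.1 ?_
      by_contra hs
      rw [(base_eq_none_iff _).2 hs] at hb
      cases hb
    | sub j y hy =>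
      rw [treeOpp_sub hy] at hx
      exact ih j (h.2 j).2.2 fun h' => hx (congrArg _ h')

theorem Fits.embedding (hO : M.GoodOrientation O) {T : PlantedTree} {d : D} (h : M.Fits O T d)
    (hd : d ∈ O) (hinj : Function.Injective (M.follow T d)) :
    M.TreeEmbedding O T (M.follow T d) :=
  ⟨hinj, h.follow_next, fun _ => follow_opp, h.follow_out hO hd, fun _ => h.follow_mult hO⟩

/-- A node lies entirely inside or outside `S`. A node of degree `2 k` has `k` outgoing half-edges:
its base and those to its `k - 1` opening leaves. -/
theorem TreeEmbedding.balanced {T : PlantedTree} {g : T.Below → D} (h : M.TreeEmbedding O T g)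
    (hE : T.IsEulerian) {S : Finset D} (hS : M.Saturated S) :
    ∑ x, (if g x ∈ S then (if g x ∈ O then 2 else 0) else 0) =
      ∑ x, (if g x ∈ S then 1 else 0) := by
  induction T with
  | opening =>
    have := isEmpty_below (T := .opening) rfl
    simp
  | closing =>
    have := isEmpty_below (T := .closing) rfl
    simp
  | node n child ih =>
    rw [sum_below, sum_below]
    congr 1
    · have hh : ∀ j, g (PlantedTree.half j) ∈ S ↔ g (PlantedTree.half 0) ∈ S := fun j => by
        rw [h.half, hS.iterate]
      simp only [hh]
      by_cases h0 : g (PlantedTree.half 0) ∈ S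
      · obtain ⟨⟨k, hk, hk'⟩, -⟩ := hE
        have hA : ∀ j : Fin n, g (PlantedTree.half j.succ) ∈ O ↔ (child j).isOpening = true :=
          fun j => by rw [← h.out, out_half_succ]
        simp only [h0, if_true, Finset.sum_const, Finset.card_univ,
          Fintype.card_fin, smul_eq_mul, mul_one]
        rw [Fin.sum_univ_succ, if_pos ((h.out _).1 out_half_zero), ← Finset.sum_filter,
          Finset.filter_congr fun j _ => hA j, Finset.sum_const, smul_eq_mul]
        omega
      · simp [h0]
    · exact Finset.sum_congr rfl fun j _ => ih j (h.toChild j) (hE.2 j)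

/-- Tree edges point towards the root. Climbing from a node in `S` either ends at a root node in `S`
or leaves `S` through an outgoing tree edge. -/
theorem TreeEmbedding.accessible {T : PlantedTree} {g : T.Below → D} (h : M.TreeEmbedding O T g)
    {S : Finset D} (hS : M.Saturated S) {y : T.Below} (hy : g y ∈ S) :
    (∃ b, T.base = some b ∧ g b ∈ S) ∨
      ∃ x, g x ∈ S ∧ g x ∈ O ∧ T.treeOpp x ≠ x ∧ g (T.treeOpp x) ∉ S := by
  induction T with
  | opening => exact y.elim
  | closing => exact y.elim
  | node n child ih =>
    have hh : ∀ j, g (PlantedTree.half j) ∈ S ↔ g (PlantedTree.half 0) ∈ S := fun j => by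
      rw [h.half, hS.iterate]
    rcases half_or_sub y with ⟨j, rfl⟩ | ⟨j, y, rfl⟩
    · exact Or.inl ⟨_, rfl, (hh j).1 hy⟩
    · by_cases h0 : g (PlantedTree.half 0) ∈ S
      · exact Or.inl ⟨_, rfl, h0⟩
      right
      rcases ih j (h.toChild j) hy with ⟨b, hb, hbS⟩ | ⟨x, hx, hxO, hxo, hxS⟩
      · refine ⟨sub j b, hbS, (h.out _).1 ((out_sub j b).2 (out_base hb)), ?_, ?_⟩
        · rw [treeOpp_sub_base hb]
          exact half_ne_sub _ _ _
        · rw [treeOpp_sub_base hb, hh]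
          exact h0
      · have hb : (child j).base ≠ some x := fun hb => hxo (treeOpp_base hb)
        refine ⟨sub j x, hx, hxO, ?_, ?_⟩
        · rw [treeOpp_sub hb]
          exact fun h' => hxo (sub_injective j h')
        · rw [treeOpp_sub hb]
          exact hxS

end Embedding

end MarkedMap

/-! ### Opening a map: existence and uniqueness of its tree. -/

namespace MarkedMap

open PlantedTree

variable {D : Type} [DecidableEq D] {M : MarkedMap D} {O V : Finset D}

/-- In the list of half-edges with steps, each unmarked closing leaf comes after the other half of
its edge, which may also be in `V`. -/
def Forward (M : MarkedMap D) : Finset D → List (D × ℤ) → Prop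
  | _, [] => True
  | V, (h, s) :: L => (s = -1 → M.mult (M.opp h) = 0 → M.opp h ∈ V) ∧ M.Forward (insert h V) L

/-- Unrolls the growing set `V` into the prefix of the list, which turns the condition into a
comparison of positions. -/
theorem forward_iff {L : List (D × ℤ)} : M.Forward V L ↔ ∀ L₁ h L₂, L = L₁ ++ (h, -1) :: L₂ →
    M.mult (M.opp h) = 0 → M.opp h ∈ V ∨ M.opp h ∈ L₁.map Prod.fst := by
  induction L generalizing V with
  | nil => simp [Forward]
  | cons p L ih =>
    obtain ⟨a, s⟩ := p
    rw [Forward, ih]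
    constructor
    · rintro ⟨h1, h2⟩ L₁ h L₂ hL hm
      rcases L₁ with _ | ⟨q, L₁⟩
      · simp only [List.nil_append, List.cons.injEq, Prod.mk.injEq] at hL
        obtain ⟨⟨rfl, rfl⟩, -⟩ := hL
        exact Or.inl (h1 rfl hm)
      · simp only [List.cons_append, List.cons.injEq] at hL
        obtain ⟨rfl, hL⟩ := hL
        have := h2 L₁ h L₂ hL hm
        simp only [Finset.mem_insert, List.map_cons, List.mem_cons] at this ⊢
        tauto
    · intro H
      refine ⟨fun hs hm => ?_, fun L₁ h L₂ hL hm => ?_⟩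
      · subst hs
        simpa using H [] a L rfl hm
      · have := H ((a, s) :: L₁) h L₂ (by simp [hL]) hm
        simp only [Finset.mem_insert, List.map_cons, List.mem_cons] at this ⊢
        tauto

theorem Run.forward {st : List D} {f : List PlantedTree} (h : M.Run O V st f) :
    M.Forward V (M.walk st f) := by
  induction h with
  | nil => trivial
  | opening _ _ ih => exact ⟨fun h => absurd h (by decide), ih⟩
  | closing _ hV _ ih => exact ⟨fun _ => hV, ih⟩
  | node _ _ _ _ _ _ ih =>
    rw [walk_node]
    exact ⟨fun h => absurd h (by decide), fun h => absurd h (by decide), ih⟩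

theorem Run.hangs {st : List D} {f : List PlantedTree} (h : M.Run O V st f) :
    List.Forall₂ (M.Hangs O) st f := by
  induction h with
  | nil => exact .nil
  | opening hO _ ih => exact .cons ⟨by simp [hO, isOpening], by simp [step], trivial⟩ ih
  | closing hO _ _ ih => exact .cons ⟨by simp [hO, isOpening], by simp [step], trivial⟩ ih
  | @node V h hs ts n child hO hm _ _ hn _ ih =>
    have h1 := List.forall₂_take_append _ _ _ ih
    have h2 := List.forall₂_drop_append _ _ _ ih
    rw [List.length_ofFn, List.take_left' (by simp [others])] at h1
    rw [List.length_ofFn, List.drop_left' (by simp [others])] at h2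
    refine .cons ⟨by simp [hO, isOpening], fun _ => hm, fits_node.2 ⟨hn, fun j => ?_⟩⟩ h2
    have := (List.forall₂_iff_get.1 h1).2 j (by simp [others]) (by simp)
    simpa [others] using this

omit [DecidableEq D] in
theorem mem_walk {st : List D} {f : List PlantedTree} (h : st.length = f.length) {d : D}
    (hd : d ∈ st) : d ∈ (M.walk st f).map Prod.fst := by
  induction st generalizing f with
  | nil => simp at hd
  | cons a st ih =>
    match f, h with
    | t :: f, h =>
      have : M.walk (a :: st) (t :: f) = M.walk [a] [t] ++ M.walk st f :=
        walk_append (st := [a]) (f := [t]) M rfl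
      rw [this, List.map_append, List.mem_append]
      rcases List.mem_cons.1 hd with rfl | hd
      · exact Or.inl (by simp [walk])
      · exact Or.inr (ih (by simpa using h) hd)

/-- Converse of `Run.hangs` and `Run.forward`: local fit, absence of repetitions and the order of
the closing leaves are all that a run needs. The induction is on the length of the walk because
`Run.node` replaces a tree by its children. -/
theorem run_of_forward (N : ℕ) : ∀ {V : Finset D} {st : List D}
    {f : List PlantedTree}, (M.walk st f).length ≤ N → List.Forall₂ (M.Hangs O) st f →
      ((M.walk st f).map Prod.fst).Nodup → (∀ d ∈ (M.walk st f).map Prod.fst, d ∉ V) →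
      M.Forward V (M.walk st f) → M.Run O V st f := by
  induction N with
  | zero =>
    intro V st f hN hH hnd hV hF
    cases hH with
    | nil => exact .nil V
    | @cons a t st f hat hrest => simp [walk] at hN
  | succ N ih =>
    intro V st f hN hH hnd hV hF
    cases hH with
    | nil => exact .nil V
    | @cons h t hs ts hat hrest =>
      obtain ⟨h1, h2, h3⟩ := hat
      cases t with
      | opening =>
        simp only [walk_opening, List.length_cons, List.map_cons, List.nodup_cons,
          List.forall_mem_cons] at hN hnd hV
        refine .opening (h1.2 rfl) (ih (by omega) hrest hnd.2 ?_ hF.2)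
        intro d hd
        rw [Finset.mem_insert, not_or]
        exact ⟨fun h => hnd.1 (h ▸ hd), hV.2 d hd⟩
      | closing =>
        simp only [walk_closing, List.length_cons, List.map_cons, List.nodup_cons,
          List.forall_mem_cons] at hN hnd hV
        refine .closing (fun h => by simpa [isOpening] using h1.1 h) (hF.1 rfl)
          (ih (by omega) hrest hnd.2 ?_ hF.2)
        intro d hd
        rw [Finset.mem_insert, not_or]
        exact ⟨fun h => hnd.1 (h ▸ hd), hV.2 d hd⟩
      | node n child =>
        rw [walk_node] at hN hnd hV hF
        simp only [List.length_cons, List.map_cons, List.nodup_cons, List.mem_cons,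
          not_or] at hN hnd hV
        obtain ⟨hn, hch⟩ := fits_node.1 h3
        have hlen : (M.others n (M.opp h) ++ hs).length = (List.ofFn child ++ ts).length := by
          simp [others, hrest.length_eq]
        refine .node (fun h => by simpa [isOpening] using h1.1 h) (h2 rfl) (hV _ (Or.inr (Or.inl rfl))) (fun hmem => ?_)
          hn (ih (by omega) ?_ hnd.2.2 ?_ hF.2.2)
        -- Waiting on the stack, `M.opp h` would occur a second time in the walk.
        · exact hnd.2.1 (mem_walk hlen (List.mem_append_right _ hmem))
        · refine List.rel_append ?_ hrest
          rw [List.forall₂_iff_get]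
          refine ⟨by simp [others], fun j h1 h2 => ?_⟩
          simpa [others] using hch ⟨j, by simpa using h2⟩
        · intro d hd
          simp only [Finset.mem_insert, not_or]
          exact ⟨fun h => hnd.2.1 (h ▸ hd), fun h => hnd.1.2 (h ▸ hd), hV d (Or.inr (Or.inr hd))⟩

open Classical in
/-- The half-edges of a map that are outgoing in the orientation given by a tree. -/
noncomputable def outSet {T : PlantedTree} (g : T.Below ≃ D) : Finset D :=
  (Finset.univ.filter T.Out).map g.toEmbedding

omit [DecidableEq D] in
@[simp]
theorem mem_outSet {T : PlantedTree} (g : T.Below ≃ D) (d : D) :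
    d ∈ outSet g ↔ T.Out (g.symm d) := by
  simp only [outSet, Finset.mem_map, Finset.mem_filter, Finset.mem_univ, true_and,
    Equiv.coe_toEmbedding]
  constructor
  · rintro ⟨x, hx, rfl⟩
    rwa [g.symm_apply_apply]
  · intro h
    exact ⟨_, h, g.apply_symm_apply d⟩

/-- A map obtained by closing a tree: each closing leaf is matched with an opening leaf, which
comes before it in clockwise order around the tree, unless their edge is marked. -/
structure TreeStructure (M : MarkedMap D) (T : PlantedTree) (g : T.Below ≃ D) : Prop where
  embedding : M.TreeEmbedding (outSet g) T g
  root : T.base = some (g.symm M.root)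
  orientation : ∀ d, d ∈ outSet g ↔ M.opp d ∉ outSet g
  compatible : ∀ d, M.mult d ≠ 0 → d ∈ outSet g
  forward : ∀ c, T.sgn c = -1 → M.mult (M.opp (g c)) = 0 →
    T.contour.idxOf (g.symm (M.opp (g c))) < T.contour.idxOf c

theorem idxOf_append_self {α : Type*} [DecidableEq α] {l₁ l₂ : List α} {a : α} (h : a ∉ l₁) :
    (l₁ ++ a :: l₂).idxOf a = l₁.length := by
  rw [List.idxOf_append_of_notMem h, List.idxOf_cons_self, add_zero]

theorem mem_of_idxOf_lt {α : Type*} [DecidableEq α] {l₁ l₂ : List α} {a b : α} (h : a ∉ l₁)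
    (hb : (l₁ ++ a :: l₂).idxOf b < (l₁ ++ a :: l₂).idxOf a) : b ∈ l₁ := by
  by_contra hn
  rw [idxOf_append_self h, List.idxOf_append_of_notMem hn] at hb
  omega

section

variable {T : PlantedTree} {g : T.Below ≃ D}

/-- Balance holds node by node, and the tree edges, which are unmarked, give access to the root. -/
theorem TreeStructure.good (h : M.TreeStructure T g) (hE : T.IsEulerian) :
    M.GoodOrientation (outSet g) where
  orientation := h.orientation
  balanced S hS := by
    have := h.embedding.balanced hE hS
    let _ : Fintype D := Fintype.ofEquiv _ g
    rw [Fintype.sum_equiv g _ (fun d => if d ∈ S then if d ∈ outSet g then 2 else 0 else 0)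
      fun _ => rfl, Fintype.sum_equiv g _ (fun d => if d ∈ S then 1 else 0) fun _ => rfl,
      Finset.sum_ite_mem, Finset.sum_ite_mem, Finset.univ_inter, Finset.sum_ite_mem,
      Finset.univ_inter, Finset.sum_const, Finset.sum_const, smul_eq_mul, smul_eq_mul, mul_one, mul_comm] at this
    exact this
  compatible := h.compatible
  accessible S hS hne hr := by
    obtain ⟨d, hd⟩ := hne
    rcases h.embedding.accessible hS (y := g.symm d) (by simpa using hd) with
      ⟨b, hb, hbS⟩ | ⟨x, hx, hxO, hxo, hxS⟩
    · rw [h.root, Option.some_inj] at hb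
      rw [← hb, g.apply_symm_apply] at hbS
      exact absurd hbS hr
    · exact ⟨g x, hx, hxO, h.embedding.mult x hxo, by rwa [h.embedding.opp x hxo]⟩
  root_mem := by
    rw [mem_outSet]
    exact out_base h.root

omit [DecidableEq D] in
theorem TreeStructure.eq_follow (h : M.TreeStructure T g) (x : T.Below) :
    g x = M.follow T M.root x := by
  rw [h.embedding.eq_follow h.root x, g.apply_symm_apply]

end

theorem stackInv_root {n : ℕ} (hn : Function.minimalPeriod M.next M.root = n + 1) :
    M.StackInv {M.root} (M.others n M.root) where
  saturated := by
    rw [← Finset.insert_eq]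
    exact saturated_orbit hn
  nodup := (nodup_orbit hn).of_cons
  notMem d hd := by
    rw [Finset.mem_singleton]
    rintro rfl
    exact (List.nodup_cons.1 (nodup_orbit hn)).1 hd

/-- The contour of the tree, read in the map, is a legitimate depth-first search. This makes every
tree structure subject to `Run.forest_unique`. -/
theorem TreeStructure.run {n : ℕ} {child : Fin n → PlantedTree}
    {g : (PlantedTree.node n child).Below ≃ D} (h : M.TreeStructure (.node n child) g) :
    Function.minimalPeriod M.next M.root = n + 1 ∧
      M.Run (outSet g) {M.root} (M.others n M.root) (List.ofFn child) := by
  have hfit := fits_node.1 (h.embedding.fits h.root)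
  rw [g.apply_symm_apply] at hfit
  refine ⟨hfit.1, ?_⟩
  have hw := M.walk_others n child M.root
  simp only [← h.eq_follow] at hw
  have hw' : M.root :: (M.walk (M.others n M.root) (List.ofFn child)).map Prod.fst =
      (PlantedTree.node n child).contour.map g := by
    have := congrArg (List.map Prod.fst) hw
    simpa [Function.comp_def] using this
  have hnd : (M.root :: (M.walk (M.others n M.root) (List.ofFn child)).map Prod.fst).Nodup := by
    rw [hw']
    exact (nodup_contour _).map g.injective
  rw [List.nodup_cons] at hnd
  refine run_of_forward _ le_rfl ?_ hnd.2 ?_ ?_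
  · rw [List.forall₂_iff_get]
    refine ⟨by simp [others], fun j h1 h2 => ?_⟩
    simpa [others] using hfit.2 ⟨j, by simpa using h2⟩
  · intro d hd
    rw [Finset.mem_singleton]
    rintro rfl
    exact hnd.1 hd
  -- Putting the root half-edge in front, with step `0`, turns the walk into the whole contour.
  · have : M.Forward ∅ ((M.root, 0) :: M.walk (M.others n M.root) (List.ofFn child)) := by
      rw [hw, forward_iff]
      intro L₁ d L₂ hL hm
      right
      obtain ⟨c₁, c₂, hc, rfl, hc₂⟩ := List.map_eq_append_iff.1 hL
      obtain ⟨c, c₂', rfl, hcd, -⟩ := List.map_eq_cons_iff.1 hc₂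
      simp only [Prod.mk.injEq] at hcd
      obtain ⟨rfl, hs⟩ := hcd
      have hlt := h.forward c hs hm
      have hcn := nodup_contour (PlantedTree.node n child)
      rw [hc] at hlt hcn
      have hnot : c ∉ c₁ := fun h' => (List.nodup_append.1 hcn).2.2 c h' c (by simp) rfl
      have := mem_of_idxOf_lt hnot hlt
      rw [List.map_map, List.mem_map]
      exact ⟨_, this, g.apply_symm_apply _⟩
    simpa using this.2

theorem TreeStructure.tree_unique {T T' : PlantedTree} {g : T.Below ≃ D} {g' : T'.Below ≃ D}
    (h : M.TreeStructure T g) (h' : M.TreeStructure T' g') (hE : T.IsEulerian)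
    (hE' : T'.IsEulerian) : T = T' := by
  match T, T' with
  | .node n child, .node n' child' =>
    obtain ⟨h1, h2⟩ := h.run
    obtain ⟨h3, h4⟩ := h'.run
    obtain rfl : n = n' := by omega
    rw [List.ofFn_injective (h2.forest_unique h4 (h.good hE) (h'.good hE') ?_ (stackInv_root h1))]
    intro d hd
    rw [Finset.mem_singleton] at hd
    subst hd
    exact iff_of_true (h.good hE).root_mem (h'.good hE').root_mem
  | .opening, _ => cases h.root
  | .closing, _ => cases h.root
  | .node _ _, .opening => cases h'.root
  | .node _ _, .closing => cases h'.root

-- Each labelling follows the tree from the root half-edge, which leaves no freedom; hence no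
-- symmetry factors arise later.
omit [DecidableEq D] in
theorem TreeStructure.equiv_unique {T : PlantedTree} {g g' : T.Below ≃ D}
    (h : M.TreeStructure T g) (h' : M.TreeStructure T g') : g = g' := by
  ext x
  rw [h.eq_follow, h'.eq_follow]

theorem GoodOrientation.exists_treeStructure [Fintype D] (hO : M.GoodOrientation O) :
    ∃ (T : PlantedTree) (g : T.Below ≃ D), T.IsEulerian ∧ M.TreeStructure T g := by
  obtain ⟨n, hn⟩ : ∃ n, Function.minimalPeriod M.next M.root = n + 1 := by
    have : 0 < Function.minimalPeriod M.next M.root :=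
      Function.minimalPeriod_pos_of_mem_periodicPts (M.next.injective.mem_periodicPts _)
    exact ⟨_, (Nat.succ_pred_eq_of_pos this).symm⟩
  have hinv := stackInv_root hn
  have hsame : ∀ a ∈ M.others n M.root, ∀ S, M.Saturated S → (a ∈ S ↔ M.root ∈ S) := by
    intro a ha S hS
    obtain ⟨j, rfl⟩ := (List.mem_ofFn' _ _).1 ha
    exact hS.iterate _ _
  obtain ⟨O', f, hO', -, hR, hE⟩ := exists_run _ {M.root} (M.others n M.root) O le_rfl hO hinv
    (Finset.mem_singleton_self _) (by
      apply List.pairwise_of_forall_mem_list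
      intro a ha b hb
      exact Or.inl fun S hS => (hsame a ha S hS).trans (hsame b hb S hS).symm)
  obtain ⟨child, rfl⟩ : ∃ child : Fin n → PlantedTree, f = List.ofFn child := by
    have hlen : f.length = n := by
      rw [← hR.length_eq]
      simp [others]
    subst hlen
    exact ⟨f.get, (List.ofFn_get _).symm⟩
  obtain ⟨hX, -⟩ := hR.split (st := M.others n M.root) (hs := []) (f := List.ofFn child) (ts := [])
    (by simp) (by simp) hR.length_eq (by simpa using hinv)
  have hw := M.walk_others n child M.root
  have hw' : M.root :: (M.walk (M.others n M.root) (List.ofFn child)).map Prod.fst =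
      (PlantedTree.node n child).contour.map (M.follow (.node n child) M.root) := by
    have := congrArg (List.map Prod.fst) hw
    simpa [Function.comp_def] using this
  set L := (M.walk (M.others n M.root) (List.ofFn child)).map Prod.fst with hL
  -- Otherwise the unvisited half-edges form a nonempty union of vertices without the root.
  -- Accessibility gives an unmarked edge from there to a visited half-edge; the latter is incoming,
  -- so by `closed` the other half has been visited too.
  have hall : ∀ d, d ∈ M.root :: L := by
    have hV : M.Saturated ({M.root} ∪ L.toFinset) := by simpa using hX.inv.saturated
    intro d
    by_contra hd
    have hS : M.Saturated ({M.root} ∪ L.toFinset)ᶜ := fun e => by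
      rw [Finset.mem_compl, Finset.mem_compl, hV]
    obtain ⟨e, he, heO, hem, he'⟩ := hO'.accessible _ hS ⟨d, by simpa using hd⟩ (by simp)
    rw [Finset.mem_compl, not_not, Finset.mem_union, Finset.mem_singleton] at he'
    rw [Finset.mem_compl] at he
    have heO' := (hO'.orientation e).1 heO
    rcases he' with he' | he'
    · exact heO' (he' ▸ hO'.root_mem)
    · apply he
      have := hX.closed _ (List.mem_toFinset.1 he') heO' (by rwa [M.opp_opp])
      rwa [M.opp_opp] at this
  have hnd : (M.root :: L).Nodup := by
    rw [List.nodup_cons]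
    exact ⟨fun h => hX.notMem _ h (Finset.mem_singleton_self _), hX.nodup⟩
  have hbij : Function.Bijective (M.follow (.node n child) M.root) := by
    rw [hw'] at hall hnd
    constructor
    · intro x y hxy
      exact List.inj_on_of_nodup_map hnd (mem_contour x) (mem_contour y) hxy
    · intro d
      obtain ⟨x, -, hx⟩ := List.mem_map.1 (hall d)
      exact ⟨x, hx⟩
  have hfit : M.Fits O' (.node n child) M.root := by
    refine fits_node.2 ⟨hn, fun j => ?_⟩
    have := (List.forall₂_iff_get.1 hR.hangs).2 j (by simp [others]) (by simp)
    simpa [others] using this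
  have hdeg := hO'.degree hO'.root_mem hn
  let g : (PlantedTree.node n child).Below ≃ D := Equiv.ofBijective _ hbij
  -- The orientation read off the tree is the one with which the search ended.
  have hgO : outSet g = O' := by
    ext d
    obtain ⟨x, rfl⟩ := g.surjective d
    rw [mem_outSet, g.symm_apply_apply]
    exact hfit.follow_out hO' hO'.root_mem x
  refine ⟨.node n child, g, ⟨⟨_, hdeg, ?_⟩, fun j => hE _ (by simp [List.mem_ofFn])⟩, ?_, ?_, ?_, ?_,
    ?_⟩
  · congr 2
    ext j
    simp only [Finset.mem_filter, Finset.mem_univ, true_and]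
    exact ((fits_node.1 hfit).2 j).1.symm
  · rw [hgO]
    exact hfit.embedding hO' hO'.root_mem hbij.1
  · rw [base_node, Option.some_inj, Equiv.eq_symm_apply]
    rfl
  · rw [hgO]
    exact hO'.orientation
  · rw [hgO]
    exact hO'.compatible
  · intro c hc hm
    have hF : M.Forward ∅ ((M.root, 0) :: M.walk (M.others n M.root) (List.ofFn child)) :=
      ⟨fun h => absurd h (by decide), by simpa using hR.forward⟩
    rw [hw, forward_iff] at hF
    obtain ⟨c₁, c₂, hcc⟩ := List.append_of_mem (mem_contour c)
    have := hF (c₁.map _) (g c) (c₂.map _) (by rw [hcc, List.map_append, List.map_cons, hc]; rfl) hm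
    rw [or_iff_right (Finset.notMem_empty _), List.map_map, List.mem_map] at this
    obtain ⟨y, hy, hyc⟩ := this
    have e : g y = M.opp (g c) := hyc
    rw [← e, g.symm_apply_apply, hcc]
    have hcn := nodup_contour (PlantedTree.node n child)
    rw [hcc] at hcn
    have hnot : c ∉ c₁ := fun h' => (List.nodup_append.1 hcn).2.2 c h' c (by simp) rfl
    rw [idxOf_append_self hnot, List.idxOf_append_of_mem hy]
    exact List.idxOf_lt_length_of_mem hy

end MarkedMap

/-! ### Vertices and edges; admissibility in terms of good orientations. -/

namespace MarkedMap

variable {D : Type} [Fintype D] {M : MarkedMap D}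

theorem mem_vertexOf {d e : D} : e ∈ M.vertexOf d ↔ M.next.SameCycle d e := by
  simp [vertexOf]

theorem self_mem_vertexOf (d : D) : d ∈ M.vertexOf d :=
  mem_vertexOf.2 (Equiv.Perm.SameCycle.refl _ _)

theorem vertexOf_eq_iff {d e : D} : M.vertexOf d = M.vertexOf e ↔ M.next.SameCycle e d := by
  constructor
  · intro h
    rw [← mem_vertexOf, ← h]
    exact self_mem_vertexOf d
  · intro h
    ext x
    rw [mem_vertexOf, mem_vertexOf]
    exact ⟨fun h' => h.trans h', fun h' => h.symm.trans h'⟩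

theorem vertexOf_next (d : D) : M.vertexOf (M.next d) = M.vertexOf d := by
  rw [vertexOf_eq_iff]
  exact Equiv.Perm.sameCycle_apply_right.2 (Equiv.Perm.SameCycle.refl _ _)

theorem vertexOf_mem_vertices (d : D) : M.vertexOf d ∈ M.vertices := by
  simp [vertices]

theorem exists_vertexOf_eq {v : Finset D} (hv : v ∈ M.vertices) : ∃ d, M.vertexOf d = v := by
  simpa [vertices] using hv

theorem mem_vertexOf_iff_iterate {d e : D} : e ∈ M.vertexOf d ↔ ∃ n : ℕ, M.next^[n] d = e := by
  rw [mem_vertexOf]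
  constructor
  · intro h
    obtain ⟨n, hn⟩ := h.exists_nat_pow_eq
    exact ⟨n, by rw [Equiv.Perm.iterate_eq_pow]; exact hn⟩
  · rintro ⟨n, rfl⟩
    rw [Equiv.Perm.iterate_eq_pow]
    exact ⟨n, by simp⟩

theorem saturated_vertexOf (d : D) : M.Saturated (M.vertexOf d) := by
  intro e
  rw [mem_vertexOf, mem_vertexOf, Equiv.Perm.sameCycle_apply_right]

theorem Saturated.mem_of_mem_vertexOf {S : Finset D} (hS : M.Saturated S) {d e : D} (hd : d ∈ S)
    (he : e ∈ M.vertexOf d) : e ∈ S := by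
  obtain ⟨n, rfl⟩ := mem_vertexOf_iff_iterate.1 he
  rwa [hS.iterate]

theorem card_vertexOf (d : D) : (M.vertexOf d).card = Function.minimalPeriod M.next d := by
  classical
  have : M.vertexOf d =
      (Finset.range (Function.minimalPeriod M.next d)).image fun j => M.next^[j] d := by
    ext e
    rw [mem_vertexOf_iff_iterate, Finset.mem_image]
    constructor
    · rintro ⟨n, rfl⟩
      refine ⟨n % Function.minimalPeriod M.next d, ?_, Function.iterate_mod_minimalPeriod_eq⟩
      rw [Finset.mem_range]
      exact Nat.mod_lt _ (Function.minimalPeriod_pos_of_mem_periodicPts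
        (M.next.injective.mem_periodicPts _))
    · rintro ⟨n, -, rfl⟩
      exact ⟨n, rfl⟩
  rw [this, Finset.card_image_of_injOn, Finset.card_range]
  simpa [Set.Iio_def] using Function.iterate_injOn_Iio_minimalPeriod (f := M.next) (x := d)

section Decidable

variable [DecidableEq D]

/-- A saturated set is a disjoint union of vertices, so balance at vertices becomes balance of
saturated sets. -/
theorem Saturated.card_inter {S : Finset D} (hS : M.Saturated S) (O : Finset D) :
    (S ∩ O).card = ∑ v ∈ S.image M.vertexOf, (v ∩ O).card := by
  rw [Finset.card_eq_sum_card_fiberwise (f := M.vertexOf) (t := S.image M.vertexOf)]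
  · refine Finset.sum_congr rfl fun v hv => ?_
    obtain ⟨d, hd, rfl⟩ := Finset.mem_image.1 hv
    congr 1
    ext e
    rw [Finset.mem_filter, Finset.mem_inter, Finset.mem_inter, vertexOf_eq_iff, ← mem_vertexOf]
    have := fun h => hS.mem_of_mem_vertexOf hd (e := e) h
    tauto
  · intro d hd
    exact Finset.mem_image_of_mem _ (Finset.mem_inter.1 hd).1

/-- A path to the root that starts in a saturated set missing the root has to leave this set, and
the edge where it does is the one required by `accessible`. -/
theorem exists_goodOrientation (hE : M.IsAdmissible) : ∃ O, M.GoodOrientation O := by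
  classical
  obtain ⟨out, ⟨ho, hv⟩, hc, ha, hr⟩ := hE
  refine ⟨Finset.univ.filter (· ∈ out), ?_, ?_, ?_, ?_, ?_⟩
  · intro d
    simpa using ho d
  · intro S hS
    have h1 := hS.card_inter (Finset.univ.filter (· ∈ out))
    have h2 := hS.card_inter Finset.univ
    simp only [Finset.inter_univ] at h2
    rw [h1, h2, Finset.mul_sum]
    refine Finset.sum_congr rfl fun v hv' => ?_
    obtain ⟨d, hd, rfl⟩ := Finset.mem_image.1 hv'
    rw [← hv _ (vertexOf_mem_vertices d), Finset.inter_filter, Finset.inter_univ]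
  · intro d hd
    simpa using hc d hd
  · intro S hS ⟨d, hd⟩ hroot
    have key : ∀ v, Relation.ReflTransGen (M.Step out) v (M.vertexOf M.root) →
        (∃ d ∈ S, M.vertexOf d = v) → ∃ d ∈ S, d ∈ out ∧ M.mult d = 0 ∧ M.opp d ∉ S := by
      intro v hv
      induction hv using Relation.ReflTransGen.head_induction_on with
      | refl =>
        rintro ⟨d, hd, h⟩
        rw [vertexOf_eq_iff, ← mem_vertexOf] at h
        refine absurd (hS.mem_of_mem_vertexOf hd ?_) hroot
        rw [mem_vertexOf] at h ⊢
        exact h.symm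
      | head h _ ih =>
        rintro ⟨d, hd, h'⟩
        obtain ⟨e, heo, hm, -, rfl, rfl⟩ := h
        have heS : e ∈ S := hS.mem_of_mem_vertexOf hd (h' ▸ self_mem_vertexOf e)
        by_cases heS' : M.opp e ∈ S
        · exact ih ⟨_, heS', rfl⟩
        · exact ⟨e, heS, heo, hm, heS'⟩
    obtain ⟨e, h1, h2, h3⟩ := key _ (ha _ (vertexOf_mem_vertices d)) ⟨d, hd, rfl⟩
    exact ⟨e, h1, by simpa using h2, h3⟩
  · simpa using hr

theorem GoodOrientation.isAdmissible {O : Finset D} (h : M.GoodOrientation O) :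
    M.IsAdmissible := by
  classical
  refine ⟨O, ⟨fun d => h.orientation d, ?_⟩, fun d hd => h.compatible d hd, ?_, h.root_mem⟩
  · intro v hv
    obtain ⟨d, rfl⟩ := exists_vertexOf_eq hv
    rw [← h.balanced _ (saturated_vertexOf d)]
    congr 2
    ext e
    simp
  · intro v hv
    by_contra hcon
    obtain ⟨d₀, rfl⟩ := exists_vertexOf_eq hv
    -- The half-edges at vertices that have no path to the root; an unmarked edge directed out of
    -- this set would provide such a path.
    set S := Finset.univ.filter fun d =>
      ¬ Relation.ReflTransGen (M.Step O) (M.vertexOf d) (M.vertexOf M.root) with hS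
    have hsat : M.Saturated S := by
      intro d
      simp [hS, vertexOf_next]
    obtain ⟨d, hd, hdO, hm, hd'⟩ := h.accessible S hsat ⟨d₀, by simp [hS, hcon]⟩
      (by simp [hS, Relation.ReflTransGen.refl])
    simp only [hS, Finset.mem_filter, Finset.mem_univ, true_and, not_not] at hd hd'
    refine hd (Relation.ReflTransGen.head ⟨d, hdO, hm, ?_, rfl, rfl⟩ hd')
    exact h.mult_eq_zero ((h.orientation d).1 hdO)

theorem GoodOrientation.isEulerian {O : Finset D} (h : M.GoodOrientation O) : M.IsEulerian := by
  intro v hv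
  obtain ⟨d, rfl⟩ := exists_vertexOf_eq hv
  rw [← h.balanced _ (saturated_vertexOf d)]
  exact even_two_mul _

end Decidable

/-- A vertex is met once by each of its half-edges. Statistics of vertices thus become sums over
half-edges, which can be compared with those of a tree on the same half-edges. -/
theorem sum_vertices (f : Finset D → ℕ) :
    ∑ d, f (M.vertexOf d) = ∑ v ∈ M.vertices, v.card * f v := by
  classical
  rw [← Finset.sum_fiberwise_of_maps_to (t := M.vertices) (g := M.vertexOf)
    fun d _ => vertexOf_mem_vertices d]
  refine Finset.sum_congr rfl fun v hv => ?_
  obtain ⟨d, rfl⟩ := exists_vertexOf_eq hv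
  have : (Finset.univ.filter fun e => M.vertexOf e = M.vertexOf d) = M.vertexOf d := by
    ext e
    simp [vertexOf_eq_iff, mem_vertexOf]
  rw [Finset.sum_congr (g := fun _ => f (M.vertexOf d)) rfl (by
    intro e he
    rw [(Finset.mem_filter.1 he).2]), this, Finset.sum_const, smul_eq_mul]

theorem two_mul_vertexCount (k : ℕ) : 2 * k * M.vertexCount k =
    ∑ d, if Function.minimalPeriod M.next d = 2 * k then 1 else 0 := by
  classical
  have := M.sum_vertices fun v => if v.card = 2 * k then 1 else 0
  simp only [card_vertexOf, mul_ite, mul_one, mul_zero] at this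
  rw [this, ← Finset.sum_filter, vertexCount, Finset.sum_congr (g := fun _ => 2 * k) rfl (by
    intro v hv
    exact (Finset.mem_filter.1 hv).2), Finset.sum_const, smul_eq_mul, mul_comm]

theorem vertexCount_zero : M.vertexCount 0 = 0 := by
  rw [vertexCount, Finset.card_eq_zero, Finset.filter_eq_empty_iff]
  intro v hv h
  obtain ⟨d, rfl⟩ := exists_vertexOf_eq hv
  rw [mul_zero, Finset.card_eq_zero] at h
  have := self_mem_vertexOf (M := M) d
  rw [h] at this
  exact Finset.notMem_empty _ this

theorem two_mul_halfDegree (hE : M.IsEulerian) : 2 * M.halfDegree = Fintype.card D := by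
  have := M.sum_vertices fun _ => 1
  simp only [Finset.sum_const, Finset.card_univ, smul_eq_mul, mul_one] at this
  rw [this, halfDegree, Finset.mul_sum]
  exact Finset.sum_congr rfl fun v hv => Nat.two_mul_div_two_of_even (hE v hv)

theorem two_mul_edgeCount : 2 * M.edgeCount = Fintype.card D := by
  classical
  rw [← Finset.card_univ, Finset.card_eq_sum_card_fiberwise (f := fun d => ({d, M.opp d} : Finset D))
    (t := M.edges), edgeCount, mul_comm, ← smul_eq_mul, ← Finset.sum_const]
  · refine Finset.sum_congr rfl fun v hv => ?_
    obtain ⟨d, -, rfl⟩ := Finset.mem_image.1 hv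
    have : (Finset.univ.filter fun e => ({e, M.opp e} : Finset D) = {d, M.opp d}) =
        {d, M.opp d} := by
      ext e
      simp only [Finset.mem_filter, Finset.mem_univ, true_and]
      constructor
      · intro h
        rw [← h]
        simp
      · intro h
        rcases Finset.mem_insert.1 h with rfl | h
        · rfl
        · rw [Finset.mem_singleton] at h
          rw [h, M.opp_opp, Finset.pair_comm]
    convert (Finset.card_pair (M.opp_ne d).symm).symm using 2
  · intro d _
    simp [edges]

end MarkedMap

/-! ### Relabelling half-edges. -/

namespace MarkedMap

variable {B D : Type}

theorem map_mem_closure_permCongr (g : B ≃ D) {a b x : Equiv.Perm B}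
    (hx : x ∈ Subgroup.closure ({a, b} : Set (Equiv.Perm B))) :
    g.permCongrHom x ∈
      Subgroup.closure ({g.permCongrHom a, g.permCongrHom b} : Set (Equiv.Perm D)) := by
  have := Subgroup.mem_map_of_mem g.permCongrHom.toMonoidHom hx
  rw [MonoidHom.map_closure, Set.image_pair] at this
  exact this

/-- The map on another set of half-edges. -/
def pullback (M : MarkedMap D) (g : B ≃ D) : MarkedMap B where
  next := g.symm.permCongrHom M.next
  opp := g.symm.permCongrHom M.opp
  opp_opp d := by simp [Equiv.permCongrHom, M.opp_opp]
  opp_ne d h := by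
    simp only [Equiv.permCongrHom, MulEquiv.coe_mk, Equiv.permCongr_apply, Equiv.symm_symm,
      Equiv.symm_apply_eq] at h
    exact M.opp_ne _ h
  connected d e := by
    obtain ⟨x, hx, h⟩ := M.connected (g d) (g e)
    refine ⟨g.symm.permCongrHom x, map_mem_closure_permCongr _ hx, ?_⟩
    simp [Equiv.permCongrHom, Equiv.permCongr_apply, h]
  root := g.symm M.root
  mult d := M.mult (g d)
  mult_opp d h := by simpa [Equiv.permCongrHom, Equiv.permCongr_apply] using M.mult_opp _ h

theorem isIso_pullback (M : MarkedMap D) (g : B ≃ D) : (M.pullback g).IsIso M g where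
  next d := by simp [pullback, Equiv.permCongrHom, Equiv.permCongr_apply]
  opp d := by simp [pullback, Equiv.permCongrHom, Equiv.permCongr_apply]
  root := by simp [pullback]
  mult _ := rfl

theorem IsIso.eq_of_refl {M M' : MarkedMap D} (h : M.IsIso M' (Equiv.refl D)) : M = M' := by
  obtain ⟨h1, h2, h3, h4⟩ := h
  obtain ⟨⟨n, o, _, _, _, r⟩, m, _⟩ := M
  obtain ⟨⟨n', o', _, _, _, r'⟩, m', _⟩ := M'
  obtain rfl : n = n' := Equiv.ext h1
  obtain rfl : o = o' := Equiv.ext h2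
  obtain rfl : r = r' := h3
  obtain rfl : m' = m := funext h4
  rfl

theorem IsIso.treeStructure {M : MarkedMap B} {M' : MarkedMap D} {f : B ≃ D} (h : M.IsIso M' f)
    {T : PlantedTree} {g : T.Below ≃ B} (hT : M.TreeStructure T g) :
    M'.TreeStructure T (g.trans f) := by
  have mem : ∀ d, f d ∈ outSet (g.trans f) ↔ d ∈ outSet g := fun d => by simp
  constructor
  · constructor
    · exact (g.trans f).injective
    · intro x
      simp only [Equiv.trans_apply]
      rw [hT.embedding.next, h.next]
    · intro x hx
      simp only [Equiv.trans_apply]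
      rw [← hT.embedding.opp x hx, h.opp]
    · intro x
      simp
    · intro x hx
      simp only [Equiv.trans_apply]
      rw [h.mult]
      exact hT.embedding.mult x hx
  · rw [hT.root, ← h.root]
    simp
  · intro d
    obtain ⟨d, rfl⟩ := f.surjective d
    rw [← h.opp, mem, mem]
    exact hT.orientation d
  · intro d hd
    obtain ⟨d, rfl⟩ := f.surjective d
    rw [mem]
    rw [h.mult] at hd
    exact hT.compatible d hd
  · intro c hc hm
    simp only [Equiv.trans_apply] at hm ⊢
    rw [← h.opp, h.mult] at hm
    have := hT.forward c hc hm
    rwa [← h.opp, Equiv.symm_trans_apply, Equiv.symm_apply_apply]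

/-- The isomorphism class of an admissible map. -/
noncomputable def toAdmissible [Fintype D] [DecidableEq D] (M : MarkedMap D)
    (h : ∃ O, M.GoodOrientation O) : AdmissibleMap :=
  Quotient.mk _
    { n := Fintype.card D
      map := M.pullback (Fintype.equivFin D).symm
      eulerian := by
        obtain ⟨O, hO⟩ := h
        have hi := (M.isIso_pullback (Fintype.equivFin D).symm).symm
        intro v hv
        rw [hi.vertices] at hv
        obtain ⟨w, hw, rfl⟩ := Finset.mem_map.1 hv
        simpa using hO.isEulerian w hw
      admissible := by
        obtain ⟨O, hO⟩ := h
        have hi := (M.isIso_pullback (Fintype.equivFin D).symm).symm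
        obtain ⟨T, g, hE, hT⟩ := hO.exists_treeStructure
        exact ((hi.treeStructure hT).good hE).isAdmissible }

section

variable [Fintype D] [DecidableEq D] {M : MarkedMap D} (h : ∃ O, M.GoodOrientation O)

theorem toAdmissible_eq_mk {L : LabelledMap} {f : D ≃ Fin L.n} (hf : M.IsIso L.map f) :
    M.toAdmissible h = Quotient.mk _ L :=
  Quotient.sound ⟨_, (M.isIso_pullback _).trans hf⟩

theorem exists_isIso_of_toAdmissible_eq {M' : MarkedMap D} {h' : ∃ O, M'.GoodOrientation O}
    (heq : M.toAdmissible h = M'.toAdmissible h') : ∃ f, M.IsIso M' f := by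
  obtain ⟨f, hf⟩ := Quotient.exact heq
  exact ⟨_, ((M.isIso_pullback _).symm.trans hf).trans (M'.isIso_pullback _)⟩

theorem vertexCount_toAdmissible (k : ℕ) : (M.toAdmissible h).vertexCount k = M.vertexCount k :=
  (M.isIso_pullback _).vertexCount k

theorem halfDegree_toAdmissible : (M.toAdmissible h).halfDegree = M.halfDegree :=
  (M.isIso_pullback _).halfDegree

theorem totalMult_toAdmissible : (M.toAdmissible h).totalMult = M.totalMult :=
  (M.isIso_pullback _).totalMult

end

end MarkedMap

/-! ### The tree of an admissible map. -/

namespace AdmissibleMap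

theorem exists_tree (A : AdmissibleMap) : ∃ T : PlantedTree, T.IsEulerian ∧
    ∃ (L : LabelledMap) (g : T.Below ≃ Fin L.n), Quotient.mk _ L = A ∧ L.map.TreeStructure T g := by
  obtain ⟨L, rfl⟩ := Quotient.exists_rep A
  obtain ⟨O, hO⟩ := MarkedMap.exists_goodOrientation L.admissible
  obtain ⟨T, g, hE, hT⟩ := hO.exists_treeStructure
  exact ⟨T, hE, L, g, rfl, hT⟩

/-- The tree obtained by opening a map. -/
noncomputable def tree (A : AdmissibleMap) : PlantedTree := A.exists_tree.choose

theorem tree_isEulerian (A : AdmissibleMap) : A.tree.IsEulerian := A.exists_tree.choose_spec.1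

theorem tree_unique {L : LabelledMap} {T : PlantedTree} {g : T.Below ≃ Fin L.n}
    (hE : T.IsEulerian) (hT : L.map.TreeStructure T g) :
    AdmissibleMap.tree (Quotient.mk _ L) = T := by
  obtain ⟨hE', L', g', hL, hT'⟩ := (exists_tree (Quotient.mk _ L)).choose_spec
  obtain ⟨f, hf⟩ := Quotient.exact hL
  exact (hf.treeStructure hT').tree_unique hT hE' hE

/-- The maps that open to a given tree are the ways to close it. -/
noncomputable def ofTree {T : PlantedTree} (hE : T.IsEulerian)
    (M : {M : MarkedMap T.Below // M.TreeStructure T (Equiv.refl _)}) :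
    {A : AdmissibleMap // A.tree = T} :=
  ⟨M.1.toAdmissible ⟨_, M.2.good hE⟩,
    tree_unique hE ((M.1.isIso_pullback _).symm.treeStructure M.2)⟩

/-- Injectivity is rigidity: an isomorphism between two closings of `T` preserves the labelling by
`T`, so it is the identity. For surjectivity, the half-edges of a map are relabelled by those of its
tree. -/
theorem bijective_ofTree {T : PlantedTree} (hE : T.IsEulerian) :
    Function.Bijective (ofTree hE) := by
  constructor
  · rintro ⟨M, hM⟩ ⟨M', hM'⟩ h
    obtain ⟨f, hf⟩ := MarkedMap.exists_isIso_of_toAdmissible_eq ⟨_, hM.good hE⟩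
      (h' := ⟨_, hM'.good hE⟩) (congrArg Subtype.val h)
    have h1 := (hf.treeStructure hM).equiv_unique hM'
    obtain rfl : f = Equiv.refl _ := h1
    exact Subtype.ext hf.eq_of_refl
  · rintro ⟨A, rfl⟩
    obtain ⟨hE', L, g, hL, hT⟩ := A.exists_tree.choose_spec
    have hi := L.map.isIso_pullback g
    have hM : (L.map.pullback g).TreeStructure A.tree (Equiv.refl _) := by
      have := hi.symm.treeStructure hT
      rwa [Equiv.self_trans_symm] at this
    exact ⟨⟨_, hM⟩, Subtype.ext ((MarkedMap.toAdmissible_eq_mk ⟨_, hM.good hE⟩ hi).trans hL)⟩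

end AdmissibleMap

/-! ### Closing a tree: matchings of its leaves. -/

namespace PlantedTree

/-- The half-edges that lead to closing leaves. -/
abbrev Cl (T : PlantedTree) : Type := {x : T.Below // T.sgn x = -1}

/-- The half-edges that lead to opening leaves, and to the root leaf. -/
abbrev Op (T : PlantedTree) : Type := {x : T.Below // T.treeOpp x = x ∧ T.Out x}

noncomputable instance fintypeOp (T : PlantedTree) : Fintype T.Op := Fintype.ofFinite _

theorem sgn_eq_neg_one_iff {T : PlantedTree} (x : T.Below) :
    T.sgn x = -1 ↔ T.treeOpp x = x ∧ ¬ T.Out x := by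
  rw [treeOpp_eq_self_iff]
  constructor
  · intro h
    exact ⟨Or.inr (by rw [h]; decide), not_out_of_sgn_eq_neg_one h⟩
  · rintro ⟨h | h, h'⟩
    · exact absurd (out_base h) h'
    · rcases sgn_cases x with h1 | h1 | h1
      · exact absurd (out_of_sgn_eq_one h1) h'
      · exact h1
      · exact absurd h1 h

theorem treeOpp_cl {T : PlantedTree} (c : T.Cl) : T.treeOpp c.1 = c.1 :=
  ((sgn_eq_neg_one_iff _).1 c.2).1

theorem not_out_cl {T : PlantedTree} (c : T.Cl) : ¬ T.Out c.1 :=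
  ((sgn_eq_neg_one_iff _).1 c.2).2

/-- A way to match the closing leaves with the opening ones, with multiplicities. -/
def IsMatching (T : PlantedTree) (p : (T.Cl ≃ T.Op) × (T.Op → ℕ)) : Prop :=
  ∀ c, p.2 (p.1 c) = 0 → T.contour.idxOf (p.1 c).1 < T.contour.idxOf c.1

/-- The edges between nodes already connect all half-edges, whatever the matching of the leaves;
this makes `close` connected. -/
theorem reachable {T : PlantedTree} {D : Type} {g : T.Below → D} {ν ω : Equiv.Perm D}
    (hν : ∀ x, g (T.rot x) = ν (g x)) (hω : ∀ x, T.treeOpp x ≠ x → ω (g x) = g (T.treeOpp x))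
    {b : T.Below} (hb : T.base = some b) (x : T.Below) :
    ∃ w ∈ Subgroup.closure ({ν, ω} : Set (Equiv.Perm D)), w (g b) = g x := by
  have hν' : ν ∈ Subgroup.closure ({ν, ω} : Set (Equiv.Perm D)) := Subgroup.subset_closure (by simp)
  have hω' : ω ∈ Subgroup.closure ({ν, ω} : Set (Equiv.Perm D)) := Subgroup.subset_closure (by simp)
  induction T with
  | opening => exact x.elim
  | closing => exact x.elim
  | node n child ih =>
    obtain rfl : half 0 = b := Option.some_injective _ hb
    have key : ∀ j : Fin (n + 1),
        ∃ w ∈ Subgroup.closure ({ν, ω} : Set (Equiv.Perm D)), w (g (half 0)) = g (half j) := by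
      intro j
      refine Fin.induction ⟨1, Subgroup.one_mem _, rfl⟩ (fun j ⟨w, hw, h⟩ => ?_) j
      refine ⟨ν * w, Subgroup.mul_mem _ hν' hw, ?_⟩
      rw [Equiv.Perm.mul_apply, h, ← hν, rot_half_castSucc]
    rcases half_or_sub x with ⟨j, rfl⟩ | ⟨j, y, rfl⟩
    · exact key j
    · cases hc : (child j).base with
      | none => exact ((MarkedMap.isEmpty_below hc).false y).elim
      | some b =>
        obtain ⟨w, hw, h⟩ := key j.succ
        obtain ⟨w', hw', h'⟩ := ih j (g := fun x => g (sub j x)) (fun x => by rw [← hν, rot_sub])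
          (fun x hx => by
            have hbx : (child j).base ≠ some x := fun hb => hx (treeOpp_base hb)
            rw [← treeOpp_sub hbx]
            refine hω _ fun h => hx ?_
            rw [treeOpp_sub hbx] at h
            exact sub_injective j h) hc y
        refine ⟨w' * (ω * w), Subgroup.mul_mem _ hw' (Subgroup.mul_mem _ hω' hw), ?_⟩
        have e := treeOpp_half_succ (child := child) hc
        rw [Equiv.Perm.mul_apply, Equiv.Perm.mul_apply, h, hω, e]
        · exact h'
        · rw [e]
          exact sub_ne_half _ _ _

section Matching

variable {T : PlantedTree} (σ : T.Cl ≃ T.Op) (μ : T.Op → ℕ)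

open Classical in
/-- The other half of an edge when the leaves are matched. -/
noncomputable def matchOpp (x : T.Below) : T.Below :=
  if hc : T.sgn x = -1 then (σ ⟨x, hc⟩).1
  else if ho : T.treeOpp x = x ∧ T.Out x then (σ.symm ⟨x, ho⟩).1
  else T.treeOpp x

theorem matchOpp_cl (c : T.Cl) : matchOpp σ c.1 = (σ c).1 := dif_pos c.2

theorem not_sgn_op (o : T.Op) : ¬ T.sgn o.1 = -1 := fun h => not_out_cl ⟨o.1, h⟩ o.2.2

theorem matchOpp_op (o : T.Op) : matchOpp σ o.1 = (σ.symm o).1 := by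
  rw [matchOpp, dif_neg (not_sgn_op o), dif_pos o.2]

theorem matchOpp_of_ne {x : T.Below} (hx : T.treeOpp x ≠ x) : matchOpp σ x = T.treeOpp x := by
  rw [matchOpp, dif_neg, dif_neg]
  · exact fun h => hx h.1
  · exact fun h => hx (treeOpp_cl ⟨x, h⟩)

/-- A half-edge leads to a closing leaf, an opening leaf or another node. -/
theorem kind_cases {motive : T.Below → Prop} (cl : ∀ c : T.Cl, motive c.1)
    (op : ∀ o : T.Op, motive o.1) (edge : ∀ x, T.treeOpp x ≠ x → motive x) (x : T.Below) :
    motive x := by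
  by_cases hx : T.treeOpp x = x
  · by_cases ho : T.Out x
    · exact op ⟨x, hx, ho⟩
    · exact cl ⟨x, (sgn_eq_neg_one_iff x).2 ⟨hx, ho⟩⟩
  · exact edge x hx

theorem treeOpp_treeOpp_ne {x : T.Below} (hx : T.treeOpp x ≠ x) :
    T.treeOpp (T.treeOpp x) ≠ T.treeOpp x := fun h => hx (by
  rw [treeOpp_treeOpp] at h
  exact h.symm)

theorem matchOpp_matchOpp (x : T.Below) : matchOpp σ (matchOpp σ x) = x := by
  induction x using kind_cases with
  | cl c => rw [matchOpp_cl, matchOpp_op, Equiv.symm_apply_apply]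
  | op o => rw [matchOpp_op, matchOpp_cl, Equiv.apply_symm_apply]
  | edge x hx => rw [matchOpp_of_ne σ hx, matchOpp_of_ne σ (treeOpp_treeOpp_ne hx), treeOpp_treeOpp]

theorem out_matchOpp (x : T.Below) : T.Out x ↔ ¬ T.Out (matchOpp σ x) := by
  induction x using kind_cases with
  | cl c =>
    rw [matchOpp_cl]
    exact iff_of_false (not_out_cl c) fun h => h (σ c).2.2
  | op o =>
    rw [matchOpp_op]
    exact iff_of_true o.2.2 (not_out_cl _)
  | edge x hx =>
    rw [matchOpp_of_ne σ hx, out_treeOpp hx, not_not]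

open Classical in
noncomputable def matchMult (x : T.Below) : ℕ :=
  if ho : T.treeOpp x = x ∧ T.Out x then μ ⟨x, ho⟩ else 0

theorem matchMult_op (o : T.Op) : matchMult μ o.1 = μ o := dif_pos o.2

theorem matchMult_of_not {x : T.Below} (hx : ¬ (T.treeOpp x = x ∧ T.Out x)) :
    matchMult μ x = 0 := dif_neg hx

variable {b : T.Below} (hb : T.base = some b)

/-- The map obtained by closing a tree. -/
noncomputable def close : MarkedMap T.Below where
  next := T.rot
  opp := Function.Involutive.toPerm (matchOpp σ) (matchOpp_matchOpp σ)
  opp_opp := matchOpp_matchOpp σ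
  -- The two halves of an edge have opposite directions, so they differ.
  opp_ne d h := by
    have h1 := out_matchOpp σ d
    have h2 : matchOpp σ d = d := h
    rw [h2] at h1
    tauto
  connected d e := by
    have key := reachable (T := T) (g := id) (ν := T.rot)
      (ω := Function.Involutive.toPerm (matchOpp σ) (matchOpp_matchOpp σ)) (fun _ => rfl)
      (fun x hx => matchOpp_of_ne σ hx) hb
    obtain ⟨w, hw, h⟩ := key d
    obtain ⟨w', hw', h'⟩ := key e
    refine ⟨w' * w⁻¹, Subgroup.mul_mem _ hw' (Subgroup.inv_mem _ hw), ?_⟩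
    have h'' : w⁻¹ d = b := Equiv.Perm.inv_eq_iff_eq.2 h.symm
    rw [Equiv.Perm.mul_apply, h'']
    exact h'
  root := b
  mult := matchMult μ
  mult_opp d hd := by
    apply matchMult_of_not
    rintro ⟨-, h⟩
    refine (out_matchOpp σ d).1 ?_ h
    by_contra h'
    exact hd (matchMult_of_not μ fun h => h' h.2)

theorem treeStructure_close (h : T.IsMatching (σ, μ)) :
    (close σ μ hb).TreeStructure T (Equiv.refl _) where
  embedding := by
    refine ⟨fun x y h => h, fun _ => rfl, fun x hx => matchOpp_of_ne σ hx, fun x => by simp,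
      fun x hx => matchMult_of_not μ fun h => hx h.1⟩
  root := hb
  orientation d := by
    rw [MarkedMap.mem_outSet, MarkedMap.mem_outSet]
    exact out_matchOpp σ d
  compatible d hd := by
    rw [MarkedMap.mem_outSet]
    by_contra h'
    exact hd (matchMult_of_not μ fun h => h' h.2)
  forward c hc hm := by
    have e : matchOpp σ c = (σ ⟨c, hc⟩).1 := matchOpp_cl σ ⟨c, hc⟩
    have hm' : matchMult μ (matchOpp σ c) = 0 := hm
    rw [e, matchMult_op] at hm'
    change T.contour.idxOf (matchOpp σ c) < _
    rw [e]
    exact h ⟨c, hc⟩ hm'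

end Matching

section Opposite

variable {T : PlantedTree} {M : MarkedMap T.Below} (h : M.TreeStructure T (Equiv.refl _))
include h

theorem treeOpp_opp {x : T.Below} (hx : T.treeOpp x = x) : T.treeOpp (M.opp x) = M.opp x := by
  by_contra hne
  have h1 : M.opp (M.opp x) = T.treeOpp (M.opp x) := h.embedding.opp _ hne
  rw [M.opp_opp] at h1
  have h2 := congrArg T.treeOpp h1
  rw [treeOpp_treeOpp, hx] at h2
  exact M.opp_ne x h2.symm

theorem out_opp (x : T.Below) : T.Out (M.opp x) ↔ ¬ T.Out x := by
  have := h.orientation x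
  simp only [MarkedMap.mem_outSet, Equiv.refl_symm, Equiv.refl_apply] at this
  tauto

/-- The matching of leaves in a map obtained by closing a tree. -/
def leafEquiv : T.Cl ≃ T.Op where
  toFun c := ⟨M.opp c.1, treeOpp_opp h (treeOpp_cl c), (out_opp h _).2 (not_out_cl c)⟩
  invFun o := ⟨M.opp o.1, (sgn_eq_neg_one_iff _).2
    ⟨treeOpp_opp h o.2.1, fun h' => (out_opp h _).1 h' o.2.2⟩⟩
  left_inv _ := Subtype.ext (M.opp_opp _)
  right_inv _ := Subtype.ext (M.opp_opp _)

end Opposite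

/-- The ways to close a tree correspond to the matchings of its leaves. -/
theorem exists_matching_equiv {T : PlantedTree} {b : T.Below} (hb : T.base = some b) :
    ∃ e : {p : (T.Cl ≃ T.Op) × (T.Op → ℕ) // T.IsMatching p} ≃
        {M : MarkedMap T.Below // M.TreeStructure T (Equiv.refl _)},
      ∀ p, (e p).1.totalMult = ∑ o, p.1.2 o := by
  refine ⟨Equiv.ofBijective
    (fun p => ⟨close p.1.1 p.1.2 hb, treeStructure_close _ _ hb p.2⟩) ⟨?_, ?_⟩, ?_⟩
  · rintro ⟨⟨σ, μ⟩, hp⟩ ⟨⟨σ', μ'⟩, hp'⟩ h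
    have h0 : close σ μ hb = close σ' μ' hb := congrArg Subtype.val h
    have h1 : ∀ x, matchOpp σ x = matchOpp σ' x := fun x =>
      congrArg (fun M : MarkedMap T.Below => M.opp x) h0
    have h2 : ∀ x, matchMult μ x = matchMult μ' x := fun x =>
      congrArg (fun M : MarkedMap T.Below => M.mult x) h0
    obtain rfl : σ = σ' := by
      ext c
      rw [← matchOpp_cl, h1, matchOpp_cl]
    obtain rfl : μ = μ' := by
      ext o
      have := h2 o.1
      rwa [matchMult_op, matchMult_op] at this
    rfl
  · rintro ⟨M, hM⟩
    have hmem : ∀ x, x ∈ MarkedMap.outSet (Equiv.refl T.Below) ↔ T.Out x := fun x => by simp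
    refine ⟨⟨(leafEquiv hM, fun o => M.mult o.1), ?_⟩, Subtype.ext ?_⟩
    · intro c hc
      exact hM.forward c.1 c.2 hc
    · apply MarkedMap.IsIso.eq_of_refl
      constructor
      · exact hM.embedding.next
      · intro x
        change matchOpp _ x = M.opp x
        induction x using kind_cases with
        | cl c => rw [matchOpp_cl]; rfl
        | op o => rw [matchOpp_op]; rfl
        | edge x hx => rw [matchOpp_of_ne _ hx]; exact (hM.embedding.opp x hx).symm
      · have := hM.root
        rw [hb, Option.some_inj] at this
        exact this
      · intro x
        change M.mult x = matchMult _ x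
        by_cases hx : T.treeOpp x = x ∧ T.Out x
        · exact (matchMult_op (fun o => M.mult o.1) ⟨x, hx⟩).symm
        · rw [matchMult_of_not _ hx]
          by_contra hm
          refine hx ⟨?_, (hmem x).1 (hM.compatible x hm)⟩
          by_contra hne
          exact hm (hM.embedding.mult x hne)
  · rintro ⟨⟨σ, μ⟩, hp⟩
    classical
    change ∑ x, matchMult μ x = ∑ o, μ o
    have e : ∑ o, μ o = ∑ o : T.Op, matchMult μ o.1 :=
      Finset.sum_congr rfl fun o _ => (matchMult_op μ o).symm
    rw [e, ← Finset.sum_subtype (Finset.univ.filter fun x => T.treeOpp x = x ∧ T.Out x) (by simp)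
        (matchMult μ), Finset.sum_filter_of_ne]
    intro x _ hx
    by_contra h
    exact hx (matchMult_of_not μ h)

end PlantedTree

/-! ### Trading multiplicities for tokens. -/

section Multiplicities

variable {O : Type} [Fintype O] [DecidableEq O]

/-- The functions with a given support and sum at most `m`. -/
def multFunctions (U : Finset O) (m : ℕ) : Finset (O → ℕ) :=
  (Fintype.piFinset fun _ => Finset.range (m + 1)).filter fun μ =>
    (∀ o, μ o ≠ 0 ↔ o ∈ U) ∧ ∑ o, μ o ≤ m

theorem mem_multFunctions {U : Finset O} {m : ℕ} {μ : O → ℕ} :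
    μ ∈ multFunctions U m ↔ (∀ o, μ o ≠ 0 ↔ o ∈ U) ∧ ∑ o, μ o ≤ m := by
  rw [multFunctions, Finset.mem_filter, and_iff_right_iff_imp]
  rintro ⟨-, h⟩
  rw [Fintype.mem_piFinset]
  intro o
  rw [Finset.mem_range, Nat.lt_succ_iff]
  exact (Finset.single_le_sum (f := μ) (fun _ _ => Nat.zero_le _) (Finset.mem_univ o)).trans h

/-- The hockey-stick identity, used to sum over the multiplicity of one element. -/
theorem sum_range_choose_eq (m k : ℕ) : ∑ j ∈ Finset.range m, j.choose k = m.choose (k + 1) := by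
  induction m with
  | zero => simp
  | succ m ih => rw [Finset.sum_range_succ, ih, Nat.choose_succ_succ, add_comm]

/-- If a new element of the support has value `v + 1`, the other values sum to at most `m - (v +
1)`. Summing over `v` is the hockey-stick identity. -/
theorem card_multFunctions (U : Finset O) (m : ℕ) :
    (multFunctions U m).card = m.choose U.card := by
  induction U using Finset.induction_on generalizing m with
  | empty =>
    rw [Finset.card_empty, Nat.choose_zero_right, Finset.card_eq_one]
    refine ⟨fun _ => 0, ?_⟩
    ext μ
    rw [mem_multFunctions, Finset.mem_singleton]
    constructor
    · rintro ⟨h, -⟩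
      funext o
      by_contra ho
      exact Finset.notMem_empty _ ((h o).1 ho)
    · rintro rfl
      simp
  | insert a U ha ih =>
    rw [Finset.card_insert_of_notMem ha, ← sum_range_choose_eq, ← Finset.sum_range_reflect,
      Finset.card_eq_sum_card_fiberwise (f := fun μ => μ a - 1) (t := Finset.range m)]
    · refine Finset.sum_congr rfl fun v hv => ?_
      rw [Finset.mem_range] at hv
      rw [← ih, show m - 1 - v = m - (v + 1) by omega]
      refine Finset.card_nbij' (fun μ => Function.update μ a 0)
        (fun μ => Function.update μ a (v + 1)) ?_ ?_ ?_ ?_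
      · intro μ hμ
        rw [Finset.mem_coe, Finset.mem_filter, mem_multFunctions] at hμ
        obtain ⟨⟨h1, h2⟩, h3⟩ := hμ
        have h4 := (h1 a).2 (Finset.mem_insert_self _ _)
        rw [Finset.mem_coe, mem_multFunctions]
        constructor
        · intro o
          beta_reduce
          by_cases ho : o = a
          · subst ho; simp [ha]
          · rw [Function.update_of_ne ho, h1, Finset.mem_insert, or_iff_right ho]
        · rw [Finset.sum_update_of_mem (Finset.mem_univ _)]
          rw [Finset.sum_eq_add_sum_sdiff_singleton_of_mem (Finset.mem_univ a)] at h2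
          omega
      · intro μ hμ
        rw [Finset.mem_coe, mem_multFunctions] at hμ
        obtain ⟨h1, h2⟩ := hμ
        have h4 : μ a = 0 := by
          by_contra h
          exact ha ((h1 a).1 h)
        rw [Finset.mem_coe, Finset.mem_filter, mem_multFunctions]
        refine ⟨⟨?_, ?_⟩, by simp⟩
        · intro o
          beta_reduce
          by_cases ho : o = a
          · subst ho; simp
          · rw [Function.update_of_ne ho, h1, Finset.mem_insert, or_iff_right ho]
        · rw [Finset.sum_update_of_mem (Finset.mem_univ _)]
          rw [Finset.sum_eq_add_sum_sdiff_singleton_of_mem (Finset.mem_univ a)] at h2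
          omega
      · intro μ hμ
        rw [Finset.mem_coe, Finset.mem_filter, mem_multFunctions] at hμ
        obtain ⟨⟨h1, h2⟩, h3⟩ := hμ
        have h4 := (h1 a).2 (Finset.mem_insert_self _ _)
        simp only [Function.update_idem]
        rw [show v + 1 = μ a by omega, Function.update_eq_self]
      · intro μ hμ
        rw [Finset.mem_coe, mem_multFunctions] at hμ
        have h4 : μ a = 0 := by
          by_contra h
          exact ha ((hμ.1 a).1 h)
        simp only [Function.update_idem]
        rw [← h4, Function.update_eq_self]
    · intro μ hμ
      rw [Finset.mem_coe, mem_multFunctions] at hμ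
      have h4 := (hμ.1 a).2 (Finset.mem_insert_self _ _)
      have := (Finset.single_le_sum (f := μ) (fun _ _ => Nat.zero_le _)
        (Finset.mem_univ a)).trans hμ.2
      beta_reduce at this ⊢
      rw [Finset.mem_coe, Finset.mem_range]
      omega

/-- Functions of sum at most `m` correspond to pairs of a set `U` (the support) and a set of tokens of
the same size; moreover the tokens are assigned to the elements of the support. -/
theorem exists_token_assignment (m : ℕ) : ∃ δ : (O → ℕ) → O → Option (Fin m),
    (∀ μ, ∑ o, μ o ≤ m → ∀ o, δ μ o = none ↔ μ o = 0) ∧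
    (∀ μ o o' x, δ μ o = some x → δ μ o' = some x → o = o') ∧
    (∀ μ μ', ∑ o, μ o ≤ m → ∑ o, μ' o ≤ m → (∀ o, μ o = 0 ↔ μ' o = 0) →
      (∀ x, (∃ o, δ μ o = some x) ↔ ∃ o, δ μ' o = some x) → μ = μ') ∧
    ∀ (U : Finset O) (S : Finset (Fin m)), U.card = S.card →
      ∃ μ, ∑ o, μ o ≤ m ∧ (∀ o, μ o ≠ 0 ↔ o ∈ U) ∧ ∀ x, x ∈ S ↔ ∃ o, δ μ o = some x := by
  classical
  -- Multiplicity functions with support `U` and subsets of `Fin m` of the size of `U` are equally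
  -- numerous. An arbitrary bijection `e U` gives each function its set of tokens, which `β` below
  -- deals out to the support.
  have hcard : ∀ U : Finset O, (multFunctions U m).card =
      ((Finset.univ : Finset (Fin m)).powersetCard U.card).card := fun U => by
    rw [card_multFunctions, Finset.card_powersetCard, Finset.card_univ, Fintype.card_fin]
  let e := fun U => Finset.equivOfCardEq (hcard U)
  let supp : (O → ℕ) → Finset O := fun μ => Finset.univ.filter fun o => μ o ≠ 0
  have hsupp : ∀ μ o, o ∈ supp μ ↔ μ o ≠ 0 := fun μ o => by simp [supp]
  have hmem : ∀ μ, ∑ o, μ o ≤ m → μ ∈ multFunctions (supp μ) m := fun μ h =>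
    mem_multFunctions.2 ⟨fun o => (hsupp μ o).symm, h⟩
  let β : ∀ μ (h : ∑ o, μ o ≤ m), supp μ ≃ (e (supp μ) ⟨μ, hmem μ h⟩).1 := fun μ h =>
    Finset.equivOfCardEq (Finset.mem_powersetCard.1 (e (supp μ) ⟨μ, hmem μ h⟩).2).2.symm
  let δ : (O → ℕ) → O → Option (Fin m) := fun μ o =>
    if h : ∑ o, μ o ≤ m ∧ o ∈ supp μ then some (β μ h.1 ⟨o, h.2⟩).1 else none
  have hδ : ∀ μ (h : ∑ o, μ o ≤ m) o x, δ μ o = some x ↔ ∃ ho : o ∈ supp μ, (β μ h ⟨o, ho⟩).1 = x := by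
    intro μ h o x
    by_cases ho : o ∈ supp μ
    · simp [δ, h, ho]
    · simp [δ, ho]
  have hrange : ∀ μ (h : ∑ o, μ o ≤ m) x,
      (∃ o, δ μ o = some x) ↔ x ∈ (e (supp μ) ⟨μ, hmem μ h⟩).1 := by
    intro μ h x
    simp only [hδ μ h]
    constructor
    · rintro ⟨o, ho, rfl⟩
      exact (β μ h ⟨o, ho⟩).2
    · intro hx
      refine ⟨((β μ h).symm ⟨x, hx⟩).1, ((β μ h).symm ⟨x, hx⟩).2, ?_⟩
      rw [Subtype.coe_eta, Equiv.apply_symm_apply]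
  refine ⟨δ, ?_, ?_, ?_, ?_⟩
  · intro μ h o
    simp [δ, h, hsupp]
  · intro μ o o' x h1 h2
    by_cases h : ∑ o, μ o ≤ m
    · obtain ⟨ho, rfl⟩ := (hδ μ h _ _).1 h1
      obtain ⟨ho', h'⟩ := (hδ μ h _ _).1 h2
      have := (β μ h).injective (Subtype.ext h')
      exact (congrArg Subtype.val this).symm
    · simp [δ, h] at h1
  · intro μ μ' h h' hs hx
    have hss : supp μ = supp μ' := by
      ext o
      rw [hsupp, hsupp, Ne, Ne, hs]
    have key : ∀ (U U' : Finset O) (hU : μ ∈ multFunctions U m) (hU' : μ' ∈ multFunctions U' m),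
        U = U' → (e U ⟨μ, hU⟩).1 = (e U' ⟨μ', hU'⟩).1 → μ = μ' := by
      rintro U _ hU hU' rfl heq
      exact congrArg Subtype.val ((e U).injective (Subtype.ext heq))
    refine key _ _ (hmem μ h) (hmem μ' h') hss ?_
    ext x
    rw [← hrange μ h, ← hrange μ' h', hx]
  · intro U S hUS
    obtain ⟨⟨μ, hμ⟩, heq⟩ := (e U).surjective ⟨S, Finset.mem_powersetCard.2
      ⟨Finset.subset_univ _, hUS.symm⟩⟩
    obtain ⟨h1, h2⟩ := mem_multFunctions.1 hμ
    refine ⟨μ, h2, h1, fun x => ?_⟩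
    rw [hrange μ h2]
    have hsU : supp μ = U := by
      ext o
      rw [hsupp, h1]
    have key : ∀ (U' : Finset O) (hU' : μ ∈ multFunctions U' m), U' = U →
        (e U' ⟨μ, hU'⟩).1 = S := by
      rintro _ hU' rfl
      rw [heq]
    rw [key _ _ hsU]

end Multiplicities

section Tokens

variable {C O : Type} [Fintype C] [Fintype O]

/-- Counting the matchings with multiplicities as the injective assignments of tokens. -/
theorem card_matching_eq (hCO : Fintype.card C = Fintype.card O) (m : ℕ) (before : O → C → Prop) :
    Nat.card {p : (C ≃ O) × (O → ℕ) // (∀ c, p.2 (p.1 c) = 0 → before (p.1 c) c) ∧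
      ∑ o, p.2 o ≤ m} =
    Nat.card {τ : C → O ⊕ Fin m // Function.Injective τ ∧ ∀ c o, τ c = .inl o → before o c} := by
  classical
  obtain ⟨δ, h0, hinj, huniq, hex⟩ := exists_token_assignment (O := O) m
  -- A closing leaf on a marked edge receives the token of its opening leaf in place of the leaf.
  let F : (C ≃ O) × (O → ℕ) → C → O ⊕ Fin m := fun p c =>
    (δ p.2 (p.1 c)).elim (.inl (p.1 c)) .inr
  have Finr : ∀ p c x, F p c = .inr x ↔ δ p.2 (p.1 c) = some x := by
    intro p c x
    cases h : δ p.2 (p.1 c) <;> simp [F, h]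
  have Finl : ∀ p c o, F p c = .inl o ↔ δ p.2 (p.1 c) = none ∧ p.1 c = o := by
    intro p c o
    cases h : δ p.2 (p.1 c) <;> simp [F, h]
  refine Nat.card_congr (Equiv.ofBijective (fun p => ⟨F p.1, ?_, ?_⟩) ⟨?_, ?_⟩)
  · intro c c' hcc
    cases h : F p.1 c' with
    | inl o =>
      rw [h, Finl] at hcc
      rw [Finl] at h
      exact p.1.1.injective (hcc.2.trans h.2.symm)
    | inr x =>
      rw [h, Finr] at hcc
      rw [Finr] at h
      exact p.1.1.injective (hinj _ _ _ x hcc h)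
  · intro c o h
    rw [Finl, h0 _ p.2.2] at h
    rw [← h.2]
    exact p.2.1 c h.1
  · rintro ⟨⟨σ, μ⟩, hb, hm⟩ ⟨⟨σ', μ'⟩, hb', hm'⟩ h
    have hF : ∀ c, F (σ, μ) c = F (σ', μ') c := fun c => congrFun (congrArg Subtype.val h) c
    have hr : ∀ (σ : C ≃ O) μ x, (∃ o, δ μ o = some x) ↔ ∃ c, F (σ, μ) c = .inr x := by
      intro σ μ x
      simp only [Finr]
      exact ⟨fun ⟨o, ho⟩ => ⟨σ.symm o, by simpa using ho⟩, fun ⟨c, hc⟩ => ⟨_, hc⟩⟩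
    have hz : ∀ (σ : C ≃ O) μ, ∑ o, μ o ≤ m → ∀ o, μ o = 0 ↔ ∃ c, F (σ, μ) c = .inl o := by
      intro σ μ h o
      simp only [Finl]
      rw [← h0 μ h]
      constructor
      · intro ho
        exact ⟨σ.symm o, by simpa using ho⟩
      · rintro ⟨c, hc, rfl⟩
        exact hc
    -- The values of `F` reveal the support and the set of tokens, hence the multiplicities. The
    -- matching is then recovered since distinct opening leaves hold distinct tokens.
    obtain rfl : μ = μ' := by
      refine huniq μ μ' hm hm' (fun o => ?_) fun x => ?_
      · rw [hz σ μ hm, hz σ' μ' hm']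
        simp only [hF]
      · rw [hr σ, hr σ']
        simp only [hF]
    obtain rfl : σ = σ' := by
      ext c
      have := hF c
      cases h : F (σ', μ) c with
      | inl o =>
        rw [h, Finl] at this
        rw [Finl] at h
        exact this.2.trans h.2.symm
      | inr x =>
        rw [h, Finr] at this
        rw [Finr] at h
        exact hinj _ _ _ x this h
    rfl
  · rintro ⟨τ, hτ, hb⟩
    -- The elements of `O` that are not values of `τ` have to be the marked ones. As `τ` is
    -- injective and `C` and `O` have equal size, they are as many as the tokens used.
    set U : Finset O := Finset.univ.filter fun o => ∀ c, τ c ≠ .inl o with hU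
    set S : Finset (Fin m) := Finset.univ.filter fun x => ∃ c, τ c = .inr x with hS
    have hUS : U.card = S.card := by
      have e1 : (Finset.univ.image τ).card = Fintype.card O := by
        rw [Finset.card_image_of_injective _ hτ, Finset.card_univ, hCO]
      have e2 : Finset.univ.image τ = Uᶜ.disjSum S := by
        ext t
        rcases t with o | x
        · simp [hU]
        · simp [hS]
      rw [e2, Finset.card_disjSum, Finset.card_compl] at e1
      have := Finset.card_le_univ U
      omega
    obtain ⟨μ, hm, hμU, hμS⟩ := hex U S hUS
    have hex' : ∀ c, ∃ o, τ c = .inl o ∨ ∃ x, τ c = .inr x ∧ δ μ o = some x := by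
      intro c
      cases h : τ c with
      | inl o => exact ⟨o, Or.inl rfl⟩
      | inr x =>
        obtain ⟨o, ho⟩ := (hμS x).1 (by simp only [hS, Finset.mem_filter, Finset.mem_univ, true_and]; exact ⟨c, h⟩)
        exact ⟨o, Or.inr ⟨x, rfl, ho⟩⟩
    choose s hs using hex'
    have hleft : ∀ c o, τ c = .inl o → δ μ o = none := by
      intro c o h
      rw [h0 μ hm]
      by_contra hne
      have := (hμU o).1 hne
      simp only [hU, Finset.mem_filter, Finset.mem_univ, true_and] at this
      exact this c h
    have hsinj : Function.Injective s := by
      intro c c' h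
      apply hτ
      rcases hs c with h1 | ⟨x, h1, h2⟩ <;> rcases hs c' with h1' | ⟨x', h1', h2'⟩
      · rw [h1, h1', h]
      · have := hleft _ _ h1
        rw [h, h2'] at this
        cases this
      · have := hleft _ _ h1'
        rw [← h, h2] at this
        cases this
      · rw [h, h2', Option.some_inj] at h2
        rw [h1, h1', h2]
    have hsbij : Function.Bijective s := (Fintype.bijective_iff_injective_and_card s).2 ⟨hsinj, hCO⟩
    refine ⟨⟨(Equiv.ofBijective s hsbij, μ), ?_, hm⟩, Subtype.ext (funext fun c => ?_)⟩
    · intro c hc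
      simp only [Equiv.ofBijective_apply] at hc ⊢
      rcases hs c with h1 | ⟨x, h1, h2⟩
      · exact hb c _ h1
      · rw [(h0 μ hm _).2 hc] at h2
        cases h2
    · rcases hs c with h1 | ⟨x, h1, h2⟩
      · exact ((Finl _ _ _).2 ⟨hleft _ _ h1, rfl⟩).trans h1.symm
      · exact ((Finr _ _ _).2 h2).trans h1.symm

end Tokens

/-! ### Injections into increasing sets. -/

section Injections

variable {α : Type*} [DecidableEq α]

/-- Choose the values in order. As the sets increase, the `j` values chosen before all lie in `A j`,
so exactly `j` elements of it are lost. -/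
theorem card_injective_fin (n : ℕ) (A : Fin n → Finset α) (hA : Monotone A) :
    Nat.card {τ : Fin n → α // Function.Injective τ ∧ ∀ j, τ j ∈ A j} =
      ∏ j, ((A j).card - j) := by
  induction n with
  | zero =>
    have : Unique {τ : Fin 0 → α // Function.Injective τ ∧ ∀ j, τ j ∈ A j} :=
      { default := ⟨Fin.elim0, fun a => a.elim0, fun a => a.elim0⟩
        uniq := fun _ => Subtype.ext (funext fun a => a.elim0) }
    rw [Nat.card_unique, Fin.prod_univ_zero]
  | succ n ih =>
    have hext : ∀ p q : Σ τ : {τ : Fin n → α // Function.Injective τ ∧ ∀ j, τ j ∈ A j.castSucc},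
        {a // a ∈ A (Fin.last n) \ Finset.univ.image τ.1},
        p.1.1 = q.1.1 → p.2.1 = q.2.1 → p = q := by
      rintro ⟨⟨τ, h⟩, a, ha⟩ ⟨⟨τ', h'⟩, a', ha'⟩ (rfl : τ = τ') (rfl : a = a')
      rfl
    let e : {τ : Fin (n + 1) → α // Function.Injective τ ∧ ∀ j, τ j ∈ A j} ≃
        Σ τ : {τ : Fin n → α // Function.Injective τ ∧ ∀ j, τ j ∈ A j.castSucc},
          {a // a ∈ A (Fin.last n) \ Finset.univ.image τ.1} :=
      { toFun := fun τ => ⟨⟨Fin.init τ.1, τ.2.1.comp (Fin.castSucc_injective n),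
            fun j => τ.2.2 _⟩, τ.1 (Fin.last n), by
          rw [Finset.mem_sdiff, Finset.mem_image]
          refine ⟨τ.2.2 _, ?_⟩
          rintro ⟨j, -, h⟩
          exact (Fin.castSucc_lt_last j).ne (τ.2.1 h)⟩
        invFun := fun p => ⟨Fin.snoc p.1.1 p.2.1, by
          have h := p.2.2
          rw [Finset.mem_sdiff, Finset.mem_image] at h
          rw [Fin.snoc_injective_iff]
          refine ⟨p.1.2.1, ?_⟩
          rintro ⟨j, hj⟩
          exact h.2 ⟨j, Finset.mem_univ _, hj⟩, by
          intro j
          refine Fin.lastCases ?_ (fun j => ?_) j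
          · rw [Fin.snoc_last]
            exact (Finset.mem_sdiff.1 p.2.2).1
          · rw [Fin.snoc_castSucc]
            exact p.1.2.2 j⟩
        left_inv := fun τ => Subtype.ext (Fin.snoc_init_self _)
        right_inv := fun p => hext _ _ (Fin.init_snoc (α := fun _ => α) _ _)
          (Fin.snoc_last (α := fun _ => α) _ _) }
    have hfin : Finite {τ : Fin n → α // Function.Injective τ ∧ ∀ j, τ j ∈ A j.castSucc} := by
      refine Finite.of_injective
        (fun τ => fun j => (⟨τ.1 j, τ.2.2 j⟩ : {a // a ∈ A j.castSucc})) fun τ τ' h => ?_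
      refine Subtype.ext (funext fun j => ?_)
      exact congrArg Subtype.val (congrFun h j)
    rw [Nat.card_congr e]
    have := Fintype.ofFinite {τ : Fin n → α // Function.Injective τ ∧ ∀ j, τ j ∈ A j.castSucc}
    rw [Nat.card_sigma, Finset.sum_congr (g := fun _ => (A (Fin.last n)).card - n) rfl,
      Finset.sum_const, Finset.card_univ, ← Nat.card_eq_fintype_card,
      ih _ fun _ _ h => hA (Fin.castSucc_le_castSucc_iff.2 h), Fin.prod_univ_castSucc, smul_eq_mul]
    · rfl
    · rintro τ -
      rw [Nat.card_eq_fintype_card, Fintype.card_coe, Finset.card_sdiff_of_subset,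
        Finset.card_image_of_injective _ τ.2.1, Finset.card_univ, Fintype.card_fin]
      intro a ha
      obtain ⟨j, -, rfl⟩ := Finset.mem_image.1 ha
      exact hA (Fin.le_last _) (τ.2.2 j)

theorem card_injective {C : Type} [Fintype C] (r : C → ℕ) (hr : Function.Injective r)
    (A : C → Finset α) (hA : ∀ c c', r c ≤ r c' → A c ⊆ A c') :
    Nat.card {τ : C → α // Function.Injective τ ∧ ∀ c, τ c ∈ A c} =
      ∏ c, ((A c).card - (Finset.univ.filter fun c' => r c' < r c).card) := by
  let _ : LinearOrder C := LinearOrder.lift' r hr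
  have e := Fintype.orderIsoFinOfCardEq C rfl
  have h1 : Nat.card {τ : C → α // Function.Injective τ ∧ ∀ c, τ c ∈ A c} =
      Nat.card {τ : Fin (Fintype.card C) → α // Function.Injective τ ∧ ∀ j, τ j ∈ A (e j)} := by
    refine Nat.card_congr ((Equiv.arrowCongr e.toEquiv.symm (Equiv.refl α)).subtypeEquiv ?_)
    intro τ
    refine and_congr ?_ ?_
    · exact ⟨fun h => h.comp e.injective, fun h => by
        have := h.comp e.symm.injective
        simpa [Function.comp_def] using this⟩
    · exact ⟨fun h j => h (e j), fun h c => by simpa using h (e.symm c)⟩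
  rw [h1, card_injective_fin _ _ fun j j' h => hA _ _ (e.monotone h)]
  refine Fintype.prod_equiv e.toEquiv _ _ fun j => ?_
  congr 1
  have h2 : (Finset.univ.filter fun c' => r c' < r (e j)) = (Finset.univ.filter fun j' => j' < j).map
      e.toEquiv.toEmbedding := by
    ext c
    simp only [Finset.mem_filter, Finset.mem_univ, true_and, Finset.mem_map,
      Equiv.coe_toEmbedding]
    constructor
    · intro h
      refine ⟨e.symm c, ?_, e.apply_symm_apply c⟩
      rw [← e.lt_iff_lt, e.apply_symm_apply]
      exact h
    · rintro ⟨j', hj, rfl⟩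
      exact e.lt_iff_lt.2 hj
  change _ = (Finset.univ.filter fun c' => r c' < r (e j)).card
  rw [h2, Finset.card_map, Finset.filter_gt_eq_Iio, Fin.card_Iio]

end Injections


/-! ### Weights of paths. -/

/-- The product of the heights from which the down-steps of a path descend, for a path starting at
height `h`; a height below `0` counts as `0`. -/
def pathWeight : ℤ → List ℤ → ℕ
  | _, [] => 1
  | h, s :: L => (if s = -1 then h.toNat else 1) * pathWeight (h + s) L

/-- Half-edges not leading to a recorded leaf have step `0`; the contour and the leaf-path thus have
the same weight. -/
theorem pathWeight_filter (h : ℤ) (L : List ℤ) :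
    pathWeight h (L.filter fun s => s ≠ 0) = pathWeight h L := by
  induction L generalizing h with
  | nil => rfl
  | cons s L ih =>
    by_cases hs : s = 0
    · subst hs
      rw [List.filter_cons_of_neg (by simp), ih]
      simp [pathWeight]
    · rw [List.filter_cons_of_pos (by simpa using hs), pathWeight, pathWeight, ih]

theorem pathWeight_eq_prod (h : ℤ) (L : List ℤ) :
    pathWeight h L = ∏ j : Fin L.length, if L.get j = -1 then (h + (L.take j).sum).toNat else 1 := by
  induction L generalizing h with
  | nil => rfl
  | cons s L ih =>
    rw [pathWeight, ih]
    refine Eq.trans ?_ (Fin.prod_univ_succ (n := L.length) _).symm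
    congr 1
    · simp
    · simp [add_assoc]

/-- A path can become negative only by a down-step from height `0`, which contributes the factor
`0`. -/
theorem nonneg_of_pathWeight_ne_zero {h : ℤ} {L : List ℤ} (hh : 0 ≤ h) (hL : ∀ s ∈ L, -1 ≤ s)
    (hw : pathWeight h L ≠ 0) (j : ℕ) : 0 ≤ h + (L.take j).sum := by
  induction L generalizing h j with
  | nil => simpa using hh
  | cons s L ih =>
    cases j with
    | zero => simpa using hh
    | succ j =>
      rw [pathWeight, mul_ne_zero_iff] at hw
      rw [List.take_succ_cons, List.sum_cons, ← add_assoc]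
      refine ih ?_ (fun x hx => hL x (List.mem_cons_of_mem _ hx)) hw.2 j
      have h1 := hL s List.mem_cons_self
      by_cases hs : s = -1
      · rw [if_pos hs] at hw
        have := hw.1
        omega
      · omega

/-- The weight of a path whose steps are indexed by the elements of a list. -/
theorem pathWeight_map {α : Type*} [Fintype α] [DecidableEq α] {l : List α} (hl : l.Nodup)
    (hmem : ∀ x, x ∈ l) (f : α → ℤ) (h : ℤ) :
    pathWeight h (l.map f) = ∏ x, if f x = -1 then
      (h + ∑ y with l.idxOf y < l.idxOf x, f y).toNat else 1 := by
  rw [pathWeight_eq_prod]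
  refine Fintype.prod_equiv ((finCongr (List.length_map f)).trans
    (List.Nodup.getEquivOfForallMemList l hl hmem)) _ _ fun j => ?_
  have h1 : ∑ y with l.idxOf y < (j : ℕ), f y = ((l.map f).take j).sum := by
    rw [← List.map_take, ← List.sum_toFinset _ ((List.take_sublist _ _).nodup hl)]
    refine Finset.sum_congr ?_ fun _ _ => rfl
    ext y
    rw [Finset.mem_filter, List.mem_toFinset, List.mem_take_iff_idxOf_lt (hmem y)]
    simp
  rw [← h1]
  simp [hl.idxOf_getElem]

/-! ### Index assignments and closings of a fixed tree. -/

namespace PlantedTree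

theorem leafSteps_eq_filter (T : PlantedTree) :
    T.leafSteps = (T.step :: T.contour.map T.sgn).filter fun s => s ≠ 0 := by
  induction T with
  | opening => rfl
  | closing => rfl
  | node n child ih =>
    have e : (node n child).contour.map (node n child).sgn =
        0 :: (List.ofFn fun j => (child j).step :: (child j).contour.map (child j).sgn).flatten := by
      simp [contour, List.map_flatten, List.map_ofFn, Function.comp_def]
    rw [e, leafSteps, step, List.filter_cons_of_neg (by simp), List.filter_cons_of_neg (by simp),
      List.filter_flatten, List.map_ofFn]
    congr 2
    funext j
    exact ih j

theorem leafSteps_eq {T : PlantedTree} {b : T.Below} (hb : T.base = some b) :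
    T.leafSteps = (T.contour.map T.sgn).filter fun s => s ≠ 0 := by
  have : T.step = 0 := by
    by_contra h
    rw [(base_eq_none_iff T).2 h] at hb
    cases hb
  rw [leafSteps_eq_filter, this, List.filter_cons_of_neg (by simp)]

theorem mem_leafSteps {T : PlantedTree} {s : ℤ} (hs : s ∈ T.leafSteps) : s = 1 ∨ s = -1 := by
  rw [leafSteps_eq_filter, List.mem_filter, List.mem_cons, List.mem_map] at hs
  obtain ⟨rfl | ⟨x, -, rfl⟩, h⟩ := hs
  · have := step_cases T
    simp at h
    tauto
  · have := sgn_cases x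
    simp at h
    tauto

/-- A node has `2 k - 1` children: `k - 1` opening ones, each contributing `+1`, and `k` others,
each contributing `-1` by induction. A subtree other than an opening leaf thus acts on the height as
one down-step. -/
theorem sum_leafSteps {T : PlantedTree} (hT : T.IsEulerian) :
    T.leafSteps.sum = if T.isOpening = true then 1 else -1 := by
  induction T with
  | opening => rfl
  | closing => rfl
  | node n child ih =>
    obtain ⟨⟨k, hk, hc⟩, hT⟩ := hT
    rw [leafSteps, List.sum_flatten, List.map_ofFn, List.sum_ofFn]
    have h1 : ∀ j, (List.sum ∘ fun j => (child j).leafSteps) j =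
        2 * (if (child j).isOpening = true then 1 else 0) - 1 := by
      intro j
      rw [Function.comp_apply, ih j (hT j)]
      split_ifs <;> rfl
    simp only [h1]
    rw [Finset.sum_sub_distrib, ← Finset.mul_sum, Finset.sum_boole, if_neg (by simp [isOpening]),
      Finset.sum_const, Finset.card_univ, Fintype.card_fin, nsmul_one]
    omega

theorem isBlossoming_iff (T : PlantedTree) : T.IsBlossoming ↔ T.leafSteps.sum = -1 := by
  have key : ∀ L : List ℤ, (∀ s ∈ L, s = 1 ∨ s = -1) → L.sum = L.count 1 - L.count (-1) := by
    intro L hL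
    induction L with
    | nil => rfl
    | cons s L ih =>
      rw [List.sum_cons, ih fun x hx => hL x (List.mem_cons_of_mem _ hx)]
      rcases hL s List.mem_cons_self with rfl | rfl
      · simp
        ring
      · simp
        ring
  rw [IsBlossoming, key _ fun s hs => mem_leafSteps hs]
  omega

theorem sum_leafSteps_of_ne {T : PlantedTree} (hT : T.IsEulerian) (h : T ≠ opening) :
    T.leafSteps.sum = -1 := by
  rw [sum_leafSteps hT, if_neg]
  cases T <;> simp_all [isOpening]

noncomputable instance fintypeClosingLeaf (T : PlantedTree) : Fintype T.ClosingLeaf :=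
  inferInstanceAs (Fintype {j : Fin T.leafSteps.length // T.leafSteps.get j = -1})

theorem card_index (i : ℕ) (T : PlantedTree) :
    Nat.card (∀ c : T.ClosingLeaf, Fin (T.iHeight i c).toNat) = pathWeight i T.leafSteps := by
  rw [Nat.card_pi, pathWeight_eq_prod, ← Finset.prod_filter]
  simp only [Nat.card_eq_fintype_card, Fintype.card_fin]
  exact (Finset.prod_subtype (p := fun j : Fin T.leafSteps.length => T.leafSteps.get j = -1)
    (F := fintypeClosingLeaf T) _ (by simp) (fun j : Fin T.leafSteps.length => (i + (T.leafSteps.take j).sum).toNat)).symm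

/-- Balance is automatic: an index requires a positive height, so no down-step starts at `0`. -/
theorem isBalanced_of_index {i : ℕ} {T : PlantedTree} (hT : T.leafSteps.sum = -1)
    (f : ∀ c : T.ClosingLeaf, Fin (T.iHeight i c).toNat) : T.IsBalanced i := by
  have hw : pathWeight i T.leafSteps ≠ 0 := by
    rw [← card_index]
    exact (Nat.card_pos_iff.2 ⟨⟨f⟩, inferInstance⟩).ne'
  refine ⟨fun j _ => nonneg_of_pathWeight_ne_zero (Int.natCast_nonneg i) ?_ hw j, ?_⟩
  · intro s hs
    rcases mem_leafSteps hs with rfl | rfl <;> simp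
  · rw [pathHeight, List.take_length, hT]
    rfl

theorem card_enrichedTree (i : ℕ) {T : PlantedTree} (hT : T.IsEulerian) (hne : T ≠ opening) :
    Nat.card {x : EnrichedTree i // x.tree = T} = pathWeight i T.leafSteps := by
  rw [← card_index]
  have hs := sum_leafSteps_of_ne hT hne
  refine (Nat.card_congr (Equiv.ofBijective (fun f =>
    ⟨⟨T, (isBlossoming_iff T).2 hs, hT, isBalanced_of_index hs f, f⟩, rfl⟩) ⟨?_, ?_⟩)).symm
  · intro f f' h
    have := congrArg Subtype.val h
    simpa using this
  · rintro ⟨⟨T', h1, h2, h3, f⟩, rfl⟩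
    exact ⟨f, rfl⟩

section Matchings

variable {T : PlantedTree}

/-- The additional `1` is the root leaf, which sits at `b` and has step `0`. -/
theorem card_op_filter {b : T.Below} (hb : T.base = some b) (P : T.Below → Prop) [DecidablePred P]
    (hP : P b) :
    (Finset.univ.filter fun o : T.Op => P o.1).card =
      (Finset.univ.filter fun x => T.sgn x = 1 ∧ P x).card + 1 := by
  classical
  rw [← Finset.card_map ⟨Subtype.val, Subtype.val_injective⟩,
    ← Finset.card_insert_of_notMem (a := b) (by simp [sgn_base hb])]
  congr 1
  ext x
  simp only [Finset.mem_map, Finset.mem_filter, Finset.mem_univ, true_and, Finset.mem_insert,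
    Function.Embedding.coeFn_mk]
  constructor
  · rintro ⟨o, ho, rfl⟩
    have h1 := not_sgn_op o
    have h2 := sgn_cases o.1
    rcases (treeOpp_eq_self_iff _).1 o.2.1 with h | h
    · rw [hb, Option.some_inj] at h
      exact Or.inl h.symm
    · tauto
  · rintro (rfl | ⟨h1, h2⟩)
    · exact ⟨⟨x, treeOpp_base hb, out_base hb⟩, hP, rfl⟩
    · exact ⟨⟨x, (treeOpp_eq_self_iff x).2 (Or.inr (by rw [h1]; decide)), out_of_sgn_eq_one h1⟩,
        h2, rfl⟩

theorem sum_sgn (P : T.Below → Prop) [DecidablePred P] :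
    ∑ x with P x, T.sgn x = (Finset.univ.filter fun x => T.sgn x = 1 ∧ P x).card -
      (Finset.univ.filter fun c : T.Cl => P c.1).card := by
  have h1 : (Finset.univ.filter fun c : T.Cl => P c.1).card =
      (Finset.univ.filter fun x => T.sgn x = -1 ∧ P x).card := by
    rw [← Finset.card_map ⟨Subtype.val, Subtype.val_injective⟩]
    congr 1
    ext x
    simp
    tauto
  rw [h1, Finset.sum_filter, Finset.card_filter, Finset.card_filter]
  push_cast
  rw [← Finset.sum_sub_distrib]
  refine Finset.sum_congr rfl fun x _ => ?_
  rcases sgn_cases x with h | h | h <;> by_cases hx : P x <;> simp [h, hx]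

/-- The leaf-path sums to `-1`, and the root leaf, which it omits, makes up the difference. -/
theorem card_cl_eq_card_op (hT : T.IsEulerian) {b : T.Below} (hb : T.base = some b) :
    Fintype.card T.Cl = Fintype.card T.Op := by
  have hne : T ≠ opening := by
    rintro rfl
    exact b.elim
  have h1 := sum_leafSteps_of_ne hT hne
  have h2 : ∀ L : List ℤ, (L.filter fun s => s ≠ 0).sum = L.sum := by
    intro L
    induction L with
    | nil => rfl
    | cons s L ih =>
      by_cases hs : s = 0
      · rw [List.filter_cons_of_neg (by simpa using hs), ih, List.sum_cons, hs, zero_add]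
      · rw [List.filter_cons_of_pos (by simpa using hs), List.sum_cons, List.sum_cons, ih]
  rw [leafSteps_eq hb, h2, ← List.sum_toFinset _ T.nodup_contour] at h1
  have h3 : T.contour.toFinset = Finset.univ.filter fun _ => True := by
    ext x
    simp [mem_contour]
  rw [h3, sum_sgn] at h1
  have h4 := card_op_filter hb (fun _ => True) trivial
  simp only [Finset.filter_true, Finset.card_univ] at h1 h4
  omega

theorem idxOf_base {b : T.Below} (hb : T.base = some b) : T.contour.idxOf b = 0 := by
  cases T with
  | opening => exact b.elim
  | closing => exact b.elim
  | node n child =>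
    obtain rfl : half 0 = b := Option.some_injective _ hb
    rw [contour, List.idxOf_cons_self]

/-- The number of ways to close a tree, with total multiplicity at most `m`. -/
theorem card_matching (hT : T.IsEulerian) {b : T.Below} (hb : T.base = some b) (m : ℕ) :
    Nat.card {p : (T.Cl ≃ T.Op) × (T.Op → ℕ) // T.IsMatching p ∧ ∑ o, p.2 o ≤ m} =
      pathWeight (m + 1) T.leafSteps := by
  classical
  refine (card_matching_eq (card_cl_eq_card_op hT hb) m
    fun o c => T.contour.idxOf o.1 < T.contour.idxOf c.1).trans ?_
  -- What a closing leaf may receive: an earlier opening leaf, or any token.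
  let A : T.Cl → Finset (T.Op ⊕ Fin m) := fun c =>
    (Finset.univ.filter fun o : T.Op => T.contour.idxOf o.1 < T.contour.idxOf c.1).disjSum
      Finset.univ
  have e1 : ∀ τ : T.Cl → T.Op ⊕ Fin m,
      (∀ c o, τ c = .inl o → T.contour.idxOf o.1 < T.contour.idxOf c.1) ↔ ∀ c, τ c ∈ A c := by
    intro τ
    refine forall_congr' fun c => ?_
    cases h : τ c with
    | inl o => simp [A]
    | inr x => simp [A]
  simp only [e1]
  have hidx : Function.Injective fun x : T.Below => T.contour.idxOf x := fun x y h =>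
    (List.idxOf_inj (mem_contour x)).1 h
  rw [card_injective (fun c : T.Cl => T.contour.idxOf c.1)
    (fun c c' h => Subtype.ext (hidx h)) A, leafSteps_eq hb, pathWeight_filter,
    pathWeight_map T.nodup_contour mem_contour, ← Finset.prod_filter]
  · rw [Finset.prod_subtype (p := fun x => T.sgn x = -1) _ (by simp)]
    refine Finset.prod_congr rfl fun c _ => ?_
    -- The root leaf precedes every closing leaf, so it always counts as available.
    have hb0 : T.contour.idxOf b < T.contour.idxOf c.1 := by
      rw [idxOf_base hb, Nat.pos_iff_ne_zero, ← idxOf_base hb]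
      intro h
      have := hidx h
      have h2 := c.2
      rw [this, sgn_base hb] at h2
      exact absurd h2 (by decide)
    have h1 := card_op_filter hb (fun x => T.contour.idxOf x < T.contour.idxOf c.1) hb0
    have h2 := sum_sgn (T := T) (fun x => T.contour.idxOf x < T.contour.idxOf c.1)
    -- Opening leaves before `c`, root leaf included, plus `m` tokens, minus the closing leaves
    -- before `c`: this is the height at `c` of the path from `m + 1`.
    rw [h2, Finset.card_disjSum, h1, Finset.card_univ, Fintype.card_fin]
    omega
  · intro c c' hc
    refine Finset.disjSum_mono (fun o ho => ?_) le_rfl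
    rw [Finset.mem_filter] at ho ⊢
    exact ⟨ho.1, ho.2.trans_le hc⟩

/-- The number of maps of total multiplicity at most `m` obtained by closing a tree. -/
theorem card_treeStructure (hT : T.IsEulerian) {b : T.Below} (hb : T.base = some b) (m : ℕ) :
    Nat.card {M : {M : MarkedMap T.Below // M.TreeStructure T (Equiv.refl _)} //
      M.1.totalMult ≤ m} = pathWeight (m + 1) T.leafSteps := by
  obtain ⟨e, he⟩ := exists_matching_equiv hb
  rw [← card_matching hT hb]
  exact Nat.card_congr ((Equiv.subtypeSubtypeEquivSubtypeInter _ _).symm.trans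
    (e.subtypeEquiv fun p => by rw [he])).symm

end Matchings

end PlantedTree


/-! ### Degrees of nodes and finiteness of the fibres. -/

theorem minimalPeriod_eq_of_semiconj {α β : Type*} {f : α → α} {f' : β → β} {g : α → β}
    (hg : Function.Injective g) (h : Function.Semiconj g f f') (x : α) :
    Function.minimalPeriod f' (g x) = Function.minimalPeriod f x := by
  rw [Function.minimalPeriod_eq_minimalPeriod_iff]
  intro n
  rw [Function.IsPeriodicPt, Function.IsFixedPt, ← (h.iterate_right n).eq, hg.eq_iff]
  rfl

theorem minimalPeriod_finRotate {n : ℕ} (j : Fin (n + 1)) :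
    Function.minimalPeriod (finRotate (n + 1)) j = n + 1 := by
  have h : ∀ m : ℕ, ((finRotate (n + 1))^[m] j : ℕ) = (j + m) % (n + 1) := by
    intro m
    induction m with
    | zero => simp [Nat.mod_eq_of_lt j.2]
    | succ m ih =>
      rw [Function.iterate_succ_apply', finRotate_apply, Fin.val_add, ih, Fin.val_one',
        ← Nat.add_mod, add_assoc]
  have h' : ∀ m : ℕ, Function.IsPeriodicPt (finRotate (n + 1)) m j ↔ n + 1 ∣ m := by
    intro m
    rw [Function.IsPeriodicPt, Function.IsFixedPt, Fin.ext_iff, h, ← Nat.modEq_zero_iff_dvd]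
    constructor
    · intro h
      refine Nat.ModEq.add_left_cancel' (j : ℕ) ?_
      rw [Nat.ModEq, h, add_zero, Nat.mod_eq_of_lt j.2]
    · intro h
      have := h.add_left (j : ℕ)
      rwa [Nat.ModEq, add_zero, Nat.mod_eq_of_lt j.2] at this
  refine Nat.dvd_antisymm ?_ ?_
  · exact Function.isPeriodicPt_iff_minimalPeriod_dvd.1 ((h' _).2 dvd_rfl)
  · exact (h' _).1 (Function.isPeriodicPt_minimalPeriod _ _)

namespace PlantedTree

/-- Same form as `MarkedMap.two_mul_vertexCount`: counting half-edges by the period of the rotation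
avoids an explicit correspondence between nodes and vertices. -/
theorem two_mul_nodeCount (T : PlantedTree) (k : ℕ) : 2 * k * T.nodeCount k =
    ∑ x, if Function.minimalPeriod T.rot x = 2 * k then 1 else 0 := by
  induction T with
  | opening => exact (Finset.sum_eq_zero fun x _ => Empty.elim x).symm
  | closing => exact (Finset.sum_eq_zero fun x _ => Empty.elim x).symm
  | node n child ih =>
    have h1 : ∀ j, Function.minimalPeriod (node n child).rot (half j) = n + 1 := fun j =>
      (minimalPeriod_eq_of_semiconj half_injective (fun _ => rfl) j).trans
        (minimalPeriod_finRotate j)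
    have h2 : ∀ j x, Function.minimalPeriod (node n child).rot (sub j x) =
        Function.minimalPeriod (child j).rot x := fun j x =>
      minimalPeriod_eq_of_semiconj (sub_injective j) (fun _ => rfl) x
    rw [sum_below]
    simp only [h1, h2, ← ih]
    rw [nodeCount, mul_add, Finset.mul_sum, Finset.sum_const, Finset.card_univ, Fintype.card_fin]
    congr 1
    split_ifs with h
    · rw [h, smul_eq_mul]
    · simp

theorem nodeCount_zero (T : PlantedTree) : T.nodeCount 0 = 0 := by
  induction T with
  | opening => rfl
  | closing => rfl
  | node n child ih => simp [nodeCount, ih]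

theorem two_mul_halfDegree {T : PlantedTree} (hT : T.IsEulerian) :
    2 * T.halfDegree = Fintype.card T.Below := by
  rw [← Finset.card_univ, Finset.card_eq_sum_ones]
  induction T with
  | opening => exact (Finset.sum_eq_zero fun x _ => Empty.elim x).symm
  | closing => exact (Finset.sum_eq_zero fun x _ => Empty.elim x).symm
  | node n child ih =>
    obtain ⟨⟨k, hk, -⟩, hT⟩ := hT
    rw [sum_below, halfDegree, mul_add, Finset.mul_sum]
    congr 1
    · simp
      omega
    · exact Finset.sum_congr rfl fun j _ => ih j (hT j)

theorem exists_base {T : PlantedTree} (h : T.HasNode) : ∃ b, T.base = some b := by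
  cases T with
  | opening => exact h.elim
  | closing => exact h.elim
  | node n child => exact ⟨_, rfl⟩

theorem hasNode_of_base {T : PlantedTree} {b : T.Below} (h : T.base = some b) : T.HasNode := by
  cases T with
  | opening => exact b.elim
  | closing => exact b.elim
  | node n child => trivial

theorem finite_treeStructure {T : PlantedTree} (hT : T.HasNode) (m : ℕ) :
    Finite {M : {M : MarkedMap T.Below // M.TreeStructure T (Equiv.refl _)} //
      M.1.totalMult ≤ m} := by
  obtain ⟨b, hb⟩ := exists_base hT
  obtain ⟨e, he⟩ := exists_matching_equiv hb
  have hle : ∀ M : {M : {M : MarkedMap T.Below // M.TreeStructure T (Equiv.refl _)} //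
      M.1.totalMult ≤ m}, ∀ o, (e.symm M.1).1.2 o < m + 1 := by
    intro M o
    refine Nat.lt_succ_of_le (le_trans ?_ M.2)
    have := he (e.symm M.1)
    rw [e.apply_symm_apply] at this
    rw [this]
    exact Finset.single_le_sum (f := (e.symm M.1).1.2) (fun _ _ => Nat.zero_le _)
      (Finset.mem_univ o)
  refine Finite.of_injective (β := (T.Cl ≃ T.Op) × (T.Op → Fin (m + 1)))
    (fun M => ((e.symm M.1).1.1, fun o => ⟨_, hle M o⟩)) fun M M' h => ?_
  rw [Prod.mk.injEq] at h
  refine Subtype.ext (e.symm.injective (Subtype.ext (Prod.ext h.1 (funext fun o => ?_))))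
  exact congrArg Fin.val (congrFun h.2 o)

theorem finite_enrichedTree (i : ℕ) (T : PlantedTree) :
    Finite {x : EnrichedTree i // x.tree = T} := by
  have : Finite (∀ c : T.ClosingLeaf, Fin (T.iHeight i c).toNat) := inferInstance
  refine Finite.of_injective
    (fun x => (x.2 ▸ x.1.index : ∀ c : T.ClosingLeaf, Fin (T.iHeight i c).toNat)) ?_
  rintro ⟨⟨T₁, _, _, _, f⟩, h₁⟩ ⟨⟨T₂, _, _, _, f'⟩, h₂⟩ h
  obtain rfl : T₁ = T := h₁
  obtain rfl : T₂ = T₁ := h₂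
  obtain rfl : f = f' := h
  rfl

end PlantedTree

namespace MarkedMap

section

variable {T : PlantedTree} {M : MarkedMap T.Below} (hM : M.TreeStructure T (Equiv.refl _))
include hM

theorem TreeStructure.vertexCount (k : ℕ) : M.vertexCount k = T.nodeCount k := by
  rcases Nat.eq_zero_or_pos k with rfl | hk
  · rw [vertexCount_zero, T.nodeCount_zero]
  · refine Nat.eq_of_mul_eq_mul_left (Nat.mul_pos two_pos hk) ?_
    rw [two_mul_vertexCount, T.two_mul_nodeCount]
    have : M.next = T.rot := Equiv.ext fun x => (hM.embedding.next x).symm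
    rw [this]

theorem TreeStructure.halfDegree (hT : T.IsEulerian) : M.halfDegree = T.halfDegree := by
  have h1 := two_mul_halfDegree (hM.good hT).isEulerian
  have h2 := PlantedTree.two_mul_halfDegree hT
  omega

end

end MarkedMap

/-! ### Statistics of a map read on its tree. -/

namespace AdmissibleMap

theorem exists_ofTree_eq (A : AdmissibleMap) :
    ∃ M : {M : MarkedMap A.tree.Below // M.TreeStructure A.tree (Equiv.refl _)},
      ofTree A.tree_isEulerian M = ⟨A, rfl⟩ :=
  (bijective_ofTree A.tree_isEulerian).2 ⟨A, rfl⟩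

theorem tree_hasNode (A : AdmissibleMap) : A.tree.HasNode := by
  obtain ⟨M, -⟩ := A.exists_ofTree_eq
  exact PlantedTree.hasNode_of_base M.2.root

theorem vertexCount_eq (A : AdmissibleMap) (k : ℕ) : A.vertexCount k = A.tree.nodeCount k := by
  obtain ⟨M, hM⟩ := A.exists_ofTree_eq
  rw [← M.2.vertexCount, ← MarkedMap.vertexCount_toAdmissible ⟨_, M.2.good A.tree_isEulerian⟩]
  exact congrArg (fun B => B.1.vertexCount k) hM.symm

theorem halfDegree_eq (A : AdmissibleMap) : A.halfDegree = A.tree.halfDegree := by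
  obtain ⟨M, hM⟩ := A.exists_ofTree_eq
  rw [← M.2.halfDegree A.tree_isEulerian,
    ← MarkedMap.halfDegree_toAdmissible ⟨_, M.2.good A.tree_isEulerian⟩]
  exact congrArg (fun B => B.1.halfDegree) hM.symm

theorem edgeCount_eq (A : AdmissibleMap) : A.edgeCount = A.halfDegree := by
  induction A using Quotient.inductionOn with
  | h L =>
    have h1 := L.map.two_mul_halfDegree L.eulerian
    have h2 := L.map.two_mul_edgeCount
    change L.map.edgeCount = L.map.halfDegree
    omega

theorem nonempty_equiv {T : PlantedTree} (hE : T.IsEulerian) (i : ℕ) :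
    Nonempty ({M : {M : MarkedMap T.Below // M.TreeStructure T (Equiv.refl _)} //
      M.1.totalMult ≤ i} ≃ {A : {A : AdmissibleMap // A.tree = T} // A.1.totalMult ≤ i}) :=
  ⟨(Equiv.ofBijective _ (bijective_ofTree hE)).subtypeEquiv fun M =>
    (congrArg (· ≤ i) (MarkedMap.totalMult_toAdmissible ⟨_, M.2.good hE⟩).symm).to_iff⟩

end AdmissibleMap

/-- The tree of a map; it is nodeless for a map without vertex. -/
noncomputable def ExtendedMap.tree : ExtendedMap → PlantedTree
  | vertexless _ => .closing
  | ofMap A => A.tree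

/-! ### The bijection, one tree at a time. -/

namespace ExtendedMap

theorem hasNode_tree_iff (M : ExtendedMap) : M.tree.HasNode ↔ ∃ A, M = ofMap A := by
  cases M with
  | vertexless μ => simp [tree, PlantedTree.HasNode]
  | ofMap A => simp [tree, A.tree_hasNode]

theorem vertexCount_eq (M : ExtendedMap) (k : ℕ) : M.tree.nodeCount k = M.vertexCount k := by
  cases M with
  | vertexless μ => rfl
  | ofMap A => exact (A.vertexCount_eq k).symm

theorem halfDegree_eq (M : ExtendedMap) : M.tree.halfDegree = M.halfDegree := by
  cases M with
  | vertexless μ => rfl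
  | ofMap A => exact A.halfDegree_eq.symm

theorem tree_isEulerian (M : ExtendedMap) : M.tree.IsEulerian := by
  cases M with
  | vertexless μ => trivial
  | ofMap A => exact A.tree_isEulerian

theorem tree_ne_opening (M : ExtendedMap) : M.tree ≠ .opening := by
  cases M with
  | vertexless μ => exact PlantedTree.noConfusion
  | ofMap A =>
    intro h
    exact (congrArg PlantedTree.HasNode h).mp A.tree_hasNode

/-- The maps without vertex, with multiplicity `j` (the unmarked one if `j = 0`). -/
def ofNat : ℕ → ExtendedMap
  | 0 => vertexless none
  | j + 1 => vertexless (some j.succPNat)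

theorem totalMult_ofNat (j : ℕ) : (ofNat j).totalMult = j := by
  cases j <;> rfl

theorem ofNat_totalMult (μ : Option ℕ+) : ofNat (vertexless μ).totalMult = vertexless μ := by
  rcases μ with _ | μ
  · rfl
  · obtain ⟨j, rfl⟩ : ∃ j : ℕ, μ = j.succPNat := ⟨_, (PNat.succPNat_natPred μ).symm⟩
    rfl

theorem tree_ofNat (j : ℕ) : (ofNat j).tree = .closing := by
  cases j <;> rfl

theorem nonempty_equiv_closing (i : ℕ) :
    Nonempty (Fin i ≃ {M : ExtendedFamily i // M.1.tree = .closing}) := by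
  refine ⟨Equiv.ofBijective
    (fun j => ⟨⟨ofNat j, by rw [totalMult_ofNat]; exact j.2⟩, tree_ofNat _⟩) ⟨?_, ?_⟩⟩
  · intro j j' h
    have := congrArg (fun M => M.1.1.totalMult) h
    simp only [totalMult_ofNat] at this
    exact Fin.ext this
  · rintro ⟨⟨M | A, hM⟩, hc⟩
    · exact ⟨⟨_, hM⟩, Subtype.ext (Subtype.ext (ofNat_totalMult M))⟩
    · have := A.tree_hasNode
      rw [show A.tree = .closing from hc] at this
      exact this.elim

theorem nonempty_equiv_tree {T : PlantedTree} (hT : T.HasNode) {i : ℕ} (hi : 1 ≤ i) :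
    Nonempty ({A : {A : AdmissibleMap // A.tree = T} // A.1.totalMult ≤ i - 1} ≃
      {M : ExtendedFamily i // M.1.tree = T}) := by
  refine ⟨Equiv.ofBijective (fun A => ⟨⟨ofMap A.1.1, ?_⟩, A.1.2⟩) ⟨?_, ?_⟩⟩
  · exact Nat.lt_of_le_pred hi A.2
  · intro A A' h
    have := congrArg (fun M => M.1.1) h
    simp only [ofMap.injEq] at this
    exact Subtype.ext (Subtype.ext this)
  · rintro ⟨⟨M | A, hM⟩, hc⟩
    · rw [← (show PlantedTree.closing = T from hc)] at hT
      exact hT.elim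
    · exact ⟨⟨⟨A, hc⟩, Nat.le_pred_of_lt hM⟩, rfl⟩

/-- Both fibres are finite of the same cardinality, `pathWeight i T.leafSteps`. Over the single
closing leaf this weight is `i`, the number of conventional maps. Non-Eulerian trees and the single
opening leaf occur on neither side. -/
theorem nonempty_equiv_enrichedTree {i : ℕ} (hi : 1 ≤ i) (T : PlantedTree) :
    Nonempty ({x : EnrichedTree i // x.tree = T} ≃ {M : ExtendedFamily i // M.1.tree = T}) := by
  have hfin := T.finite_enrichedTree i
  by_cases hT : T.IsEulerian ∧ T ≠ .opening
  · obtain ⟨hE, hne⟩ := hT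
    have h1 := PlantedTree.card_enrichedTree i hE hne
    cases T with
    | opening => exact absurd rfl hne
    | closing =>
      obtain ⟨e⟩ := nonempty_equiv_closing i
      have : Finite {M : ExtendedFamily i // M.1.tree = .closing} := Finite.of_equiv _ e
      refine Finite.card_eq.1 ?_
      rw [h1, ← Nat.card_congr e]
      simp [PlantedTree.leafSteps, pathWeight]
    | node n child =>
      have hN : (PlantedTree.node n child).HasNode := trivial
      obtain ⟨e⟩ := nonempty_equiv_tree hN hi
      -- Total multiplicity less than `i` means at most `i - 1`; `1 ≤ i` makes the path start at `(i
      -- - 1) + 1 = i`.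
      obtain ⟨e'⟩ := AdmissibleMap.nonempty_equiv hE (i - 1)
      have hf := PlantedTree.finite_treeStructure hN (i - 1)
      have : Finite {M : ExtendedFamily i // M.1.tree = .node n child} :=
        Finite.of_equiv _ (e'.trans e)
      refine Finite.card_eq.1 ?_
      rw [h1, ← Nat.card_congr (e'.trans e), PlantedTree.card_treeStructure hE rfl]
      congr 1
      omega
  · have h1 : IsEmpty {x : EnrichedTree i // x.tree = T} := by
      refine ⟨fun x => hT ?_⟩
      obtain ⟨x, rfl⟩ := x
      refine ⟨x.eulerian, fun h => ?_⟩
      have := (PlantedTree.isBlossoming_iff _).1 x.blossoming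
      rw [h] at this
      exact absurd this (by decide)
    have h2 : IsEmpty {M : ExtendedFamily i // M.1.tree = T} := by
      refine ⟨fun M => hT ?_⟩
      obtain ⟨M, rfl⟩ := M
      exact ⟨M.1.tree_isEulerian, M.1.tree_ne_opening⟩
    exact ⟨Equiv.equivOfIsEmpty _ _⟩

end ExtendedMap

theorem exists_equiv {i : ℕ} (hi : 1 ≤ i) :
    ∃ Φ : EnrichedTree i ≃ ExtendedFamily i, ∀ x, (Φ x).1.tree = x.tree := by
  let e := fun T => (ExtendedMap.nonempty_equiv_enrichedTree hi T).some
  exact ⟨Equiv.ofFiberEquiv (g := fun M : ExtendedFamily i => M.1.tree) e,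
    fun x => Equiv.ofFiberEquiv_map e x⟩


/-! ### Walks traced by the children of a node. -/

theorem pathWeight_append (h : ℤ) (L L' : List ℤ) :
    pathWeight h (L ++ L') = pathWeight h L * pathWeight (h + L.sum) L' := by
  induction L generalizing h with
  | nil => simp [pathWeight]
  | cons s L ih => rw [List.cons_append, pathWeight, pathWeight, ih, List.sum_cons, mul_assoc,
      add_assoc]

theorem pathWeight_flatten {n : ℕ} (h : ℤ) (f : Fin n → List ℤ) :
    pathWeight h (List.ofFn f).flatten =
      ∏ j : Fin n, pathWeight (h + ∑ l : Fin n, if (l : ℕ) < j then (f l).sum else 0) (f j) := by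
  induction n generalizing h with
  | zero => simp [pathWeight]
  | succ n ih =>
    rw [List.ofFn_succ, List.flatten_cons, pathWeight_append, ih, Fin.prod_univ_succ]
    congr 1
    · simp
    · refine Finset.prod_congr rfl fun j _ => ?_
      rw [Fin.sum_univ_succ]
      simp [add_assoc]

section Walks

variable {m : ℕ} (i : ℕ) (p : Fin m → Bool)

theorem walkHeight_zero : walkHeight i p 0 = i := by simp [walkHeight]

theorem walkHeight_succ (j : Fin m) :
    walkHeight i p (j + 1) = walkHeight i p j + if p j then 1 else -1 := by
  rw [walkHeight, walkHeight, add_assoc]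
  congr 1
  rw [← Finset.sum_ite_eq_of_mem' Finset.univ j (fun l => if p l then (1 : ℤ) else -1)
    (Finset.mem_univ j), ← Finset.sum_add_distrib]
  refine Finset.sum_congr rfl fun l _ => ?_
  rcases lt_trichotomy l j with h | h | h
  · have h1 : (l : ℕ) < j := h
    simp [h1, h1.trans (Nat.lt_succ_self _), h.ne]
  · subst h
    simp
  · have h1 : (j : ℕ) < l := h
    rw [if_neg (by omega), if_neg (by omega), if_neg h.ne', add_zero]

theorem walkHeight_length :
    walkHeight i p m = i + 2 * (Finset.univ.filter fun j => p j = true).card - m := by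
  have h1 : ∀ l : Fin m, (if (l : ℕ) < m then (if p l then (1 : ℤ) else -1) else 0) =
      2 * (if p l = true then 1 else 0) - 1 := by
    intro l
    rw [if_pos l.2]
    split_ifs <;> rfl
  rw [walkHeight]
  simp only [h1]
  rw [Finset.sum_sub_distrib, ← Finset.mul_sum, Finset.sum_boole, Finset.sum_const,
    Finset.card_univ, Fintype.card_fin, nsmul_one]
  ring

/-- Among `2 k - 1` steps, ending one below the start means having `k - 1` up-steps, the number of
opening children of a node of degree `2 k`. -/
theorem mem_dyckPaths {k : ℕ} (hk : 1 ≤ k) (p : Fin (2 * k - 1) → Bool) :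
    p ∈ dyckPaths k i ↔ (Finset.univ.filter fun j => p j = true).card + 1 = k ∧
      ∀ j < 2 * k, 0 ≤ walkHeight i p j := by
  simp only [dyckPaths, Finset.mem_filter, Finset.mem_univ, Finset.mem_range, true_and]
  rw [walkHeight_length, and_comm]
  refine and_congr_left fun _ => ?_
  omega

/-- A walk that becomes negative descends from height `0`. -/
theorem exists_walkHeight_eq_zero {j : ℕ} (hj : j ≤ m) (h : walkHeight i p j < 0) :
    ∃ l, p l = false ∧ walkHeight i p l = 0 := by
  induction j with
  | zero =>
    rw [walkHeight_zero] at h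
    omega
  | succ j ih =>
    by_cases h' : walkHeight i p j < 0
    · exact ih (by omega) h'
    · have := walkHeight_succ i p ⟨j, hj⟩
      simp only at this
      refine ⟨⟨j, hj⟩, ?_, ?_⟩ <;> cases hp : p ⟨j, hj⟩ <;> simp [hp] at this ⊢ <;> omega

end Walks

/-! ### Generating function of enriched trees. -/

namespace PlantedTree

/-- The number of nodes of each degree. -/
noncomputable def counts : PlantedTree → ℕ →₀ ℕ
  | opening => 0
  | closing => 0
  | node n child => Finsupp.single ((n + 1) / 2) 1 + ∑ j, (child j).counts

theorem counts_apply {T : PlantedTree} (hT : T.IsEulerian) (k : ℕ) :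
    T.counts k = T.nodeCount k := by
  induction T with
  | opening => rfl
  | closing => rfl
  | node n child ih =>
    obtain ⟨⟨m, hm, -⟩, hT⟩ := hT
    rw [counts, nodeCount, Finsupp.add_apply, Finsupp.finsetSum_apply, Finsupp.single_apply]
    congr 1
    · congr 1
      rw [eq_iff_iff]
      omega
    · exact Finset.sum_congr rfl fun j _ => ih j (hT j)

/-- The weight of a tree. -/
noncomputable def weight : PlantedTree → Series
  | opening => 1
  | closing => 1
  | node n child => PowerSeries.X ^ ((n + 1) / 2) *
      PowerSeries.C (MvPolynomial.X ((n + 1) / 2)) * ∏ j, (child j).weight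

theorem weight_eq (T : PlantedTree) : T.weight =
    PowerSeries.X ^ T.halfDegree * PowerSeries.C (MvPolynomial.monomial T.counts 1) := by
  induction T with
  | opening => simp [weight, halfDegree, counts]
  | closing => simp [weight, halfDegree, counts]
  | node n child ih =>
    have h : MvPolynomial.monomial (node n child).counts (1 : ℤ) =
        MvPolynomial.X ((n + 1) / 2) * ∏ j, MvPolynomial.monomial (child j).counts 1 := by
      rw [← MvPolynomial.monomial_sum_one, MvPolynomial.X, MvPolynomial.monomial_mul, one_mul,
        counts]
    rw [h, weight, halfDegree, Finset.prod_congr rfl fun j _ => ih j, Finset.prod_mul_distrib,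
      Finset.prod_pow_eq_pow_sum, ← map_prod, pow_add, map_mul]
    ring

/-- The weight of a tree times its number of index assignments, for paths starting at height `h`. -/
noncomputable def enrichedWeight (h : ℤ) (T : PlantedTree) : Series :=
  (pathWeight h T.leafSteps : Series) * T.weight

theorem enrichedWeight_opening (h : ℤ) : enrichedWeight h opening = 1 := by
  simp [enrichedWeight, weight, leafSteps, pathWeight]

theorem enrichedWeight_closing (h : ℤ) : enrichedWeight h closing = (h.toNat : Series) := by
  simp [enrichedWeight, weight, leafSteps, pathWeight]

/-- A path from `0` to `-1` becomes negative, so it has weight zero. This is what discards the walks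
that leave the natural numbers. -/
theorem enrichedWeight_zero {T : PlantedTree} (hT : T.IsEulerian) (hne : T ≠ opening) :
    enrichedWeight 0 T = 0 := by
  have h0 : pathWeight 0 T.leafSteps = 0 := by
    by_contra h
    have := nonneg_of_pathWeight_ne_zero le_rfl (fun s hs => by
      rcases mem_leafSteps hs with rfl | rfl <;> simp) h T.leafSteps.length
    rw [List.take_length, sum_leafSteps_of_ne hT hne] at this
    omega
  rw [enrichedWeight, h0, Nat.cast_zero, zero_mul]

/-- By `sum_leafSteps`, the heights at which the leaf-path enters the successive children are those
of the walk `p`, so the path weight factors. -/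
theorem enrichedWeight_node {n : ℕ} {child : Fin n → PlantedTree} (i : ℕ) (p : Fin n → Bool)
    (hp : ∀ j, (child j).isOpening = p j) (hT : ∀ j, (child j).IsEulerian) :
    enrichedWeight i (node n child) = PowerSeries.X ^ ((n + 1) / 2) *
      PowerSeries.C (MvPolynomial.X ((n + 1) / 2)) *
        ∏ j : Fin n, enrichedWeight (walkHeight i p j) (child j) := by
  have h : pathWeight i (node n child).leafSteps =
      ∏ j : Fin n, pathWeight (walkHeight i p j) (child j).leafSteps := by
    rw [leafSteps, pathWeight_flatten]
    simp only [walkHeight, sum_leafSteps (hT _), hp]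
  simp only [enrichedWeight]
  rw [h, weight, Finset.prod_mul_distrib, Nat.cast_prod]
  ring

open Classical in
/-- The families of children of a node of degree `2 k` with prescribed opening leaves. -/
noncomputable def children (S : Finset PlantedTree) {n : ℕ} (p : Fin n → Bool) :
    Finset (Fin n → PlantedTree) :=
  Fintype.piFinset fun j => if p j then {opening} else S

open Classical in
/-- A finite set of Eulerian trees which contains those of half-degree less than `N`. -/
noncomputable def upTo : ℕ → Finset PlantedTree
  | 0 => ∅
  | N + 1 => insert closing ((Finset.Icc 1 N).biUnion fun k =>
      (Finset.univ.filter fun p : Fin (2 * k - 1) → Bool =>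
        (Finset.univ.filter fun j => p j = true).card + 1 = k).biUnion fun p =>
          (children (upTo N) p).image (node (2 * k - 1)))

theorem mem_children {S : Finset PlantedTree} {n : ℕ} {p : Fin n → Bool}
    {child : Fin n → PlantedTree} :
    child ∈ children S p ↔ ∀ j, if p j then child j = opening else child j ∈ S := by
  rw [children, Fintype.mem_piFinset]
  refine forall_congr' fun j => ?_
  split_ifs <;> simp

theorem isOpening_of_mem_children {S : Finset PlantedTree} (hS : opening ∉ S) {n : ℕ}
    {p : Fin n → Bool} {child : Fin n → PlantedTree} (h : child ∈ children S p) (j : Fin n) :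
    (child j).isOpening = p j := by
  have := mem_children.1 h j
  cases hp : p j with
  | true =>
    rw [if_pos hp] at this
    rw [this]
    rfl
  | false =>
    rw [if_neg (by simp [hp])] at this
    cases hc : child j with
    | opening => exact absurd (hc ▸ this) hS
    | closing => rfl
    | node n child => rfl

theorem isOpening_eq_true_iff {T : PlantedTree} : T.isOpening = true ↔ T = opening := by
  cases T <;> simp [isOpening]

theorem opening_notMem_upTo (N : ℕ) : opening ∉ upTo N := by
  cases N with
  | zero => exact Finset.notMem_empty _
  | succ N => simp [upTo]

theorem isEulerian_of_mem_upTo {N : ℕ} {T : PlantedTree} (h : T ∈ upTo N) : T.IsEulerian := by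
  induction N generalizing T with
  | zero => exact absurd h (Finset.notMem_empty _)
  | succ N ih =>
    simp only [upTo, Finset.mem_insert, Finset.mem_biUnion, Finset.mem_image, Finset.mem_Icc,
      Finset.mem_filter, Finset.mem_univ, true_and] at h
    obtain rfl | ⟨k, hk, p, hp, child, hc, rfl⟩ := h
    · trivial
    · refine ⟨⟨k, by omega, ?_⟩, fun j => ?_⟩
      · simpa only [isOpening_of_mem_children (opening_notMem_upTo N) hc] using hp
      · have := mem_children.1 hc j
        split_ifs at this
        · rw [this]
          trivial
        · exact ih this

theorem mem_upTo {N : ℕ} {T : PlantedTree} (hT : T.IsEulerian) (hne : T ≠ opening)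
    (hN : T.halfDegree < N) : T ∈ upTo N := by
  induction N generalizing T with
  | zero => omega
  | succ N ih =>
    simp only [upTo, Finset.mem_insert, Finset.mem_biUnion, Finset.mem_image, Finset.mem_Icc,
      Finset.mem_filter, Finset.mem_univ, true_and]
    cases T with
    | opening => exact absurd rfl hne
    | closing => exact Or.inl rfl
    | node n child =>
      obtain ⟨⟨k, hk, hc⟩, hT⟩ := hT
      obtain rfl : n = 2 * k - 1 := by omega
      rw [halfDegree] at hN
      refine Or.inr ⟨k, by omega, fun j => (child j).isOpening, hc, child, ?_, rfl⟩
      rw [mem_children]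
      intro j
      split_ifs with h
      · exact isOpening_eq_true_iff.1 h
      · refine ih (hT j) (fun h' => h (isOpening_eq_true_iff.2 h')) ?_
        have : (child j).halfDegree ≤ ∑ j, (child j).halfDegree :=
          Finset.single_le_sum (f := fun j => (child j).halfDegree) (fun _ _ => Nat.zero_le _)
            (Finset.mem_univ j)
        omega

/-- The generating function of a finite set of trees. -/
noncomputable def upToSeries (N : ℕ) (h : ℤ) : Series := ∑ T ∈ upTo N, enrichedWeight h T

theorem upToSeries_zero (N : ℕ) : upToSeries N 0 = 0 :=
  Finset.sum_eq_zero fun _ hT => enrichedWeight_zero (isEulerian_of_mem_upTo hT)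
    fun h => opening_notMem_upTo N (h ▸ hT)

/-- The opening children prescribed by `p` have weight `1`, while the others range independently
over `upTo N`; the sum of products becomes a product of sums. -/
theorem sum_children (N i : ℕ) {k : ℕ} (hk : 1 ≤ k) (p : Fin (2 * k - 1) → Bool) :
    ∑ child ∈ children (upTo N) p, enrichedWeight i (node (2 * k - 1) child) =
      PowerSeries.X ^ k * PowerSeries.C (MvPolynomial.X k) *
        ∏ j with p j = false, upToSeries N (walkHeight i p j) := by
  have hk' : (2 * k - 1 + 1) / 2 = k := by omega
  have h1 : ∀ child ∈ children (upTo N) p, enrichedWeight i (node (2 * k - 1) child) =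
      PowerSeries.X ^ k * PowerSeries.C (MvPolynomial.X k) *
        ∏ j : Fin (2 * k - 1), enrichedWeight (walkHeight i p j) (child j) := by
    intro child hc
    rw [enrichedWeight_node i p (isOpening_of_mem_children (opening_notMem_upTo N) hc), hk']
    intro j
    have := mem_children.1 hc j
    split_ifs at this
    · rw [this]
      trivial
    · exact isEulerian_of_mem_upTo this
  rw [Finset.sum_congr rfl h1, ← Finset.mul_sum, children, ← Finset.prod_univ_sum,
    Finset.prod_filter]
  congr 1
  refine Finset.prod_congr rfl fun j _ => ?_
  cases hp : p j with
  | true => simp [enrichedWeight_opening]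
  | false => simp [upToSeries]

/-- The left sum allows walks that become negative. Each of them has a down-step from height `0`,
where its factor is `upToSeries N 0 = 0`. -/
theorem pathSum_upToSeries (N i : ℕ) {k : ℕ} (hk : 1 ≤ k) :
    ∑ p : Fin (2 * k - 1) → Bool with (Finset.univ.filter fun j => p j = true).card + 1 = k,
      ∏ j with p j = false, upToSeries N (walkHeight i p j) =
    pathSum (fun i => upToSeries N i) k i := by
  rw [pathSum]
  symm
  have h2 : dyckPaths k i ⊆ Finset.univ.filter fun p : Fin (2 * k - 1) → Bool =>
      (Finset.univ.filter fun j => p j = true).card + 1 = k := fun p hp =>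
    Finset.mem_filter.2 ⟨Finset.mem_univ _, ((mem_dyckPaths i hk p).1 hp).1⟩
  refine (Finset.sum_congr rfl fun p hp => Finset.prod_congr rfl fun j _ => ?_).trans
    (Finset.sum_subset h2 fun p hp hp' => ?_)
  · rw [Int.toNat_of_nonneg (((mem_dyckPaths i hk p).1 hp).2 j (by omega))]
  · have : ∃ j < 2 * k, walkHeight i p j < 0 := by
      by_contra hne
      push Not at hne
      exact hp' ((mem_dyckPaths i hk p).2 ⟨(Finset.mem_filter.1 hp).2, hne⟩)
    obtain ⟨j, hj, hneg⟩ := this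
    obtain ⟨l, hl, h0⟩ := exists_walkHeight_eq_zero i p (by omega) hneg
    refine Finset.prod_eq_zero (i := l) (by simp [hl]) ?_
    rw [h0, upToSeries_zero]

/-- Decomposition at the root node: the single closing leaf gives `i`, and the trees with a root
node of degree `2 k` give the term of index `k`. -/
theorem upToSeries_succ (N i : ℕ) : upToSeries (N + 1) i = (i : Series) +
    ∑ k ∈ Finset.Icc 1 N, PowerSeries.X ^ k * PowerSeries.C (MvPolynomial.X k) *
      pathSum (fun i => upToSeries N i) k i := by
  classical
  rw [upToSeries, upTo, Finset.sum_insert (by simp), enrichedWeight_closing, Int.toNat_natCast,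
    Finset.sum_biUnion]
  · congr 1
    refine Finset.sum_congr rfl fun k hk => ?_
    have hk1 := (Finset.mem_Icc.1 hk).1
    rw [Finset.sum_biUnion, ← pathSum_upToSeries N i hk1, Finset.mul_sum]
    · refine Finset.sum_congr rfl fun p _ => ?_
      rw [Finset.sum_image, sum_children N i hk1]
      intro c _ c' _ h
      simpa using h
    · intro p _ p' _ hpp
      rw [Function.onFun, Finset.disjoint_left]
      intro T hT hT'
      obtain ⟨c, hc, rfl⟩ := Finset.mem_image.1 hT
      obtain ⟨c', hc', h⟩ := Finset.mem_image.1 hT'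
      obtain rfl : c' = c := by simpa using h
      refine hpp (funext fun j => ?_)
      rw [← isOpening_of_mem_children (opening_notMem_upTo N) hc,
        ← isOpening_of_mem_children (opening_notMem_upTo N) hc']
  · intro k hk k' hk' hkk
    rw [Function.onFun, Finset.disjoint_left]
    intro T hT hT'
    simp only [Finset.mem_biUnion, Finset.mem_image] at hT hT'
    obtain ⟨p, -, c, -, rfl⟩ := hT
    obtain ⟨p', -, c', -, h⟩ := hT'
    have := (node.inj h).1
    have := (Finset.mem_Icc.1 hk).1
    have := (Finset.mem_Icc.1 hk').1
    omega

theorem coeff_upToSeries (N : ℕ) : ∀ i : ℕ, ∀ m < N,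
    PowerSeries.coeff m (upToSeries N i) = PowerSeries.coeff m (rSeries i) := by
  induction N with
  | zero => intro i m hm; omega
  | succ N ih =>
    intro i m hm
    rw [rSeries_system, ← systemRHS_congr ih i m hm, upToSeries_succ, systemRHS, map_add, map_add,
      map_sum, PowerSeries.coeff_mk]
    congr 1
    -- Terms with `k > m` are divisible by a higher power of `t` and do not reach the coefficient
    -- considered.
    have hsub : Finset.Icc 1 m ⊆ Finset.Icc 1 N := Finset.Icc_subset_Icc_right (by omega)
    refine ((Finset.sum_congr rfl fun k hk => ?_).trans (Finset.sum_subset hsub fun k _ hk => ?_)).symm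
    · rw [mul_assoc, PowerSeries.coeff_X_pow_mul', if_pos (Finset.mem_Icc.1 hk).2,
        PowerSeries.coeff_C_mul]
    · rw [mul_assoc, PowerSeries.coeff_X_pow_mul', if_neg]
      rw [Finset.mem_Icc] at *
      omega

theorem coeff_enrichedWeight (h : ℤ) {T : PlantedTree} (hT : T.IsEulerian) (E : ℕ) (m : ℕ →₀ ℕ)
    [Decidable (T.halfDegree = E ∧ ∀ k, T.nodeCount k = m k)] :
    MvPolynomial.coeff m (PowerSeries.coeff E (enrichedWeight h T)) =
      if T.halfDegree = E ∧ ∀ k, T.nodeCount k = m k then (pathWeight h T.leafSteps : ℤ) else 0 := by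
  classical
  have h1 : T.halfDegree = E ∧ (∀ k, T.nodeCount k = m k) ↔ T.halfDegree = E ∧ T.counts = m := by
    refine and_congr_right fun _ => ?_
    rw [Finsupp.ext_iff]
    simp only [counts_apply hT]
  rw [if_congr h1 rfl rfl, enrichedWeight, weight_eq, ← nsmul_eq_mul, map_nsmul, PowerSeries.coeff_X_pow_mul',
    MvPolynomial.coeff_smul, PowerSeries.coeff_C]
  by_cases h2 : T.halfDegree = E
  · by_cases h3 : T.counts = m
    · simp [h2, h3]
    · simp [h2, h3, MvPolynomial.coeff_monomial]
  · have h3 : T.halfDegree ≤ E → E - T.halfDegree ≠ 0 := by omega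
    by_cases h4 : T.halfDegree ≤ E
    · simp [h2, h4, h3 h4]
    · simp [h2, h4]

end PlantedTree

/-! ### Counting series of trees and maps. -/

open PlantedTree

theorem EnrichedTree.tree_ne_opening {i : ℕ} (x : EnrichedTree i) : x.tree ≠ opening := by
  intro h
  have := (isBlossoming_iff _).1 x.blossoming
  rw [h] at this
  exact absurd this (by decide)

/-- Enriched trees with a property of the tree are counted by summing over the trees. -/
theorem card_enrichedTree_eq_sum (i : ℕ) (S : Finset PlantedTree) (P : PlantedTree → Prop)
    (hS : ∀ T, T ∈ S ↔ T.IsEulerian ∧ T ≠ opening ∧ P T) :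
    Finite {x : EnrichedTree i // P x.tree} ∧
      Nat.card {x : EnrichedTree i // P x.tree} = ∑ T ∈ S, pathWeight i T.leafSteps := by
  let e : {x : EnrichedTree i // P x.tree} ≃ Σ T : S, {x : EnrichedTree i // x.tree = T} :=
    { toFun := fun x => ⟨⟨x.1.tree, (hS _).2 ⟨x.1.eulerian, x.1.tree_ne_opening, x.2⟩⟩, x.1, rfl⟩
      invFun := fun y => ⟨y.2.1, by rw [y.2.2]; exact ((hS _).1 y.1.2).2.2⟩
      left_inv := fun _ => rfl
      right_inv := by
        rintro ⟨⟨T, hT⟩, x, hx⟩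
        obtain rfl : x.tree = T := hx
        rfl }
  have := fun T => finite_enrichedTree i T
  refine ⟨Finite.of_equiv _ e.symm, ?_⟩
  rw [Nat.card_congr e, Nat.card_sigma, ← Finset.sum_coe_sort S fun T => pathWeight i T.leafSteps]
  refine Finset.sum_congr rfl fun T _ => ?_
  obtain ⟨hE, hne, -⟩ := (hS _).1 T.2
  exact card_enrichedTree i hE hne

theorem isCountingSeries_enrichedTree (i : ℕ) :
    IsCountingSeries (fun x : EnrichedTree i => x.tree.halfDegree)
      (fun k x => x.tree.nodeCount k) (rSeries i) := by
  classical
  constructor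
  · intro E
    refine (card_enrichedTree_eq_sum i ((upTo (E + 1)).filter fun T => T.halfDegree = E)
      (fun T => T.halfDegree = E) fun T => ?_).1
    rw [Finset.mem_filter]
    exact ⟨fun h => ⟨isEulerian_of_mem_upTo h.1, fun h' => opening_notMem_upTo _ (h' ▸ h.1), h.2⟩,
      fun h => ⟨mem_upTo h.1 h.2.1 (by omega), h.2.2⟩⟩
  · intro E m
    rw [(card_enrichedTree_eq_sum i ((upTo (E + 1)).filter fun T =>
      T.halfDegree = E ∧ ∀ k, T.nodeCount k = m k)
      (fun T => T.halfDegree = E ∧ ∀ k, T.nodeCount k = m k) fun T => ?_).2,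
      ← coeff_upToSeries (E + 1) i E (Nat.lt_succ_self E), upToSeries, map_sum,
      MvPolynomial.coeff_sum, Finset.sum_congr rfl fun T hT =>
        coeff_enrichedWeight i (isEulerian_of_mem_upTo hT) E m, ← Finset.sum_filter, Nat.cast_sum]
    rw [Finset.mem_filter]
    exact ⟨fun h => ⟨isEulerian_of_mem_upTo h.1, fun h' => opening_notMem_upTo _ (h' ▸ h.1), h.2⟩,
      fun h => ⟨mem_upTo h.1 h.2.1 (by omega), h.2.2⟩⟩

theorem IsCountingSeries.of_equiv {α β : Type} {size : α → ℕ} {count : ℕ → α → ℕ} {F : Series}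
    (h : IsCountingSeries size count F) (e : α ≃ β) {size' : β → ℕ} {count' : ℕ → β → ℕ}
    (hs : ∀ a, size a = size' (e a)) (hc : ∀ k a, count k a = count' k (e a)) :
    IsCountingSeries size' count' F := by
  constructor
  · intro E
    have := h.1 E
    exact Finite.of_equiv {a // size a = E} (e.subtypeEquiv fun a => by rw [hs])
  · intro E m
    rw [h.2]
    exact congrArg _ (Nat.card_congr (e.subtypeEquiv fun a => by rw [hs]; simp only [hc]))


/-- The objects of a given weight in a disjoint sum are finite in number, and their counts add up;
used to remove the conventional maps from the extended family. -/
theorem IsCountingSeries.of_sum {α β : Type} {size : α → ℕ} {count : ℕ → α → ℕ} {size' : β → ℕ}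
    {count' : ℕ → β → ℕ} {F G : Series}
    (h : IsCountingSeries (Sum.elim size size') (fun k => Sum.elim (count k) (count' k)) F)
    (h' : IsCountingSeries size' count' G) : IsCountingSeries size count (F - G) := by
  have hfin : ∀ E, Finite {a : α // size a = E} := fun E => by
    have := h.1 E
    exact Finite.of_injective (fun a : {a : α // size a = E} =>
      (⟨.inl a.1, a.2⟩ : {c : α ⊕ β // Sum.elim size size' c = E}))
      fun a a' h => Subtype.ext (Sum.inl_injective (congrArg Subtype.val h))
  refine ⟨hfin, fun E m => ?_⟩
  have := hfin E
  have := h'.1 E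
  have : Finite {a : α // size a = E ∧ ∀ k, count k a = m k} :=
    Finite.of_injective (Subtype.impEmbedding _ _ fun _ => And.left)
      (Function.Embedding.injective _)
  have : Finite {b : β // size' b = E ∧ ∀ k, count' k b = m k} :=
    Finite.of_injective (Subtype.impEmbedding _ _ fun _ => And.left)
      (Function.Embedding.injective _)
  have hcard : Nat.card {c : α ⊕ β // Sum.elim size size' c = E ∧
      ∀ k, Sum.elim (count k) (count' k) c = m k} =
      Nat.card {a // size a = E ∧ ∀ k, count k a = m k} +
        Nat.card {b // size' b = E ∧ ∀ k, count' k b = m k} :=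
    (Nat.card_congr Equiv.subtypeSum).trans
      (Nat.card_sum (α := {a // size a = E ∧ ∀ k, count k a = m k})
        (β := {b // size' b = E ∧ ∀ k, count' k b = m k}))
  rw [map_sub, MvPolynomial.coeff_sub, h.2, h'.2, hcard, Nat.cast_add, add_sub_cancel_right]

theorem isCountingSeries_fin (i : ℕ) :
    IsCountingSeries (fun _ : Fin i => 0) (fun _ _ => 0) (i : Series) := by
  classical
  refine ⟨fun E => inferInstance, fun E m => ?_⟩
  have h1 : (i : Series) = PowerSeries.C (MvPolynomial.C (i : ℤ)) := by simp
  rw [h1, PowerSeries.coeff_C]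
  have h2 : (∀ k, 0 = m k) ↔ 0 = m := by
    rw [Finsupp.ext_iff]
    rfl
  simp only [h2]
  by_cases hE : E = 0
  · by_cases hm : 0 = m
    · rw [if_pos hE, MvPolynomial.coeff_C, if_pos hm]
      simp [hE, hm]
    · rw [if_pos hE, MvPolynomial.coeff_C, if_neg hm]
      simp [hm]
  · rw [if_neg hE, MvPolynomial.coeff_zero]
    simp [Ne.symm hE]

/-- The maps with at least one vertex and those without. -/
theorem exists_sum_equiv (i : ℕ) : ∃ e : MapFamily i ⊕ Fin i ≃ ExtendedFamily i,
    (∀ A, (e (.inl A)).1 = .ofMap A.1) ∧ ∀ j, (e (.inr j)).1 = ExtendedMap.ofNat j := by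
  refine ⟨Equiv.ofBijective (Sum.elim (fun A => ⟨.ofMap A.1, A.2⟩)
    fun j => ⟨.ofNat j, by rw [ExtendedMap.totalMult_ofNat]; exact j.2⟩) ⟨?_, ?_⟩,
    fun _ => rfl, fun _ => rfl⟩
  · have hne : ∀ (A : AdmissibleMap) j, ExtendedMap.ofMap A ≠ .ofNat j := by
      rintro A (_ | j) h <;> cases h
    rintro (A | j) (A' | j') h
    · have : ExtendedMap.ofMap A.1 = .ofMap A'.1 := congrArg Subtype.val h
      rw [Subtype.ext (ExtendedMap.ofMap.inj this)]
    · exact absurd (congrArg Subtype.val h) (hne _ _)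
    · exact absurd (congrArg Subtype.val h).symm (hne _ _)
    · have : (ExtendedMap.ofNat j).totalMult = (ExtendedMap.ofNat j').totalMult :=
        congrArg (fun M : ExtendedFamily i => M.1.totalMult) h
      rw [ExtendedMap.totalMult_ofNat, ExtendedMap.totalMult_ofNat] at this
      rw [Fin.ext this]
  · rintro ⟨M | A, hM⟩
    · exact ⟨.inr ⟨_, hM⟩, Subtype.ext (ExtendedMap.ofNat_totalMult M)⟩
    · exact ⟨.inl ⟨A, hM⟩, rfl⟩

theorem IsCountingSeries.mapFamily {i : ℕ} {F : Series}
    (h : IsCountingSeries (fun M : ExtendedFamily i => M.1.halfDegree)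
      (fun k M => M.1.vertexCount k) F) :
    IsCountingSeries (fun M : MapFamily i => M.1.halfDegree)
      (fun k M => M.1.vertexCount k) (F - (i : Series)) := by
  obtain ⟨e, he, he'⟩ := exists_sum_equiv i
  refine IsCountingSeries.of_sum (h.of_equiv e.symm ?_ ?_) (isCountingSeries_fin i)
  · intro M
    obtain ⟨A | j, rfl⟩ := e.surjective M
    · rw [he, e.symm_apply_apply]
      rfl
    · rw [he', e.symm_apply_apply]
      cases (j : ℕ) <;> rfl
  · intro k M
    obtain ⟨A | j, rfl⟩ := e.surjective M
    · rw [he, e.symm_apply_apply]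
      rfl
    · rw [he', e.symm_apply_apply]
      cases (j : ℕ) <;> rfl

end EulerianMaps

theorem mainTheorem3 (i : ℕ) (hi : 1 ≤ i) :
    (∃ Φ : EnrichedTree i ≃ ExtendedFamily i, ∀ T : EnrichedTree i,
      (T.tree.HasNode ↔ ∃ M : AdmissibleMap, (Φ T).1 = ExtendedMap.ofMap M) ∧
      (∀ k : ℕ, T.tree.nodeCount k = (Φ T).1.vertexCount k) ∧
      T.tree.halfDegree = (Φ T).1.halfDegree) ∧
    (∀ M : MapFamily i, M.1.edgeCount = M.1.halfDegree) ∧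
    IsCountingSeries (fun T : EnrichedTree i => T.tree.halfDegree)
      (fun k T => T.tree.nodeCount k) (rSeries i) ∧
    IsCountingSeries (fun M : ExtendedFamily i => M.1.halfDegree)
      (fun k M => M.1.vertexCount k) (rSeries i) ∧
    IsCountingSeries (fun M : MapFamily i => M.1.halfDegree)
      (fun k M => M.1.vertexCount k) (rSeries i - (i : Series)) := by
  obtain ⟨Φ, hΦ⟩ := exists_equiv hi
  have hv : ∀ k T, T.tree.nodeCount k = (Φ T).1.vertexCount k := fun k T => by
    rw [← hΦ, ExtendedMap.vertexCount_eq]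
  have hd : ∀ T, T.tree.halfDegree = (Φ T).1.halfDegree := fun T => by
    rw [← hΦ, ExtendedMap.halfDegree_eq]
  have hext : IsCountingSeries (fun M : ExtendedFamily i => M.1.halfDegree)
      (fun k M => M.1.vertexCount k) (rSeries i) :=
    (isCountingSeries_enrichedTree i).of_equiv Φ hd hv
  refine ⟨⟨Φ, fun T => ⟨?_, fun k => hv k T, hd T⟩⟩, fun M => M.1.edgeCount_eq,
    isCountingSeries_enrichedTree i, hext, hext.mapFamily⟩
  rw [← hΦ, ExtendedMap.hasNode_tree_iff]
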